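/- Let $M$ be a compact one-dimensional smooth manifold, possibly with boundary, and $L : M \to \mathbb R^3$ a smooth embedding. A diagram $\Gamma$ with support $M$ is a finite simple graph with vertex set $V = U \sqcup T$ and edge set $E$, where the elements of $U$ are univalent, the elements of $T$ are trivalent and every connected component meets $U$, together with an isotopy class of injections of $U$ into the interior of $M$. Its configuration space $C_\Gamma = C_\Gamma(L)$ is the set of the maps $x : V \to \mathbb R^3$ which are injective on each edge and coincide on $U$ with $L \circ i$ for some $i$ in the isotopy class; it is a submanifold of $(\mathbb R^3)^V$ of dimension $n = \#U + 3\,\#T = 2\,\#E$. When all edges are oriented, $\Psi : C_\Gamma \to (S^2)^E$ sends $x$ to the directions of $x(v') - x(v)$, for the edges $e = (v, v')$. For a finite set $A$ with at least two elements, let $C^A$ be the sphere of nonconstant maps $A \to \mathbb R^3$ modulo translations and dilations (positive homotheties). Let $G$ be the graph with vertex set $V$ whose edges are those of $\Gamma$ plus all pairs of elements of $U$; let $R$ be the set of the connected subsets $A \subseteq V$ of $G$ with $\#A \ge 2$; let $\mathcal H(G) \subseteq \prod_{A \in R} C^A$ be the set of the $(x_A)_{A\in R}$ such that whenever $A \subseteq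 B$, the restriction of $x_B$ to $A$ is either constant or equal to $x_A$. Sending $x$ to its restrictions to the sets $A \in R$ and to the $i$ with $x|_U = L \circ i$ defines a canonical map $C_\Gamma \to \mathcal H(G) \times M^U$. Then, for every diagram $\Gamma$: (1) There are a compact Hausdorff smooth $n$-dimensional manifold with corners $\overline{C_\Gamma}$ and a diffeomorphism of $C_\Gamma$ onto the interior of $\overline{C_\Gamma}$, which is dense in $\overline{C_\Gamma}$, such that the canonical map extends to a smooth map $k$ from $\overline{C_\Gamma}$ onto the closure of the image of $C_\Gamma$ in $\mathcal H(G) \times M^U$ (smooth meaning that all the components $\overline{C_\Gamma} \to C^A$ and $\overline{C_\Gamma} \to M$ are smooth); if $\#U \ne 1$, then $k$ is moreover a topological embedding and an immersion at every point of $\overline{C_\Gamma}$, so that $\overline{C_\Gamma}$ is this closure. For every orientation of the edges, $\Psi$ extends to a smooth map $\overline{C_\Gamma} \to (S^2)^E$. (2) Consequently the configuration space integral $I_L(\Gamma) = \int_{C_\Gamma} \Psi^*\Omega$ converges absolutely, for all choices of orientations, where $\Omega = \bigwedge^E \omega$ and $\omega$ is the standard volume form of total mass $1$ on $S^2$. 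-/

import Mathlib

open scoped Manifold ContDiff Topology
open MeasureTheory

universe u v w

noncomputable section

/-- Euclidean three-space. -/
abbrev E3 : Type := EuclideanSpace ℝ (Fin 3)

/-- The unit sphere `S²` of `ℝ³`. -/
abbrev S2 : Type := Metric.sphere (0 : E3) 1

/-! ### Maps modulo translations and dilations -/

/-- `g` is the image of `f` under a translation-dilation `y ↦ c y + b`, `c > 0`. -/
def TransDil {A : Type*} (f g : A → E3) : Prop :=
  ∃ c : ℝ, 0 < c ∧ ∃ b : E3, ∀ a, g a = c • f a + b

/-- The space `C^A` of nonconstant maps `A → ℝ³` modulo translations and dilations, realised as the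
sphere of the representatives with barycentre `0` and square norm `1`
(see `SphereMaps.existsUnique`). -/
abbrev SphereMaps (A : Type*) [Fintype A] : Type _ :=
  {f : A → E3 // ∑ a, f a = 0 ∧ ∑ a, ‖f a‖ ^ 2 = 1}

/-- Every nonconstant map has exactly one representative in `SphereMaps A`. -/
theorem SphereMaps.existsUnique {A : Type*} [Fintype A] (f : A → E3)
    (hf : ∃ a a', f a ≠ f a') : ∃! g : SphereMaps A, TransDil g.1 f := by
  obtain ⟨a₁, a₂, h12⟩ := hf
  have hcard : (Fintype.card A : ℝ) ≠ 0 := by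
    have : 0 < Fintype.card A := Fintype.card_pos_iff.2 ⟨a₁⟩
    positivity
  set m : E3 := (Fintype.card A : ℝ)⁻¹ • ∑ a, f a with hm
  have hsum : ∑ a, (f a - m) = 0 := by
    rw [Finset.sum_sub_distrib, Finset.sum_const, Finset.card_univ, hm, ← Nat.cast_smul_eq_nsmul ℝ,
      smul_smul, mul_inv_cancel₀ hcard, one_smul, sub_self]
  set q : ℝ := ∑ a, ‖f a - m‖ ^ 2 with hq
  have hqpos : 0 < q := by
    have h0 : 0 ≤ q := Finset.sum_nonneg fun _ _ => by positivity
    refine lt_of_le_of_ne h0 fun h => h12 ?_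
    have hz := (Finset.sum_eq_zero_iff_of_nonneg
      (fun a _ => by positivity : ∀ a ∈ Finset.univ, 0 ≤ ‖f a - m‖ ^ 2)).1 h.symm
    have e1 : f a₁ - m = 0 := by simpa using hz a₁ (Finset.mem_univ _)
    have e2 : f a₂ - m = 0 := by simpa using hz a₂ (Finset.mem_univ _)
    rw [sub_eq_zero.1 e1, sub_eq_zero.1 e2]
  set r : ℝ := Real.sqrt q with hr
  have hrpos : 0 < r := Real.sqrt_pos.2 hqpos
  have hrsq : r ^ 2 = q := Real.sq_sqrt hqpos.le
  refine ⟨⟨fun a => r⁻¹ • (f a - m), ?_, ?_⟩, ⟨r, hrpos, m, fun a => ?_⟩, ?_⟩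
  · rw [← Finset.smul_sum, hsum, smul_zero]
  · have : ∀ a, ‖r⁻¹ • (f a - m)‖ ^ 2 = (r ^ 2)⁻¹ * ‖f a - m‖ ^ 2 := fun a => by
      rw [norm_smul, mul_pow, Real.norm_eq_abs, sq_abs, inv_pow]
    simp only [this]
    rw [← Finset.mul_sum, ← hq, hrsq, inv_mul_cancel₀ hqpos.ne']
  · simp [smul_smul, mul_inv_cancel₀ hrpos.ne']
  · rintro ⟨g, hg0, hg1⟩ ⟨c, hc, b, hgb⟩
    have hb : m = b := by
      rw [hm]
      simp only [hgb]
      rw [Finset.sum_add_distrib, ← Finset.smul_sum, hg0, smul_zero, zero_add, Finset.sum_const,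
        Finset.card_univ, ← Nat.cast_smul_eq_nsmul ℝ, smul_smul, inv_mul_cancel₀ hcard, one_smul]
    have hd : ∀ a, f a - m = c • g a := fun a => by rw [hb, hgb a, add_sub_cancel_right]
    have hqc : q = c ^ 2 := by
      rw [hq]
      have : ∀ a, ‖f a - m‖ ^ 2 = c ^ 2 * ‖g a‖ ^ 2 := fun a => by
        rw [hd, norm_smul, mul_pow, Real.norm_eq_abs, sq_abs]
      simp only [this]
      rw [← Finset.mul_sum, hg1, mul_one]
    have hrc : r = c := by rw [hr, hqc, Real.sqrt_sq hc.le]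
    apply Subtype.ext
    funext a
    show g a = r⁻¹ • (f a - m)
    rw [hd, hrc, smul_smul, inv_mul_cancel₀ hc.ne', one_smul]

/-! ### Diagrams -/

section Diagrams

variable (U : Type v) (T : Type w) (M : Type u)
  [TopologicalSpace M] [ChartedSpace (EuclideanHalfSpace 1) M]

/-- The injections of `U` into the interior of the one-dimensional manifold `M`. -/
def interiorInjections : Set (U → M) :=
  {i | Function.Injective i ∧ ∀ a, i a ∈ (𝓡∂ 1).interior M}

/-- A diagram with support `M`, with set `U` of univalent vertices and set `T` of trivalent
vertices: a (simple) graph on `U ⊔ T`, every component of which meets `U`, and an isotopy class of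
injections of `U` into the interior of `M`. -/
structure Diagram where
  graph : SimpleGraph (U ⊕ T)
  univalent : ∀ a : U, (graph.neighborSet (Sum.inl a)).ncard = 1
  trivalent : ∀ t : T, (graph.neighborSet (Sum.inr t)).ncard = 3
  meets : ∀ x : U ⊕ T, ∃ a : U, graph.Reachable x (Sum.inl a)
  cls : Set (U → M)
  isotopy : ∃ i₀ ∈ interiorInjections U M, cls = pathComponentIn (interiorInjections U M) i₀

end Diagrams

namespace Diagram

variable {U : Type v} {T : Type w} {M : Type u}
  [TopologicalSpace M] [ChartedSpace (EuclideanHalfSpace 1) M]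

/-- The configuration space `C_Γ(L)`: the maps from the vertices to `ℝ³` which are injective on each
edge, and which coincide on `U` with `L ∘ i` for some `i` in the isotopy class. -/
def configSpace (Γ : Diagram U T M) (L : M → E3) : Set (U ⊕ T → E3) :=
  {x | (∀ p q, Γ.graph.Adj p q → x p ≠ x q) ∧ ∃ i ∈ Γ.cls, ∀ a, x (Sum.inl a) = L (i a)}

/-- An orientation of all edges. -/
structure EdgeOrientation (Γ : Diagram U T M) where
  tail : Γ.graph.edgeSet → U ⊕ T
  head : Γ.graph.edgeSet → U ⊕ T
  edge_eq : ∀ e, s(tail e, head e) = (e : Sym2 (U ⊕ T))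

/-- The `e` component of the direction map `Ψ`: the direction of `x (head e) - x (tail e)`. -/
def directionMap {Γ : Diagram U T M} (o : Γ.EdgeOrientation) (x : U ⊕ T → E3)
    (e : Γ.graph.edgeSet) : E3 :=
  ‖x (o.head e) - x (o.tail e)‖⁻¹ • (x (o.head e) - x (o.tail e))

/-! ### The ambient space of the compactification -/

/-- The graph `G`: the edges of `Γ`, plus all pairs of univalent vertices. -/
def fullGraph (Γ : Diagram U T M) : SimpleGraph (U ⊕ T) :=
  Γ.graph ⊔ SimpleGraph.fromRel fun p q => p.isLeft ∧ q.isLeft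

/-- The set `R` of the connected sets of at least two vertices of `G`. -/
abbrev ConnectedSets (Γ : Diagram U T M) : Type (max v w) :=
  {A : Finset (U ⊕ T) // 2 ≤ A.card ∧ (Γ.fullGraph.induce (A : Set (U ⊕ T))).Connected}

/-- The product of the spheres `C^A`, `A ∈ R`. -/
abbrev SphereProduct (Γ : Diagram U T M) : Type (max v w) :=
  ∀ A : Γ.ConnectedSets, SphereMaps A.1

/-- The subspace `H(G)` of `∏ C^A`: if `A ⊆ B`, the restriction of `x_B` to `A` is either constant
or equal to `x_A` (modulo translations and dilations). -/
def graphSpace (Γ : Diagram U T M) : Set Γ.SphereProduct :=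
  {x | ∀ (A B : Γ.ConnectedSets) (h : A.1 ⊆ B.1),
    (∃ b : E3, ∀ a : A.1, (x B).1 ⟨a.1, h a.2⟩ = b) ∨
      TransDil (x A).1 (fun a : A.1 => (x B).1 ⟨a.1, h a.2⟩)}

/-- `p` is the point of `∏ C^A × M^U` given by the configuration `x`: its `C^A` component is the
class of `x` restricted to `A`, and its `M^U` component is the `i` with `x = L ∘ i` on `U`. -/
def IsImage (Γ : Diagram U T M) (L : M → E3) (x : U ⊕ T → E3)
    (p : Γ.SphereProduct × (U → M)) : Prop :=
  (∀ A : Γ.ConnectedSets, TransDil (p.1 A).1 (fun a : A.1 => x a.1)) ∧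
    ∀ a : U, L (p.2 a) = x (Sum.inl a)

/-- The closure of (the image of) `C_Γ` in `H(G) × M^U`. -/
def closedConfigSpace (Γ : Diagram U T M) (L : M → E3) : Set (Γ.SphereProduct × (U → M)) :=
  closure {p | ∃ x ∈ Γ.configSpace L, Γ.IsImage L x p} ∩ {p | p.1 ∈ Γ.graphSpace}

end Diagram

/-! ### Compactifications into manifolds with corners -/

/-- The model `[0, ∞[ⁿ ⊆ ℝⁿ` of the `n`-dimensional manifolds with corners. -/
abbrev cornerModel (n : ℕ) :
    ModelWithCorners ℝ (EuclideanSpace ℝ (Fin n)) (EuclideanQuadrant n) :=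
  modelWithCornersEuclideanQuadrant n

/-- `j : X → N` is a compactification of the submanifold `X` of the vector space `F` into a smooth
`n`-dimensional manifold with corners `N`: the space `N` is compact Hausdorff, and `j` is a
diffeomorphism of `X` onto the interior of `N`, which is dense. That `j` is a diffeomorphism means
that it is a homeomorphism onto the interior, whose inverse is a smooth immersion into `F`. -/
structure IsCornerCompactification (n : ℕ) {F : Type*} [NormedAddCommGroup F] [NormedSpace ℝ F]
    (X : Set F) (N : Type*) [TopologicalSpace N] [ChartedSpace (EuclideanQuadrant n) N]
    (j : X → N) : Prop where
  isManifold : IsManifold (cornerModel n) ∞ N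
  compactSpace : CompactSpace N
  t2Space : T2Space N
  isEmbedding : Topology.IsEmbedding j
  range_eq : Set.range j = (cornerModel n).interior N
  denseRange : DenseRange j
  diffeo : ∃ g : N → F, (∀ x : X, g (j x) = x) ∧ ∀ p ∈ (cornerModel n).interior N,
    ContMDiffAt (cornerModel n) 𝓘(ℝ, F) ∞ g p ∧
      Function.Injective (mfderiv (cornerModel n) 𝓘(ℝ, F) g p)

namespace Diagram

variable {U : Type v} {T : Type w} {M : Type u}
  [TopologicalSpace M] [ChartedSpace (EuclideanHalfSpace 1) M]

/-- `k : N → ∏ C^A × M^U` is a smooth map (all its components are) which extends the canonical map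
of the configuration space, and its image is the closure of the configuration space. -/
structure IsClosureMap [Fintype U] [Fintype T] (Γ : Diagram U T M) (L : M → E3) (n : ℕ)
    {N : Type*} [TopologicalSpace N] [ChartedSpace (EuclideanQuadrant n) N]
    (j : Γ.configSpace L → N) (k : N → Γ.SphereProduct × (U → M)) : Prop where
  smooth_left : ∀ A : Γ.ConnectedSets,
    ContMDiff (cornerModel n) 𝓘(ℝ, A.1 → E3) ∞ (fun p => ((k p).1 A).1)
  smooth_right : ∀ a : U, ContMDiff (cornerModel n) (𝓡∂ 1) ∞ (fun p => (k p).2 a)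
  extends_canonical : ∀ x : Γ.configSpace L, Γ.IsImage L x.1 (k (j x))
  range_eq : Set.range k = Γ.closedConfigSpace L

/-- `k : N → ∏ C^A × M^U` is a topological embedding, and an immersion at every point of `N`,
corners included: a tangent vector which is killed by all components of `k` vanishes. -/
structure IsImmersedEmbedding [Fintype U] [Fintype T] (Γ : Diagram U T M) (n : ℕ)
    {N : Type*} [TopologicalSpace N] [ChartedSpace (EuclideanQuadrant n) N]
    (k : N → Γ.SphereProduct × (U → M)) : Prop where
  isEmbedding : Topology.IsEmbedding k
  immersion : ∀ (p : N) (ξ : TangentSpace (cornerModel n) p),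
    (∀ A : Γ.ConnectedSets,
      mfderiv (cornerModel n) 𝓘(ℝ, A.1 → E3) (fun q => ((k q).1 A).1) p ξ = 0) →
    (∀ a : U, mfderiv (cornerModel n) (𝓡∂ 1) (fun q => (k q).2 a) p ξ = 0) → ξ = 0

/-! ### The configuration space integral -/

/-- A continuous field of unit tangent vectors along `L`, that is, an orientation of `M`. -/
structure IsUnitTangent (L : M → E3) (s : E3 → E3) : Prop where
  continuousOn : ContinuousOn s (Set.range L)
  norm_eq : ∀ m, ‖s (L m)‖ = 1
  tangent : ∀ m, ∃ ξ, mfderiv (𝓡∂ 1) 𝓘(ℝ, E3) L m ξ = s (L m)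

/-- The basis of the tangent space of `C_Γ` at `x` given by the unit tangent vectors to the curve
at the univalent vertices, and the standard basis of `ℝ³` at the trivalent vertices. -/
def coordVector (s : U → E3 → E3) (x : U ⊕ T → E3) : U ⊕ (T × Fin 3) → (U ⊕ T → E3) := by
  classical
  exact fun c => match c with
    | Sum.inl a => Pi.single (Sum.inl a) (s a (x (Sum.inl a)))
    | Sum.inr (t, l) => Pi.single (Sum.inr t) (EuclideanSpace.single l 1)

/-- Vectors of `(ℝ³)^E`, in coordinates: the outer normals to the factors of `(S²)^E` at `Ψ(x)`, and
the images under `dΨ` of the basis `coordVector` of the tangent space of `C_Γ` at `x`. -/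
def pullbackColumn {Γ : Diagram U T M} [Fintype U] [Fintype T] (o : Γ.EdgeOrientation)
    (s : U → E3 → E3) (x : U ⊕ T → E3) :
    Γ.graph.edgeSet ⊕ (U ⊕ (T × Fin 3)) → Γ.graph.edgeSet × Fin 3 → ℝ := by
  classical
  exact fun c r => match c with
    | Sum.inl e => if e = r.1 then directionMap o x e r.2 else 0
    | Sum.inr q => (fderiv ℝ (fun y => directionMap o y r.1) x (coordVector s x q)) r.2

/-- The value of `Ψ^*Ω` on the basis `coordVector` of the tangent space of `C_Γ` at `x`. Here
`Ω = ⋀^E ω`, and `ω_p(a, b) = det (p, a, b) / 4π` is the volume form of total mass `1` of `S²`; so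
`Ω` is `(4π)^(-#E)` times the determinant in `(ℝ³)^E` with the outer normals in front. The
bijection `σ` orders the basis, and changing it changes at most the sign (the orientation). -/
def pullbackVolume {Γ : Diagram U T M} [Fintype U] [Fintype T] (o : Γ.EdgeOrientation)
    (s : U → E3 → E3) (σ : (Γ.graph.edgeSet ⊕ (U ⊕ (T × Fin 3))) ≃ (Γ.graph.edgeSet × Fin 3))
    (x : U ⊕ T → E3) : ℝ := by
  classical
  haveI : Fintype Γ.graph.edgeSet := Fintype.ofFinite _
  exact ((4 * Real.pi) ^ Nat.card Γ.graph.edgeSet)⁻¹ *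
    (Matrix.of fun r c => pullbackColumn o s x (σ.symm c) r).det

/-- The measure on `L(M)^U × (ℝ³)^T` which gives the value one to the basis `coordVector`: the
product of the arc length on the curve at each univalent vertex, and of the Lebesgue measure of
`ℝ³` at each trivalent vertex. -/
def configMeasure [Fintype U] [Fintype T] (L : M → E3) : Measure (U ⊕ T → E3) :=
  Measure.pi (Sum.elim (fun _ : U => (Measure.hausdorffMeasure 1 : Measure E3).restrict
    (Set.range L)) (fun _ : T => (volume : Measure E3)))

/-- The convergence of `I_L(Γ) = ∫_{C_Γ} Ψ^*Ω`: the form `Ψ^*Ω` is (absolutely) integrable on the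
configuration space. -/
def IntegralConverges {Γ : Diagram U T M} [Fintype U] [Fintype T] (L : M → E3)
    (o : Γ.EdgeOrientation) (s : U → E3 → E3)
    (σ : (Γ.graph.edgeSet ⊕ (U ⊕ (T × Fin 3))) ≃ (Γ.graph.edgeSet × Fin 3)) : Prop :=
  IntegrableOn (pullbackVolume o s σ) (Γ.configSpace L) (configMeasure L)

end Diagram

end

/-!
# Compactification of the configuration spaces of diagrams

The compactification is the closure, in a vector space, of the image of the configuration space
under the map `Diagram.canon`, which sends a configuration `x` to the normalised shapes of its
restrictions to the connected sets of vertices and to the positions of the univalent vertices, and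
moreover, if there is a single univalent vertex, to the overall scale `S / (1 + S)`. (In this case
the configurations can be dilated freely about the univalent vertex, and the canonical map alone is
not injective.) The shapes are bounded, and the curve is compact; so is the closure.

Everything rests on local coordinates at each point `p` of the closure (`LocalModel`,
`Diagram.nonempty_localModel`), which are coordinates of a neighbourhood of `p` in a domain
`{t | 0 ≤ t j for some of the j}`, the configurations being the points where these `t j` are
positive. They are found as follows.

* For each edge of the graph `G`, the largest connected set whose shape at `p` separates the ends of
  the edge is called a cluster. The clusters form a laminar family, each is collapsed to a point in
  the shapes of the larger ones, and every connected set is visible in the shape of a cluster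
  (`exists_clusters`). So a configuration near `p` is a hierarchy of configurations of various
  scales.
* Rank the vertices, univalent ones first and in the order of the curve where they coincide at `p`
  (`ClusterData`). Every vertex `v` but the first has a predecessor: the first vertex `pred v` of
  the smallest cluster `P v` of which `v` is not the first vertex. The differences `v - pred v`,
  divided by the scale of `P v`, together with the ratios of the scales of successive clusters,
  determine the configuration. The scale of a cluster is measured by one of the coordinates of such
  a difference which does not vanish at `p`, and this coordinate is then replaced by a ratio of
  scales (`ScaleData`).
* Univalent vertices are constrained to the curve. Where `v` and `pred v` have equal positions at
  `p`, the difference of their curve parameters is a coordinate, and the difference of positions is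
  the product of it with the slope of the curve, a smooth function of both parameters
  (`LocalParam`). Where they have different positions, the parameter of `v` is itself a coordinate,
  and it fixes the scale in space of the cluster of all univalent vertices. The parameter
  vanishes at an end point of the curve, so that this coordinate, too, is constrained.
* Hence the shapes, being sums of products of these coordinates along the predecessors, are smooth
  functions of the coordinates even where ratios of scales vanish, and conversely
  (`Diagram.ScaleData.config_coord`, `coord_config`, `canon_config`). Small positive coordinates
  give configurations in the right isotopy class because the order along the curve is kept.

In general, a compact closure with such local coordinates is a manifold with corners, with the
original space as its interior (`CornerAtlas.isCornerCompactification`). As its inclusion into the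
vector space is an immersion, so is the canonical map, provided that the overall scale is not
needed. The direction of an edge is a function of the shape of the pair of its ends, which is never
constant; thus it extends smoothly (`Diagram.exists_direction`).

Consequently, the coefficient of `Ψ^*Ω` in local coordinates is the determinant of a matrix that
extends continuously to the boundary, and is bounded. As the measure of the configuration space is
bounded by the Lebesgue measure in the curve parameters and the coordinates of the trivalent
vertices (`Diagram.configMeasure_restrict_le`), the change of variables formula shows that `Ψ^*Ω` is
integrable near each point of the compactification, and by compactness it is integrable.
-/

set_option linter.unusedSectionVars false

noncomputable section

/-! ### Clusters of a system of shapes -/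

section Clusters

variable {V E : Type*} (G : SimpleGraph V)

/-- The connected sets of at least two vertices of a graph. -/
def IsConnSet (A : Finset V) : Prop := 2 ≤ A.card ∧ (G.induce (A : Set V)).Connected

variable {G}

/-- A function on a connected set which is not constant takes different values at the ends of some
edge. -/
theorem IsConnSet.exists_adj_ne {A : Finset V} (hA : IsConnSet G A) {q : V → E}
    (h : ∃ v ∈ A, ∃ w ∈ A, q v ≠ q w) : ∃ v ∈ A, ∃ w ∈ A, G.Adj v w ∧ q v ≠ q w := by
  by_contra! hc
  obtain ⟨v, hv, w, hw, hne⟩ := h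
  obtain ⟨p⟩ := hA.2.preconnected ⟨v, hv⟩ ⟨w, hw⟩
  have key : ∀ (a b : (A : Set V)) (_ : (G.induce (A : Set V)).Walk a b), q a = q b := by
    intro a b p
    induction p with
    | nil => rfl
    | cons hadj _ ih => exact (hc _ (Finset.mem_coe.1 (Subtype.prop _)) _
        (Finset.mem_coe.1 (Subtype.prop _)) hadj).trans ih
  exact hne (key _ _ p)

variable [Fintype V] [DecidableEq V]

theorem IsConnSet.pair {v w : V} (h : G.Adj v w) : IsConnSet G {v, w} := by
  refine ⟨(Finset.card_pair h.ne).ge, ?_⟩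
  rw [Finset.coe_pair]
  exact SimpleGraph.induce_pair_connected_of_adj h

theorem IsConnSet.union {A B : Finset V} (hA : IsConnSet G A) (hB : IsConnSet G B)
    (h : ∃ v, v ∈ A ∧ v ∈ B) : IsConnSet G (A ∪ B) := by
  refine ⟨hA.1.trans (Finset.card_le_card Finset.subset_union_left), ?_⟩
  rw [Finset.coe_union]
  obtain ⟨v, h1, h2⟩ := h
  exact SimpleGraph.induce_union_connected hA.2.preconnected hB.2.preconnected ⟨v, h1, h2⟩

/-- A system of nonconstant shapes `q A` on the connected sets `A`, such that the restriction of
`q B` to a subset `A` of `B` is constant or has the same coincidences as `q A`, has a laminar family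
of clusters: for an edge `e`, the largest connected set on which the shape separates the ends of `e`
is a cluster. -/
theorem exists_clusters (q : Finset V → V → E) (hV : IsConnSet G Finset.univ)
    (h1 : ∀ A, IsConnSet G A → ∃ v ∈ A, ∃ w ∈ A, q A v ≠ q A w)
    (h2 : ∀ A B, IsConnSet G A → IsConnSet G B → A ⊆ B →
      (∀ v ∈ A, ∀ w ∈ A, q B v = q B w) ∨ ∀ v ∈ A, ∀ w ∈ A, (q B v = q B w ↔ q A v = q A w)) :
    ∃ cl : Finset (Finset V), (∀ A ∈ cl, IsConnSet G A) ∧ Finset.univ ∈ cl ∧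
      (∀ A ∈ cl, ∀ B ∈ cl, (∃ v, v ∈ A ∧ v ∈ B) → A ⊆ B ∨ B ⊆ A) ∧
      (∀ A ∈ cl, ∀ B ∈ cl, B ⊂ A → ∀ v ∈ B, ∀ w ∈ B, q A v = q A w) ∧
      ∀ B, IsConnSet G B → ∃ A ∈ cl, B ⊆ A ∧ ∃ v ∈ B, ∃ w ∈ B, q A v ≠ q A w := by
  classical
  let S : V → V → Finset V → Prop := fun v w B => IsConnSet G B ∧ v ∈ B ∧ w ∈ B ∧ q B v ≠ q B w
  -- the union of two connected sets whose shapes separate an edge also has this property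
  have hun : ∀ v w A B, S v w A → S v w B → S v w (A ∪ B) := by
    rintro v w A B ⟨hA, hvA, hwA, hA'⟩ ⟨hB, hvB, hwB, hB'⟩
    have hD := hA.union hB ⟨v, hvA, hvB⟩
    refine ⟨hD, Finset.mem_union_left _ hvA, Finset.mem_union_left _ hwA, ?_⟩
    rcases h2 A _ hA hD Finset.subset_union_left with hcA | hiA
    · rcases h2 B _ hB hD Finset.subset_union_right with hcB | hiB
      · exfalso
        obtain ⟨a, ha, b, hb, hab⟩ := h1 _ hD
        have hall : ∀ c ∈ A ∪ B, q (A ∪ B) c = q (A ∪ B) v := fun c hc =>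
          (Finset.mem_union.1 hc).elim (fun h => hcA _ h _ hvA) (fun h => hcB _ h _ hvB)
        exact hab ((hall a ha).trans (hall b hb).symm)
      · exact fun h => hB' ((hiB _ hvB _ hwB).1 h)
    · exact fun h => hA' ((hiA _ hvA _ hwA).1 h)
  let Mx : V → V → Finset V → Prop := fun v w A => S v w A ∧ ∀ B, S v w B → B ⊆ A
  have hmax : ∀ v w B, S v w B → ∃ A, Mx v w A := by
    intro v w B hB
    obtain ⟨A, hA, hAm⟩ := Finset.exists_max_image (Finset.univ.filter (S v w)) Finset.card
      ⟨B, by simpa using hB⟩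
    have hA' : S v w A := by simpa using hA
    refine ⟨A, hA', fun B hB => ?_⟩
    have hle := hAm (A ∪ B) (by simpa using hun v w A B hA' hB)
    have := Finset.eq_of_subset_of_card_le (Finset.subset_union_left (s₁ := A) (s₂ := B)) hle
    exact Finset.union_eq_left.1 this.symm
  refine ⟨Finset.univ.filter fun A => ∃ v w, Mx v w A, ?_, ?_, ?_, ?_, ?_⟩
  · simp only [Finset.mem_filter, Finset.mem_univ, true_and]
    rintro A ⟨v, w, hA, -⟩
    exact hA.1
  · obtain ⟨v, hv, w, hw, hne⟩ := h1 _ hV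
    have hS : S v w Finset.univ := ⟨hV, hv, hw, hne⟩
    simp only [Finset.mem_filter, Finset.mem_univ, true_and]
    exact ⟨v, w, hS, fun B _ => Finset.subset_univ _⟩
  · simp only [Finset.mem_filter, Finset.mem_univ, true_and]
    rintro A ⟨v, w, hA, hAm⟩ B ⟨v', w', hB, hBm⟩ ⟨c, hcA, hcB⟩
    have hD := hA.1.union hB.1 ⟨c, hcA, hcB⟩
    rcases h2 A _ hA.1 hD Finset.subset_union_left with hA' | hA'
    · rcases h2 B _ hB.1 hD Finset.subset_union_right with hB' | hB'
      · exfalso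
        obtain ⟨a, ha, b, hb, hab⟩ := h1 _ hD
        have hall : ∀ d ∈ A ∪ B, q (A ∪ B) d = q (A ∪ B) c := fun d hd =>
          (Finset.mem_union.1 hd).elim (fun h => hA' _ h _ hcA) (fun h => hB' _ h _ hcB)
        exact hab ((hall a ha).trans (hall b hb).symm)
      · left
        exact Finset.subset_union_left.trans (hBm _ ⟨hD, Finset.mem_union_right _ hB.2.1,
          Finset.mem_union_right _ hB.2.2.1,
          fun h => hB.2.2.2 ((hB' _ hB.2.1 _ hB.2.2.1).1 h)⟩)
    · right
      exact Finset.subset_union_right.trans (hAm _ ⟨hD, Finset.mem_union_left _ hA.2.1,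
          Finset.mem_union_left _ hA.2.2.1,
          fun h => hA.2.2.2 ((hA' _ hA.2.1 _ hA.2.2.1).1 h)⟩)
  · simp only [Finset.mem_filter, Finset.mem_univ, true_and]
    rintro A ⟨v, w, hA, hAm⟩ B ⟨v', w', hB, hBm⟩ hBA
    rcases h2 B A hB.1 hA.1 hBA.subset with h | h
    · exact h
    · exact absurd (hBm A ⟨hA.1, hBA.subset hB.2.1, hBA.subset hB.2.2.1,
        fun h' => hB.2.2.2 ((h _ hB.2.1 _ hB.2.2.1).1 h')⟩) hBA.not_subset
  · intro B hB
    obtain ⟨v, hv, w, hw, -, hne⟩ := hB.exists_adj_ne (h1 _ hB)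
    have hS : S v w B := ⟨hB, hv, hw, hne⟩
    obtain ⟨A, hA⟩ := hmax v w B hS
    exact ⟨A, by simpa using ⟨v, w, hA⟩, hA.2 _ hS, v, hv, w, hw, hA.1.2.2.2⟩

end Clusters

/-! ### Nested families of vertex sets -/

/-- A laminar family `cl` of nonempty subsets of `V`, containing `V`, together with an injective
ranking of the elements of `V`. -/
structure Nest (V : Type*) [Fintype V] [DecidableEq V] where
  cl : Finset (Finset V)
  nonempty : ∀ A ∈ cl, A.Nonempty
  univ_mem : Finset.univ ∈ cl
  laminar : ∀ A ∈ cl, ∀ B ∈ cl, (∃ v, v ∈ A ∧ v ∈ B) → A ⊆ B ∨ B ⊆ A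
  key : V → ℕ
  key_inj : Function.Injective key

namespace Nest

variable {V : Type*} [Fintype V] [DecidableEq V] [Nonempty V] (𝒯 : Nest V)

open Classical in
/-- The base of a set: its element of lowest rank. -/
def base (A : Finset V) : V :=
  if h : A.Nonempty then (Finset.exists_min_image A 𝒯.key h).choose else Classical.arbitrary V

variable {𝒯} in
theorem base_mem {A : Finset V} (hA : A.Nonempty) : 𝒯.base A ∈ A := by
  rw [base, dif_pos hA]
  exact (Finset.exists_min_image A 𝒯.key hA).choose_spec.1

theorem key_base_le {A : Finset V} {v : V} (hv : v ∈ A) : 𝒯.key (𝒯.base A) ≤ 𝒯.key v := by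
  have hA : A.Nonempty := ⟨v, hv⟩
  rw [base, dif_pos hA]
  exact (Finset.exists_min_image A 𝒯.key hA).choose_spec.2 v hv

theorem base_eq_of_subset {A B : Finset V} (h : B ⊆ A) (hB : 𝒯.base A ∈ B) :
    𝒯.base B = 𝒯.base A :=
  𝒯.key_inj (le_antisymm (𝒯.key_base_le hB) (𝒯.key_base_le (h (base_mem ⟨_, hB⟩))))

/-- The element of lowest rank of all. -/
def root : V := 𝒯.base Finset.univ

open Classical in
/-- The smallest member of the family which contains `v` but is not based at `v`. -/
def P (v : V) : Finset V :=
  if h : (𝒯.cl.filter fun A => v ∈ A ∧ 𝒯.base A ≠ v).Nonempty then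
    (Finset.exists_min_image _ Finset.card h).choose else Finset.univ

/-- The predecessor of a vertex: the base of `P v`. -/
def pred (v : V) : V := 𝒯.base (𝒯.P v)

variable {𝒯}

theorem P_mem (v : V) : 𝒯.P v ∈ 𝒯.cl := by
  classical
  unfold P
  split_ifs with h
  · exact (Finset.mem_filter.1 (Finset.exists_min_image _ Finset.card h).choose_spec.1).1
  · exact 𝒯.univ_mem

theorem mem_P (v : V) : v ∈ 𝒯.P v := by
  classical
  unfold P
  split_ifs with h
  · exact (Finset.mem_filter.1 (Finset.exists_min_image _ Finset.card h).choose_spec.1).2.1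
  · exact Finset.mem_univ _

theorem P_subset {v : V} {A : Finset V} (hA : A ∈ 𝒯.cl) (hv : v ∈ A) (hb : 𝒯.base A ≠ v) :
    𝒯.P v ⊆ A := by
  classical
  have hmem : A ∈ 𝒯.cl.filter fun A => v ∈ A ∧ 𝒯.base A ≠ v :=
    Finset.mem_filter.2 ⟨hA, hv, hb⟩
  rcases 𝒯.laminar _ (P_mem v) A hA ⟨v, mem_P v, hv⟩ with h | h
  · exact h
  · have hle : (𝒯.P v).card ≤ A.card := by
      unfold P
      rw [dif_pos ⟨A, hmem⟩]
      exact (Finset.exists_min_image _ Finset.card ⟨A, hmem⟩).choose_spec.2 A hmem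
    exact (Finset.eq_of_subset_of_card_le h hle).ge

theorem pred_ne {v : V} (hv : v ≠ 𝒯.root) : 𝒯.pred v ≠ v := by
  classical
  have hmem : Finset.univ ∈ 𝒯.cl.filter fun A => v ∈ A ∧ 𝒯.base A ≠ v :=
    Finset.mem_filter.2 ⟨𝒯.univ_mem, Finset.mem_univ _, fun h => hv h.symm⟩
  unfold pred P
  rw [dif_pos ⟨_, hmem⟩]
  exact (Finset.mem_filter.1 (Finset.exists_min_image _ Finset.card ⟨_, hmem⟩).choose_spec.1).2.2

theorem pred_mem_P (v : V) : 𝒯.pred v ∈ 𝒯.P v := base_mem ⟨v, mem_P v⟩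

theorem key_pred_lt {v : V} (hv : v ≠ 𝒯.root) : 𝒯.key (𝒯.pred v) < 𝒯.key v :=
  lt_of_le_of_ne (𝒯.key_base_le (mem_P v)) fun h => pred_ne hv (𝒯.key_inj h)

theorem ne_root_of_ne_base {A : Finset V} {v : V} (hv : v ∈ A) (hb : v ≠ 𝒯.base A) :
    v ≠ 𝒯.root := by
  rintro rfl
  exact hb (𝒯.base_eq_of_subset (Finset.subset_univ A) hv).symm

/-- Induction along the predecessors inside a member of the family. -/
theorem induction_on_mem {A : Finset V} (hA : A ∈ 𝒯.cl) {p : V → Prop} (h0 : p (𝒯.base A))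
    (h : ∀ v ∈ A, v ≠ 𝒯.base A → 𝒯.P v ⊆ A → p (𝒯.pred v) → p v) {v : V} (hv : v ∈ A) :
    p v := by
  induction hn : 𝒯.key v using Nat.strong_induction_on generalizing v with
  | _ n ih =>
    by_cases hb : v = 𝒯.base A
    · exact hb ▸ h0
    · have hP := P_subset hA hv (Ne.symm hb)
      refine h v hv hb hP (ih _ ?_ (hP (pred_mem_P v)) rfl)
      rw [← hn]
      exact key_pred_lt (ne_root_of_ne_base hv hb)

variable (𝒯) in
open Classical in
/-- Recursion along the predecessors, from initial values at the vertices where `halt` holds. -/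
def walk {β : Type*} (halt : V → Prop) (i : V → β) (step : V → β → β) (v : V) : β :=
  if h : halt v ∨ v = 𝒯.root then i v else
    have : 𝒯.key (𝒯.pred v) < 𝒯.key v := key_pred_lt fun h' => h (Or.inr h')
    step v (walk halt i step (𝒯.pred v))
termination_by 𝒯.key v

theorem walk_halt {β : Type*} {halt : V → Prop} {i : V → β} {step : V → β → β} {v : V}
    (h : halt v ∨ v = 𝒯.root) : 𝒯.walk halt i step v = i v := by
  rw [walk, dif_pos h]

theorem walk_step {β : Type*} {halt : V → Prop} {i : V → β} {step : V → β → β} {v : V}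
    (h : ¬ halt v) (h' : v ≠ 𝒯.root) :
    𝒯.walk halt i step v = step v (𝒯.walk halt i step (𝒯.pred v)) := by
  rw [walk, dif_neg (not_or.2 ⟨h, h'⟩)]

/-- A property of the values of a recursion along the predecessors. -/
theorem walk_induction {β : Type*} {halt : V → Prop} {i : V → β} {step : V → β → β}
    {p : V → β → Prop} (h0 : ∀ v, halt v ∨ v = 𝒯.root → p v (i v))
    (h1 : ∀ v, ¬ halt v → v ≠ 𝒯.root → ∀ b, p (𝒯.pred v) b → p v (step v b)) (v : V) :
    p v (𝒯.walk halt i step v) := by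
  induction hn : 𝒯.key v using Nat.strong_induction_on generalizing v with
  | _ n ih =>
    by_cases h : halt v ∨ v = 𝒯.root
    · rw [walk_halt h]
      exact h0 v h
    · have h' := not_or.1 h
      rw [walk_step h'.1 h'.2]
      exact h1 v h'.1 h'.2 _ (ih _ (hn ▸ key_pred_lt h'.2) _ rfl)

/-! Ratios of scales. -/

variable (𝒯) in
/-- The product of the `u C` for the members `C` of the family with `B ⊆ C ⊂ A`: if the `u C` are
the ratios of the scales of `C` and of the next larger member, this is the ratio of the scales of
`B` and `A`. -/
def ratio (u : Finset V → ℝ) (B A : Finset V) : ℝ :=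
  ∏ C ∈ 𝒯.cl.filter fun C => B ⊆ C ∧ C ⊂ A, u C

@[simp] theorem ratio_self (u : Finset V → ℝ) (A : Finset V) : 𝒯.ratio u A A = 1 := by
  rw [ratio, Finset.filter_eq_empty_iff.2, Finset.prod_empty]
  rintro C - ⟨h1, h2⟩
  exact h2.not_subset h1

theorem ratio_mul (u : Finset V → ℝ) {A B C : Finset V} (hB : B.Nonempty) (hC : C ∈ 𝒯.cl)
    (hBC : B ⊆ C) (hCA : C ⊆ A) : 𝒯.ratio u B A = 𝒯.ratio u B C * 𝒯.ratio u C A := by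
  classical
  unfold ratio
  rw [← Finset.prod_union]
  · congr 1
    ext D
    simp only [Finset.mem_union, Finset.mem_filter]
    constructor
    · rintro ⟨hD, h1, h2⟩
      obtain ⟨b, hb⟩ := hB
      rcases 𝒯.laminar D hD C hC ⟨b, h1 hb, hBC hb⟩ with h | h
      · rcases h.eq_or_ssubset with rfl | h
        · exact Or.inr ⟨hD, subset_rfl, h2⟩
        · exact Or.inl ⟨hD, h1, h⟩
      · exact Or.inr ⟨hD, h, h2⟩
    · rintro (⟨hD, h1, h2⟩ | ⟨hD, h1, h2⟩)
      · exact ⟨hD, h1, h2.trans_subset hCA⟩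
      · exact ⟨hD, hBC.trans h1, h2⟩
  · rw [Finset.disjoint_left]
    simp only [Finset.mem_filter]
    rintro D ⟨-, -, h1⟩ ⟨-, h2, -⟩
    exact h1.not_subset h2

theorem ratio_pos {u : Finset V → ℝ} {A B : Finset V} (hu : ∀ C ∈ 𝒯.cl, C ≠ Finset.univ → 0 < u C) :
    0 < 𝒯.ratio u B A := by
  refine Finset.prod_pos fun C hC => hu C (Finset.mem_filter.1 hC).1 ?_
  rintro rfl
  exact (Finset.mem_filter.1 hC).2.2.not_subset (Finset.subset_univ _)

variable (𝒯) in
open Classical in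
/-- The smallest member of the family which strictly contains `C`. -/
def par (C : Finset V) : Finset V :=
  if h : (𝒯.cl.filter fun A => C ⊂ A).Nonempty then
    (Finset.exists_min_image _ Finset.card h).choose else Finset.univ

theorem par_mem (C : Finset V) : 𝒯.par C ∈ 𝒯.cl := by
  classical
  unfold par
  split_ifs with h
  · exact (Finset.mem_filter.1 (Finset.exists_min_image _ Finset.card h).choose_spec.1).1
  · exact 𝒯.univ_mem

theorem ssubset_par {C : Finset V} (hC : C ≠ Finset.univ) : C ⊂ 𝒯.par C := by
  classical
  have hmem : Finset.univ ∈ 𝒯.cl.filter fun A => C ⊂ A :=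
    Finset.mem_filter.2 ⟨𝒯.univ_mem, Finset.ssubset_univ_iff.2 hC⟩
  unfold par
  rw [dif_pos ⟨_, hmem⟩]
  exact (Finset.mem_filter.1 (Finset.exists_min_image _ Finset.card ⟨_, hmem⟩).choose_spec.1).2

theorem par_subset {A C : Finset V} (hC : C.Nonempty) (hA : A ∈ 𝒯.cl) (h : C ⊂ A) :
    𝒯.par C ⊆ A := by
  classical
  have hmem : A ∈ 𝒯.cl.filter fun A => C ⊂ A := Finset.mem_filter.2 ⟨hA, h⟩
  have hne : C ≠ Finset.univ := fun h' => (h' ▸ h).not_subset (Finset.subset_univ _)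
  obtain ⟨c, hc⟩ := hC
  rcases 𝒯.laminar _ (par_mem C) A hA ⟨c, (ssubset_par hne).subset hc, h.subset hc⟩ with h' | h'
  · exact h'
  · have hle : (𝒯.par C).card ≤ A.card := by
      unfold par
      rw [dif_pos ⟨A, hmem⟩]
      exact (Finset.exists_min_image _ Finset.card ⟨A, hmem⟩).choose_spec.2 A hmem
    exact (Finset.eq_of_subset_of_card_le h' hle).ge

theorem ratio_par (u : Finset V → ℝ) {C : Finset V} (hC : C ∈ 𝒯.cl) (hne : C ≠ Finset.univ) :
    𝒯.ratio u C (𝒯.par C) = u C := by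
  classical
  rw [ratio, Finset.prod_eq_single_of_mem C]
  · exact Finset.mem_filter.2 ⟨hC, subset_rfl, ssubset_par hne⟩
  · intro D hD hDC
    obtain ⟨hD, h1, h2⟩ := Finset.mem_filter.1 hD
    exact absurd (par_subset (𝒯.nonempty C hC) hD (h1.ssubset_of_ne hDC.symm)) h2.not_subset

/-- If the `u C` are the ratios of successive scales, then `ratio` is the ratio of the scales. -/
theorem ratio_eq_div {u r : Finset V → ℝ} (hr : ∀ A ∈ 𝒯.cl, r A ≠ 0)
    (hu : ∀ C ∈ 𝒯.cl, C ≠ Finset.univ → u C = r C / r (𝒯.par C)) {A B : Finset V}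
    (hA : A ∈ 𝒯.cl) (hB : B ∈ 𝒯.cl) (h : B ⊆ A) : 𝒯.ratio u B A = r B / r A := by
  induction hn : A.card - B.card using Nat.strong_induction_on generalizing B with
  | _ n ih =>
    rcases h.eq_or_ssubset with rfl | h'
    · rw [ratio_self, div_self (hr _ hA)]
    · have hne : B ≠ Finset.univ := fun h => (h ▸ h').not_subset (Finset.subset_univ _)
      have hs := ssubset_par (𝒯 := 𝒯) hne
      have hp := par_subset (𝒯.nonempty B hB) hA h'
      have h1 := Finset.card_lt_card hs
      have h2 := Finset.card_le_card hp
      rw [ratio_mul u (𝒯.nonempty B hB) (par_mem B) hs.subset hp, ratio_par u hB hne, hu B hB hne,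
        ih _ (by omega) (par_mem B) hp rfl, div_mul_div_cancel₀ (hr _ (par_mem B))]

end Nest

/-! ### Calculus -/

section Calculus

/-- A parametric integral of a smooth function over an interval is smooth. -/
theorem contDiff_intervalIntegral {H E : Type u} [NormedAddCommGroup H] [NormedSpace ℝ H]
    [ProperSpace H] [NormedAddCommGroup E] [NormedSpace ℝ E] [CompleteSpace E] (n : ℕ)
    {F : H × ℝ → E} (hF : ContDiff ℝ n F) : ContDiff ℝ n fun x => ∫ θ in (0 : ℝ)..1, F (x, θ) := by
  induction n generalizing E with
  | zero =>
    rw [Nat.cast_zero, contDiff_zero] at hF ⊢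
    exact intervalIntegral.continuous_parametric_intervalIntegral_of_continuous'
      (f := fun x θ => F (x, θ)) hF 0 1
  | succ n ih =>
    have hd : Differentiable ℝ F := hF.differentiable (by simp)
    have hF' : ContDiff ℝ n fun z : H × ℝ =>
        (fderiv ℝ F z).comp (ContinuousLinearMap.inl ℝ H ℝ) :=
      (hF.fderiv_right (m := n) (by norm_cast)).clm_comp contDiff_const
    refine contDiff_succ_iff_hasFDerivAt.2 ⟨_, ih hF', fun x => ?_⟩
    have hFc := hF.continuous
    have hFc' := hF'.continuous
    obtain ⟨C, hC⟩ := ((isCompact_closedBall x 1).prod (isCompact_Icc (a := (0 : ℝ)) (b := 1))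
      ).exists_bound_of_continuousOn hFc'.continuousOn
    refine (intervalIntegral.hasFDerivAt_integral_of_dominated_of_fderiv_le
      (bound := fun _ => C) (F' := fun x θ => (fderiv ℝ F (x, θ)).comp
        (ContinuousLinearMap.inl ℝ H ℝ)) (Metric.closedBall_mem_nhds x one_pos)
      ?_ ?_ ?_ ?_ ?_ ?_)
    · exact Filter.Eventually.of_forall fun y => Continuous.aestronglyMeasurable (by fun_prop)
    · exact Continuous.intervalIntegrable (by fun_prop) _ _
    · exact (hFc'.comp (by fun_prop : Continuous fun θ : ℝ => (x, θ))).aestronglyMeasurable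
    · refine Filter.Eventually.of_forall fun θ hθ y hy => hC (y, θ) ⟨hy, ?_⟩
      rw [Set.uIoc_of_le zero_le_one] at hθ
      exact ⟨hθ.1.le, hθ.2⟩
    · exact intervalIntegrable_const
    · refine Filter.Eventually.of_forall fun θ _ y _ => ?_
      exact (hd (y, θ)).hasFDerivAt.comp y (hasFDerivAt_prodMk_left y θ)

/-- The difference quotients of a smooth curve extend to a smooth function on the plane. -/
theorem exists_contDiff_slope {E : Type} [NormedAddCommGroup E] [NormedSpace ℝ E]
    [CompleteSpace E] {f : ℝ → E} (hf : ContDiff ℝ ∞ f) :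
    ∃ g : ℝ × ℝ → E, ContDiff ℝ ∞ g ∧ (∀ s s', f s' - f s = (s' - s) • g (s, s')) ∧
      ∀ s, g (s, s) = deriv f s := by
  have hd : ContDiff ℝ ∞ (deriv f) := (contDiff_infty_iff_deriv.1 hf).2
  refine ⟨fun z => ∫ θ in (0 : ℝ)..1, deriv f (z.1 + θ * (z.2 - z.1)), ?_, fun s s' => ?_,
    fun s => by simp⟩
  · refine contDiff_infty.2 fun n => contDiff_intervalIntegral n
      (F := fun z : (ℝ × ℝ) × ℝ => deriv f (z.1.1 + z.2 * (z.1.2 - z.1.1))) ?_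
    have := contDiff_infty.1 hd n
    fun_prop
  · have h1 : ∀ θ ∈ Set.uIcc (0 : ℝ) 1, HasDerivAt (fun θ : ℝ => f (s + θ * (s' - s)))
        ((s' - s) • deriv f (s + θ * (s' - s))) θ := by
      intro θ _
      have h2 := (hf.differentiable (by simp) (s + θ * (s' - s))).hasDerivAt
      have h3 : HasDerivAt (fun θ : ℝ => s + θ * (s' - s)) (s' - s) θ := by
        simpa using ((hasDerivAt_id θ).mul_const (s' - s)).const_add s
      exact h2.scomp θ h3
    have h4 := intervalIntegral.integral_eq_sub_of_hasDerivAt h1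
      (Continuous.intervalIntegrable (by have := hd.continuous; fun_prop) _ _)
    rw [intervalIntegral.integral_smul] at h4
    simpa using h4.symm

/-- A function which is smooth on an open set agrees near any of its points with a globally smooth
one. -/
theorem exists_contDiff_eqOn_nhds {E F : Type*} [NormedAddCommGroup E] [NormedSpace ℝ E]
    [FiniteDimensional ℝ E] [NormedAddCommGroup F] [NormedSpace ℝ F] {f : E → F} {s : Set E}
    (hs : IsOpen s) (hf : ContDiffOn ℝ ∞ f s) {x : E} (hx : x ∈ s) :
    ∃ g : E → F, ContDiff ℝ ∞ g ∧ g =ᶠ[𝓝 x] f := by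
  obtain ⟨ε, hε, hsub⟩ := Metric.isOpen_iff.1 hs x hx
  let χ : ContDiffBump x := ⟨ε / 4, ε / 2, by positivity, by linarith⟩
  refine ⟨fun y => χ y • f y, contDiff_iff_contDiffAt.2 fun y => ?_, ?_⟩
  · by_cases hy : y ∈ Metric.ball x ε
    · exact χ.contDiff.contDiffAt.smul (hf.contDiffAt (hs.mem_nhds (hsub hy)))
    · have hy' : y ∈ (Metric.closedBall x (ε / 2))ᶜ := by
        simp only [Metric.mem_ball, not_lt, Set.mem_compl_iff, Metric.mem_closedBall, not_le] at *
        linarith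
      refine contDiffAt_const (c := 0) |>.congr_of_eventuallyEq ?_
      filter_upwards [Metric.isClosed_closedBall.isOpen_compl.mem_nhds hy'] with z hz
      have : χ z = 0 := χ.zero_of_le_dist (by
        simp only [Set.mem_compl_iff, Metric.mem_closedBall, not_le] at hz
        exact hz.le)
      rw [this, zero_smul]
  · filter_upwards [χ.eventuallyEq_one] with y hy
    rw [hy, Pi.one_apply, one_smul]

end Calculus

/-! ### Local parameters of the embedded curve -/

section LocalParam

variable {M : Type u} [TopologicalSpace M] [ChartedSpace (EuclideanHalfSpace 1) M]

/-- A local parametrisation `ℓ` of the curve `L` near `L m`, extended smoothly to the real line. The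
parameter is nonnegative on the curve, and positive exactly at the interior points of `M`; the
function `σ` on space gives the parameter of the points of the curve, and `slope` the difference
quotients of `ℓ`. -/
structure LocalParam (L : M → E3) (m : M) where
  ℓ : ℝ → E3
  σ : E3 → ℝ
  slope : ℝ × ℝ → E3
  ε : ℝ
  nhd : Set E3
  contDiff_ℓ : ContDiff ℝ ∞ ℓ
  contDiff_σ : ContDiff ℝ ∞ σ
  contDiff_slope : ContDiff ℝ ∞ slope
  ε_pos : 0 < ε
  isOpen_nhd : IsOpen nhd
  mem_nhd : L m ∈ nhd
  σ_ℓ : ∀ s, |s - σ (L m)| < ε → σ (ℓ s) = s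
  ℓ_mem_nhd : ∀ s, |s - σ (L m)| < ε → ℓ s ∈ nhd
  ℓ_mem : ∀ s, |s - σ (L m)| < ε → 0 ≤ s → ∃ m', L m' = ℓ s
  ℓ_σ : ∀ m', L m' ∈ nhd → ℓ (σ (L m')) = L m'
  σ_nonneg : ∀ m', L m' ∈ nhd → 0 ≤ σ (L m')
  interior_iff : ∀ m', L m' ∈ nhd → (m' ∈ (𝓡∂ 1).interior M ↔ 0 < σ (L m'))
  slope_eq : ∀ s s', ℓ s' - ℓ s = (s' - s) • slope (s, s')
  slope_self : ∀ s, slope (s, s) = deriv ℓ s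

namespace LocalParam

variable {L : M → E3} {m : M}

theorem deriv_ne (c : LocalParam L m) {s : ℝ} (hs : |s - c.σ (L m)| < c.ε) : deriv c.ℓ s ≠ 0 := by
  intro h0
  have h1 : HasDerivAt c.ℓ 0 s := h0 ▸ (c.contDiff_ℓ.differentiable (by simp) s).hasDerivAt
  have h2 := (c.contDiff_σ.differentiable (by simp) (c.ℓ s)).hasFDerivAt.comp_hasDerivAt s h1
  have h3 : (c.σ ∘ c.ℓ) =ᶠ[𝓝 s] id := by
    have : {r : ℝ | |r - c.σ (L m)| < c.ε} ∈ 𝓝 s :=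
      (isOpen_lt (by fun_prop) continuous_const).mem_nhds hs
    filter_upwards [this] with r hr using c.σ_ℓ r hr
  have h4 := (h2.congr_of_eventuallyEq h3.symm).unique (hasDerivAt_id s)
  simp at h4

theorem slope_ne (c : LocalParam L m) {s : ℝ} (hs : |s - c.σ (L m)| < c.ε) :
    c.slope (s, s) ≠ 0 := by
  rw [c.slope_self]
  exact c.deriv_ne hs

end LocalParam

variable [IsManifold (𝓡∂ 1) ∞ M]

theorem isInteriorPoint_iff_of_mem_maximalAtlas {e : OpenPartialHomeomorph M (EuclideanHalfSpace 1)}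
    (he : e ∈ IsManifold.maximalAtlas (𝓡∂ 1) ∞ M) {x : M} (hx : x ∈ e.source) :
    x ∈ (𝓡∂ 1).interior M ↔ 0 < (e x).1 0 := by
  have hloc : IsLocalDiffeomorphAt (𝓡∂ 1) (𝓡∂ 1) ∞ e x := by
    refine ⟨⟨e.toPartialEquiv, e.open_source, e.open_target, contMDiffOn_of_mem_maximalAtlas he,
      contMDiffOn_symm_of_mem_maximalAtlas he⟩, hx, fun y _ => rfl⟩
  have h1 := hloc.isInteriorPoint_iff (by simp)
  refine h1.trans ?_
  unfold ModelWithCorners.IsInteriorPoint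
  simp only [extChartAt, OpenPartialHomeomorph.extend, mfld_simps]
  change (e x).1 ∈ interior (Set.range (Subtype.val : EuclideanHalfSpace 1 → _)) ↔ _
  rw [range_euclideanHalfSpace, interior_halfSpace]
  rfl

theorem exists_localParam {L : M → E3} (hL : Manifold.IsSmoothEmbedding (𝓡∂ 1) 𝓘(ℝ, E3) ∞ L)
    (m : M) : Nonempty (LocalParam L m) := by
  have h := hL.isImmersion.isImmersionAt m
  set φ := h.domChart with hφ
  set ψ := h.codChart with hψ
  set eq := h.equiv
  have hmφ : m ∈ φ.source := h.mem_domChart_source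
  have hmψ : L m ∈ ψ.source := h.mem_codChart_source
  have hsub : φ.source ⊆ L ⁻¹' ψ.source := h.source_subset_preimage_source
  have hψs : ContDiffOn ℝ ∞ ψ ψ.source :=
    contMDiffOn_iff_contDiffOn.1 (contMDiffOn_of_mem_maximalAtlas h.codChart_mem_maximalAtlas)
  have hψt : ContDiffOn ℝ ∞ ψ.symm ψ.target :=
    contMDiffOn_iff_contDiffOn.1 (contMDiffOn_symm_of_mem_maximalAtlas h.codChart_mem_maximalAtlas)
  let ι : ℝ → EuclideanSpace ℝ (Fin 1) := fun s => WithLp.toLp 2 fun _ => s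
  have hι : ContDiff ℝ ∞ ι := by
    refine (contDiff_euclidean (n := ∞)).2 fun i => ?_
    exact contDiff_id
  have hι0 : ∀ x : EuclideanSpace ℝ (Fin 1), ι (x 0) = x := by
    intro x
    ext i
    rw [Subsingleton.elim i 0]
  have hch : ∀ m' ∈ φ.source, ψ (L m') = eq ((φ m').1, 0) := by
    intro m' hm'
    have hm'' : φ.extend (𝓡∂ 1) m' ∈ (φ.extend (𝓡∂ 1)).target :=
      (φ.extend (𝓡∂ 1)).map_source (by rwa [OpenPartialHomeomorph.extend_source])
    have := h.writtenInCharts hm''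
    simp only [Function.comp_apply] at this
    rw [OpenPartialHomeomorph.extend_left_inv _ hm'] at this
    exact this
  let σ₀ : E3 → ℝ := fun x => (eq.symm (ψ x)).1 0
  let ℓ₀ : ℝ → E3 := fun s => ψ.symm (eq (ι s, 0))
  have hσ₀ : ∀ m' ∈ φ.source, σ₀ (L m') = (φ m').1 0 := by
    intro m' hm'
    simp only [σ₀]
    rw [hch m' hm', ContinuousLinearEquiv.symm_apply_apply]
  have hℓ₀ : ∀ m' ∈ φ.source, ℓ₀ ((φ m').1 0) = L m' := by
    intro m' hm'
    simp only [ℓ₀]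
    rw [hι0, ← hch m' hm', ψ.left_inv (hsub hm')]
  have hιc : ContDiff ℝ ∞ fun s => eq (ι s, 0) := by
    exact eq.contDiff.comp (hι.prodMk contDiff_const)
  have hT : IsOpen {s : ℝ | eq (ι s, 0) ∈ ψ.target} := ψ.open_target.preimage hιc.continuous
  have hmT : (φ m).1 0 ∈ {s : ℝ | eq (ι s, 0) ∈ ψ.target} := by
    simp only [Set.mem_ofPred_eq]
    rw [hι0, ← hch m hmφ]
    exact ψ.map_source hmψ
  obtain ⟨ℓ, hℓ, hℓe⟩ := exists_contDiff_eqOn_nhds hT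
    (f := ℓ₀) (hψt.comp hιc.contDiffOn fun s hs => hs) hmT
  obtain ⟨σ, hσ, hσe⟩ := exists_contDiff_eqOn_nhds ψ.open_source (f := σ₀) (by
    have h1 : ContDiffOn ℝ ∞ (fun x => (eq.symm (ψ x)).1) ψ.source :=
      contDiff_fst.comp_contDiffOn (eq.symm.contDiff.comp_contDiffOn hψs)
    exact (contDiff_euclidean.1 contDiff_id 0).comp_contDiffOn h1) hmψ
  obtain ⟨g, hg, hg1, hg2⟩ := exists_contDiff_slope hℓ
  have hσm : σ (L m) = (φ m).1 0 := by rw [hσe.self_of_nhds, hσ₀ m hmφ]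
  have hℓm : ℓ (σ (L m)) = L m := by rw [hσm, hℓe.self_of_nhds, hℓ₀ m hmφ]
  rw [← hσm] at hℓe hmT
  -- the neighbourhood in which everything happens
  obtain ⟨O, hO, hOL⟩ := (hL.isEmbedding.isOpen_iff).1 φ.open_source
  obtain ⟨Q, hQs, hQ, hmQ⟩ := mem_nhds_iff.1 (Filter.inter_mem (Filter.inter_mem hσe
    (ψ.open_source.mem_nhds hmψ)) (hO.mem_nhds (by rw [← Set.mem_preimage, hOL]; exact hmφ)))
  have e1 : ∀ᶠ s in 𝓝 (σ (L m)), ℓ s = ℓ₀ s := hℓe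
  have e2 : ∀ᶠ s in 𝓝 (σ (L m)), eq (ι s, 0) ∈ ψ.target := hT.mem_nhds hmT
  have e3 : ∀ᶠ s in 𝓝 (σ (L m)), ℓ s ∈ Q :=
    hℓ.continuous.continuousAt.eventually (by rw [hℓm]; exact hQ.mem_nhds hmQ)
  have e4 : ∀ᶠ s in 𝓝 (σ (L m)), ∀ hs : 0 ≤ s, (⟨ι s, hs⟩ : EuclideanHalfSpace 1) ∈ φ.target := by
    obtain ⟨D, hD, hDt⟩ := isOpen_induced_iff.1 φ.open_target
    have hm : ι (σ (L m)) ∈ D := by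
      rw [hσm, hι0]
      have : φ m ∈ Subtype.val ⁻¹' D := by rw [hDt]; exact φ.map_source hmφ
      exact this
    filter_upwards [hι.continuous.continuousAt.eventually (hD.mem_nhds hm)] with s hs hs0
    rw [← hDt]
    exact hs
  have e5 : ∀ᶠ s in 𝓝 (σ (L m)), |s - σ (L m)| < 1 := by
    have := Metric.ball_mem_nhds (σ (L m)) one_pos
    filter_upwards [this] with s hs using by simpa [Real.dist_eq] using hs
  obtain ⟨ε, hε, hball⟩ := Metric.eventually_nhds_iff.1 (e1.and (e2.and (e3.and e4)))
  have hb : ∀ s, |s - σ (L m)| < ε → dist s (σ (L m)) < ε := fun s hs => by rwa [Real.dist_eq]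
  have hσℓ : ∀ s, |s - σ (L m)| < ε → σ (ℓ s) = s := by
    intro s hs
    obtain ⟨h1, h2, h3, -⟩ := hball (hb s hs)
    rw [show σ (ℓ s) = σ₀ (ℓ s) from (hQs h3).1.1, h1]
    simp only [σ₀, ℓ₀]
    rw [ψ.right_inv h2, ContinuousLinearEquiv.symm_apply_apply]
  have hQφ : ∀ m', L m' ∈ Q → m' ∈ φ.source := fun m' hm' => by
    rw [← hOL]
    exact (hQs hm').2
  refine ⟨{
    ℓ := ℓ, σ := σ, slope := g, ε := ε, nhd := Q ∩ {x | |σ x - σ (L m)| < ε}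
    contDiff_ℓ := hℓ, contDiff_σ := hσ, contDiff_slope := hg, ε_pos := hε
    isOpen_nhd := hQ.inter (isOpen_lt ((hσ.continuous.sub continuous_const).abs) continuous_const)
    mem_nhd := ⟨hmQ, by simpa using hε⟩
    σ_ℓ := hσℓ
    ℓ_mem_nhd := fun s hs => ⟨(hball (hb s hs)).2.2.1, by
      rw [Set.mem_ofPred_eq, hσℓ s hs]
      exact hs⟩
    ℓ_mem := ?_
    ℓ_σ := ?_
    σ_nonneg := ?_
    interior_iff := ?_
    slope_eq := hg1
    slope_self := hg2 }⟩
  · intro s hs h0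
    obtain ⟨h1, h2, h3, h4⟩ := hball (hb s hs)
    refine ⟨φ.symm ⟨ι s, h0⟩, ?_⟩
    have := hℓ₀ _ (φ.map_target (h4 h0))
    rw [φ.right_inv (h4 h0)] at this
    rw [← this, h1]
  · intro m' hm'
    rw [(hball (hb _ hm'.2)).1, show σ (L m') = σ₀ (L m') from (hQs hm'.1).1.1,
      hσ₀ _ (hQφ _ hm'.1), hℓ₀ _ (hQφ _ hm'.1)]
  · intro m' hm'
    rw [show σ (L m') = σ₀ (L m') from (hQs hm'.1).1.1, hσ₀ _ (hQφ _ hm'.1)]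
    exact (φ m').2
  · intro m' hm'
    rw [show σ (L m') = σ₀ (L m') from (hQs hm'.1).1.1, hσ₀ _ (hQφ _ hm'.1)]
    exact isInteriorPoint_iff_of_mem_maximalAtlas h.domChart_mem_maximalAtlas (hQφ _ hm'.1)

end LocalParam

/-! ### Normalised shapes -/

section Shapes

variable {A : Type*} [Fintype A]

/-- The barycentre of a map. -/
def mean (f : A → E3) : E3 := (Fintype.card A : ℝ)⁻¹ • ∑ a, f a

/-- The standard deviation of a map, up to a constant factor. -/
def size (f : A → E3) : ℝ := Real.sqrt (∑ a, ‖f a - mean f‖ ^ 2)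

/-- The representative in `SphereMaps A` of a nonconstant map. -/
def nrm (f : A → E3) : A → E3 := fun a => (size f)⁻¹ • (f a - mean f)

theorem size_nonneg (f : A → E3) : 0 ≤ size f := Real.sqrt_nonneg _

theorem size_pos {f : A → E3} (h : ∃ a a', f a ≠ f a') : 0 < size f := by
  obtain ⟨a, a', h⟩ := h
  refine Real.sqrt_pos.2 (lt_of_le_of_ne (Finset.sum_nonneg fun _ _ => by positivity) fun h0 => ?_)
  have hz := (Finset.sum_eq_zero_iff_of_nonneg
    (fun a _ => by positivity : ∀ a ∈ Finset.univ, 0 ≤ ‖f a - mean f‖ ^ 2)).1 h0.symm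
  have e : ∀ a, f a = mean f := fun a => by simpa [sub_eq_zero] using hz a (Finset.mem_univ _)
  exact h ((e a).trans (e a').symm)

theorem eq_mean_of_size_eq_zero {f : A → E3} (h : size f = 0) (a : A) : f a = mean f := by
  have h0 := (Real.sqrt_eq_zero (Finset.sum_nonneg fun _ _ => by positivity)).1 h
  have hz := (Finset.sum_eq_zero_iff_of_nonneg
    (fun a _ => by positivity : ∀ a ∈ Finset.univ, 0 ≤ ‖f a - mean f‖ ^ 2)).1 h0
  simpa [sub_eq_zero] using hz a (Finset.mem_univ _)

theorem mean_affine [Nonempty A] {f g : A → E3} {c : ℝ} {b : E3} (h : ∀ a, g a = c • f a + b) :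
    mean g = c • mean f + b := by
  have hc : (Fintype.card A : ℝ) ≠ 0 := by positivity
  simp only [mean, h, Finset.sum_add_distrib, ← Finset.smul_sum, Finset.sum_const,
    Finset.card_univ, ← Nat.cast_smul_eq_nsmul ℝ, smul_add, smul_smul, inv_mul_cancel₀ hc,
    one_smul, mul_comm c]

theorem size_affine {f g : A → E3} {c : ℝ} (hc : 0 ≤ c) {b : E3} (h : ∀ a, g a = c • f a + b) :
    size g = c * size f := by
  rcases isEmpty_or_nonempty A with hA | hA
  · simp [size]
  · have : ∀ a, ‖g a - mean g‖ ^ 2 = c ^ 2 * ‖f a - mean f‖ ^ 2 := fun a => by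
      rw [mean_affine h, h, add_sub_add_right_eq_sub, ← smul_sub, norm_smul, mul_pow,
        Real.norm_eq_abs, sq_abs]
    simp only [size, this, ← Finset.mul_sum]
    rw [Real.sqrt_mul (sq_nonneg c), Real.sqrt_sq hc]

theorem nrm_affine {f g : A → E3} {c : ℝ} (hc : 0 < c) {b : E3} (h : ∀ a, g a = c • f a + b) :
    nrm g = nrm f := by
  funext a
  have : Nonempty A := ⟨a⟩
  rw [nrm, nrm, size_affine hc.le h, mean_affine h, h, add_sub_add_right_eq_sub, ← smul_sub,
    smul_smul, mul_inv, mul_assoc, mul_comm _ c, ← mul_assoc, inv_mul_cancel₀ hc.ne', one_mul]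

theorem size_smul_nrm (f : A → E3) (a : A) : size f • nrm f a = f a - mean f := by
  by_cases h : size f = 0
  · rw [h, zero_smul, eq_mean_of_size_eq_zero h a, sub_self]
  · rw [nrm, smul_smul, mul_inv_cancel₀ h, one_smul]

theorem nrm_mem {f : A → E3} (h : ∃ a a', f a ≠ f a') :
    ∑ a, nrm f a = 0 ∧ ∑ a, ‖nrm f a‖ ^ 2 = 1 := by
  have hA : Nonempty A := ⟨h.choose⟩
  have hc : (Fintype.card A : ℝ) ≠ 0 := by positivity
  have hs := size_pos h
  constructor
  · simp only [nrm]
    rw [← Finset.smul_sum, Finset.sum_sub_distrib, Finset.sum_const, Finset.card_univ, mean,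
      ← Nat.cast_smul_eq_nsmul ℝ, smul_smul, mul_inv_cancel₀ hc, one_smul, sub_self, smul_zero]
  · have : ∀ a, ‖nrm f a‖ ^ 2 = (size f ^ 2)⁻¹ * ‖f a - mean f‖ ^ 2 := fun a => by
      rw [nrm, norm_smul, mul_pow, Real.norm_eq_abs, sq_abs, inv_pow]
    simp only [this]
    rw [← Finset.mul_sum, size, Real.sq_sqrt (Finset.sum_nonneg fun _ _ => by positivity),
      inv_mul_cancel₀]
    have := pow_pos hs 2
    rw [size, Real.sq_sqrt (Finset.sum_nonneg fun _ _ => by positivity)] at this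
    exact this.ne'

theorem transDil_nrm {f : A → E3} (h : ∃ a a', f a ≠ f a') : TransDil (nrm f) f :=
  ⟨size f, size_pos h, mean f, fun a => by rw [size_smul_nrm, sub_add_cancel]⟩

theorem mean_sphereMaps (g : SphereMaps A) : mean g.1 = 0 := by
  rw [mean, g.2.1, smul_zero]

theorem size_sphereMaps (g : SphereMaps A) : size g.1 = 1 := by
  simp only [size, mean_sphereMaps, sub_zero, g.2.2, Real.sqrt_one]

theorem nrm_sphereMaps (g : SphereMaps A) : nrm g.1 = g.1 := by
  funext a
  rw [nrm, size_sphereMaps, mean_sphereMaps, inv_one, one_smul, sub_zero]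

theorem eq_nrm_of_transDil {g : SphereMaps A} {f : A → E3} (h : TransDil g.1 f) : g.1 = nrm f := by
  obtain ⟨c, hc, b, hb⟩ := h
  rw [nrm_affine hc hb, nrm_sphereMaps]

theorem contDiff_mean : ContDiff ℝ ∞ (mean : (A → E3) → E3) := by
  have h : ContDiff ℝ ∞ fun f : A → E3 => ∑ a, f a :=
    ContDiff.sum fun a _ => contDiff_apply ℝ E3 a
  exact h.const_smul _

theorem continuous_size : Continuous (size : (A → E3) → ℝ) := by
  unfold size
  have := (contDiff_mean (A := A)).continuous
  fun_prop

theorem contDiffAt_size {f : A → E3} (h : ∃ a a', f a ≠ f a') : ContDiffAt ℝ ∞ size f := by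
  have h1 := size_pos h
  refine ContDiffAt.sqrt ?_ (Real.sqrt_pos.1 h1).ne'
  refine ContDiff.contDiffAt (ContDiff.sum fun a _ => ?_)
  exact ((contDiff_apply ℝ E3 a).sub contDiff_mean).norm_sq ℝ

theorem contDiffAt_nrm {f : A → E3} (h : ∃ a a', f a ≠ f a') : ContDiffAt ℝ ∞ nrm f := by
  refine contDiffAt_pi.2 fun a => ?_
  exact ((contDiffAt_size h).inv (size_pos h).ne').smul
    ((contDiff_apply ℝ E3 a).sub contDiff_mean).contDiffAt

theorem nrm_sub (f : A → E3) (a b : A) : nrm f a - nrm f b = (size f)⁻¹ • (f a - f b) := by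
  rw [nrm, nrm, ← smul_sub, sub_sub_sub_cancel_right]

theorem isCompact_sphereMaps :
    IsCompact {f : A → E3 | ∑ a, f a = 0 ∧ ∑ a, ‖f a‖ ^ 2 = 1} := by
  refine Metric.isCompact_of_isClosed_isBounded ?_ ?_
  · exact (isClosed_eq (by fun_prop) continuous_const).inter
      (isClosed_eq (by fun_prop) continuous_const)
  · refine (Metric.isBounded_closedBall (x := (0 : A → E3)) (r := 1)).subset ?_
    rintro f ⟨-, hf⟩
    rw [mem_closedBall_zero_iff, pi_norm_le_iff_of_nonneg zero_le_one]
    intro a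
    have : ‖f a‖ ^ 2 ≤ 1 := hf ▸ Finset.single_le_sum (f := fun a => ‖f a‖ ^ 2)
      (fun b _ => by positivity) (Finset.mem_univ a)
    exact (sq_le_one_iff₀ (norm_nonneg _)).1 this

end Shapes

/-! ### The canonical map -/

namespace Diagram

variable {U : Type v} {T : Type w} {M : Type u}
  [TopologicalSpace M] [ChartedSpace (EuclideanHalfSpace 1) M] [Fintype U] [Fintype T]

instance (Γ : Diagram U T M) : Fintype Γ.ConnectedSets := Fintype.ofFinite _

/-- The vector space which contains the compactification: the shapes of the connected sets, the
positions of the univalent vertices, and the overall scale. The last factor is lifted to the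
universe of `M`, which matters only for the universe of the compactification. -/
abbrev Ambient (Γ : Diagram U T M) : Type (max u v w) :=
  (∀ A : Γ.ConnectedSets, A.1 → E3) × (U → E3) × ULift.{u} ℝ

/-- The overall scale of a configuration, in `[0, 1[`. It is recorded only if there is a single
univalent vertex; otherwise the scale is determined by the other data. -/
def scale (U : Type v) {T : Type w} [Fintype U] [Fintype T] (x : U ⊕ T → E3) : ℝ :=
  if Fintype.card U = 1 then size x / (1 + size x) else 0

/-- The canonical map, with values in the ambient vector space. -/
def canon (Γ : Diagram U T M) (x : U ⊕ T → E3) : Γ.Ambient :=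
  (fun A => nrm fun a : A.1 => x a, fun a => x (Sum.inl a), ⟨scale U x⟩)

/-- The compactification, as a subset of the ambient vector space. -/
def compactification (Γ : Diagram U T M) (L : M → E3) : Set Γ.Ambient :=
  closure (Γ.canon '' Γ.configSpace L)

open Classical in
/-- The shape of the set `A` given by a point of the ambient space, extended by zero. -/
def shape {Γ : Diagram U T M} (e : Γ.Ambient) (A : Finset (U ⊕ T)) (v : U ⊕ T) : E3 :=
  if h : IsConnSet Γ.fullGraph A ∧ v ∈ A then e.1 ⟨A, h.1⟩ ⟨v, h.2⟩ else 0

variable {Γ : Diagram U T M} {L : M → E3}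

theorem shape_eq {e : Γ.Ambient} {A : Finset (U ⊕ T)} (hA : IsConnSet Γ.fullGraph A) {v : U ⊕ T}
    (hv : v ∈ A) : shape e A v = e.1 ⟨A, hA⟩ ⟨v, hv⟩ := dif_pos ⟨hA, hv⟩

theorem contDiff_shape (A : Finset (U ⊕ T)) (v : U ⊕ T) :
    ContDiff ℝ ∞ fun e : Γ.Ambient => shape e A v := by
  unfold shape
  split_ifs with h
  · have h1 : ContDiff ℝ ∞ fun e : Γ.Ambient => e.1 ⟨A, h.1⟩ :=
      (ContinuousLinearMap.proj (R := ℝ) (φ := fun A : Γ.ConnectedSets => A.1 → E3)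
        ⟨A, h.1⟩).contDiff.comp contDiff_fst
    exact (contDiff_apply ℝ E3 (⟨v, h.2⟩ : A)).comp h1
  · exact contDiff_const

theorem contDiff_pos (a : U) : ContDiff ℝ ∞ fun e : Γ.Ambient => e.2.1 a :=
  (contDiff_apply ℝ E3 a).comp (contDiff_fst.comp contDiff_snd)

theorem fullGraph_adj {p q : U ⊕ T} : Γ.fullGraph.Adj p q ↔
    Γ.graph.Adj p q ∨ p ≠ q ∧ p.isLeft ∧ q.isLeft := by
  simp only [fullGraph, SimpleGraph.sup_adj, SimpleGraph.fromRel_adj]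
  tauto

theorem isConnSet_univ [Nonempty (U ⊕ T)] : IsConnSet Γ.fullGraph Finset.univ := by
  classical
  obtain ⟨x₀⟩ := ‹Nonempty (U ⊕ T)›
  obtain ⟨a₀, -⟩ := Γ.meets x₀
  constructor
  · obtain ⟨y, hy⟩ : (Γ.graph.neighborSet (Sum.inl a₀)).Nonempty := by
      apply Set.nonempty_of_ncard_ne_zero
      rw [Γ.univalent]
      exact one_ne_zero
    have : ({Sum.inl a₀, y} : Finset (U ⊕ T)).card ≤ Finset.univ.card :=
      Finset.card_le_card (Finset.subset_univ _)
    rwa [Finset.card_pair (show Sum.inl a₀ ≠ y from (show Γ.graph.Adj _ _ from hy).ne)] at this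
  · have hr : ∀ x : U ⊕ T, Γ.fullGraph.Reachable x (Sum.inl a₀) := by
      intro x
      obtain ⟨a, ha⟩ := Γ.meets x
      refine (ha.mono le_sup_left).trans ?_
      by_cases h : a = a₀
      · rw [h]
      · exact SimpleGraph.Adj.reachable (fullGraph_adj.2 (Or.inr ⟨by simpa using h, rfl, rfl⟩))
    have hc : Γ.fullGraph.Connected := by
      have : Nonempty (U ⊕ T) := ⟨x₀⟩
      exact ⟨fun x y => (hr x).trans (hr y).symm⟩
    rw [Finset.coe_univ]
    exact (SimpleGraph.induceUnivIso Γ.fullGraph).connected_iff.2 hc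

theorem isConnSet_range_inl (h : 2 ≤ Fintype.card U) :
    IsConnSet Γ.fullGraph (Finset.univ.map Function.Embedding.inl) := by
  refine ⟨by simpa using h, ?_⟩
  have hne : Nonempty U := Fintype.card_pos_iff.1 (by omega)
  have hcl : ∀ p q : ((Finset.univ.map Function.Embedding.inl : Finset (U ⊕ T)) : Set (U ⊕ T)),
      (Γ.fullGraph.induce _).Reachable p q := by
    rintro ⟨p, hp⟩ ⟨q, hq⟩
    by_cases hpq : p = q
    · subst hpq
      exact SimpleGraph.Reachable.refl _
    · refine SimpleGraph.Adj.reachable ?_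
      simp only [Finset.coe_map, Set.mem_image] at hp hq
      obtain ⟨a, -, rfl⟩ := hp
      obtain ⟨b, -, rfl⟩ := hq
      exact fullGraph_adj.2 (Or.inr ⟨hpq, rfl, rfl⟩)
  obtain ⟨a⟩ := hne
  have : Nonempty ((Finset.univ.map Function.Embedding.inl : Finset (U ⊕ T)) : Set (U ⊕ T)) :=
    ⟨⟨Sum.inl a, by simp⟩⟩
  exact ⟨hcl⟩

section Config

variable (hL : Function.Injective L)
include hL

theorem configSpace_ne {x : U ⊕ T → E3} (hx : x ∈ Γ.configSpace L) {p q : U ⊕ T}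
    (h : Γ.fullGraph.Adj p q) : x p ≠ x q := by
  obtain ⟨h1, i, hi, hxi⟩ := hx
  rcases fullGraph_adj.1 h with h | ⟨hne, hp, hq⟩
  · exact h1 p q h
  · obtain ⟨a, rfl⟩ := Sum.isLeft_iff.1 hp
    obtain ⟨b, rfl⟩ := Sum.isLeft_iff.1 hq
    rw [hxi, hxi]
    obtain ⟨i₀, -, hcls⟩ := Γ.isotopy
    rw [hcls] at hi
    have hin := pathComponentIn_subset hi
    exact fun h => hne (congrArg Sum.inl (hin.1 (hL h)))

theorem IsConnSet.exists_ne {x : U ⊕ T → E3} (hx : x ∈ Γ.configSpace L) {A : Finset (U ⊕ T)}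
    (hA : IsConnSet Γ.fullGraph A) : ∃ a a' : A, x a ≠ x a' := by
  obtain ⟨v, hv, w, hw, hvw⟩ := Finset.one_lt_card.1 hA.1
  obtain ⟨v, hv, w, hw, hadj, -⟩ := hA.exists_adj_ne (q := fun v => v) ⟨v, hv, w, hw, hvw⟩
  exact ⟨⟨v, hv⟩, ⟨w, hw⟩, configSpace_ne hL hx hadj⟩

theorem exists_ne_of_card_eq_one (hU : Fintype.card U = 1) {x : U ⊕ T → E3}
    (hx : x ∈ Γ.configSpace L) : ∃ a a', x a ≠ x a' := by
  have : Nonempty U := Fintype.card_pos_iff.1 (by omega)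
  obtain ⟨a, a', h⟩ := IsConnSet.exists_ne hL hx (isConnSet_univ (Γ := Γ))
  exact ⟨a, a', h⟩

theorem contDiffAt_canon {x : U ⊕ T → E3} (hx : x ∈ Γ.configSpace L) :
    ContDiffAt ℝ ∞ Γ.canon x := by
  refine ContDiffAt.prodMk ?_ (ContDiffAt.prodMk ?_ ?_)
  · refine contDiffAt_pi.2 fun A => ?_
    refine ContDiffAt.comp x (contDiffAt_nrm (IsConnSet.exists_ne hL hx A.2)) ?_
    exact contDiffAt_pi.2 fun a => (contDiff_apply ℝ E3 a.1).contDiffAt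
  · exact contDiffAt_pi.2 fun a => (contDiff_apply ℝ E3 (Sum.inl a)).contDiffAt
  · have : ContDiffAt ℝ ∞ (scale U (T := T)) x := by
      unfold scale
      split_ifs with h
      · have h1 := contDiffAt_size (exists_ne_of_card_eq_one hL h hx)
        exact h1.div (contDiffAt_const.add h1) (by have := size_nonneg x; positivity)
      · exact contDiffAt_const
    exact (ContinuousLinearEquiv.ulift (R₁ := ℝ) (M₁ := ℝ)).symm.contDiff.contDiffAt.comp x this

/-- The properties of the canonical images which are closed conditions, and hence hold in the
compactification: the shapes are normalised and compatible with restrictions, the positions of the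
univalent vertices are on the curve and, up to a nonnegative factor, their differences are those of
the shapes (`pos_norm` and `pos_inner`, which remain meaningful if the positions coincide). -/
structure IsLimitShape (Γ : Diagram U T M) (L : M → E3) (e : Γ.Ambient) : Prop where
  sphere : ∀ A : Γ.ConnectedSets, ∑ a, e.1 A a = 0 ∧ ∑ a, ‖e.1 A a‖ ^ 2 = 1
  restrict : ∀ (A B : Γ.ConnectedSets) (h : A.1 ⊆ B.1) (a : A.1),
    e.1 B ⟨a, h a.2⟩ - mean (fun a : A.1 => e.1 B ⟨a, h a.2⟩) =
      size (fun a : A.1 => e.1 B ⟨a, h a.2⟩) • e.1 A a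
  pos_mem : ∀ a, e.2.1 a ∈ Set.range L
  pos_norm : ∀ (A : Γ.ConnectedSets) (a b c d : U) (ha : Sum.inl a ∈ A.1) (hb : Sum.inl b ∈ A.1)
    (hc : Sum.inl c ∈ A.1) (hd : Sum.inl d ∈ A.1),
    ‖e.1 A ⟨_, ha⟩ - e.1 A ⟨_, hb⟩‖ * ‖e.2.1 c - e.2.1 d‖ =
      ‖e.1 A ⟨_, hc⟩ - e.1 A ⟨_, hd⟩‖ * ‖e.2.1 a - e.2.1 b‖
  pos_inner : ∀ (A : Γ.ConnectedSets) (a b : U) (ha : Sum.inl a ∈ A.1) (hb : Sum.inl b ∈ A.1),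
    inner ℝ (e.1 A ⟨_, ha⟩ - e.1 A ⟨_, hb⟩) (e.2.1 a - e.2.1 b) =
      ‖e.1 A ⟨_, ha⟩ - e.1 A ⟨_, hb⟩‖ * ‖e.2.1 a - e.2.1 b‖
  scale_mem : e.2.2.down ∈ Set.Icc (0 : ℝ) 1
  scale_eq : Fintype.card U ≠ 1 → e.2.2.down = 0

theorem isLimitShape_canon {x : U ⊕ T → E3} (hx : x ∈ Γ.configSpace L) :
    IsLimitShape Γ L (Γ.canon x) where
  sphere A := nrm_mem (IsConnSet.exists_ne hL hx A.2)
  restrict A B h a := by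
    have hB : ∀ a : A.1, (Γ.canon x).1 B ⟨a, h a.2⟩ =
        (size fun b : B.1 => x b)⁻¹ • x a + -((size fun b : B.1 => x b)⁻¹ • mean fun b : B.1 => x b)
        := fun a => by
      change nrm (fun b : B.1 => x b) _ = _
      rw [nrm, smul_sub, sub_eq_add_neg]
    have hp := size_pos (IsConnSet.exists_ne hL hx B.2)
    have hn := nrm_affine (f := fun a : A.1 => x a) (inv_pos.2 hp) hB
    rw [← size_smul_nrm (fun a : A.1 => (Γ.canon x).1 B ⟨a, h a.2⟩) a, hn]
    rfl
  pos_mem a := by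
    obtain ⟨-, i, -, hi⟩ := hx
    exact ⟨i a, (hi a).symm⟩
  pos_norm A a b c d ha hb hc hd := by
    simp only [canon]
    rw [nrm_sub, nrm_sub, norm_smul, norm_smul]
    ring
  pos_inner A a b ha hb := by
    simp only [canon]
    rw [nrm_sub, norm_smul, real_inner_smul_left, real_inner_self_eq_norm_mul_norm,
      Real.norm_of_nonneg (inv_nonneg.2 (size_nonneg _)), mul_assoc]
  scale_mem := by
    simp only [canon, scale]
    have := size_nonneg x
    split_ifs
    · exact ⟨by positivity, (div_le_one (by positivity)).2 (by linarith)⟩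
    · simp
  scale_eq h := by simp only [canon, scale, if_neg h]

theorem isLimitShape_of_mem [CompactSpace M] (hLc : Continuous L) {e : Γ.Ambient}
    (he : e ∈ Γ.compactification L) : IsLimitShape Γ L e := by
  have hcl : IsClosed {e : Γ.Ambient | IsLimitShape Γ L e} := by
    have h1 : ∀ A : Γ.ConnectedSets, ∀ a : A.1, Continuous fun e : Γ.Ambient => e.1 A a :=
      fun A a => by fun_prop
    have h2 : ∀ a, Continuous fun e : Γ.Ambient => e.2.1 a := fun a => by fun_prop
    have h3 : Continuous fun e : Γ.Ambient => e.2.2.down :=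
      continuous_uliftDown.comp (continuous_snd.comp continuous_snd)
    have h4 := isCompact_range hLc
    have heq : {e : Γ.Ambient | IsLimitShape Γ L e} =
        {e | ∀ A : Γ.ConnectedSets, ∑ a, e.1 A a = 0 ∧ ∑ a, ‖e.1 A a‖ ^ 2 = 1} ∩
        ({e | ∀ (A B : Γ.ConnectedSets) (h : A.1 ⊆ B.1) (a : A.1),
          e.1 B ⟨a, h a.2⟩ - mean (fun a : A.1 => e.1 B ⟨a, h a.2⟩) =
          size (fun a : A.1 => e.1 B ⟨a, h a.2⟩) • e.1 A a} ∩
        ({e | ∀ a, e.2.1 a ∈ Set.range L} ∩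
        ({e | ∀ (A : Γ.ConnectedSets) (a b c d : U) (ha : Sum.inl a ∈ A.1) (hb : Sum.inl b ∈ A.1)
          (hc : Sum.inl c ∈ A.1) (hd : Sum.inl d ∈ A.1),
          ‖e.1 A ⟨_, ha⟩ - e.1 A ⟨_, hb⟩‖ * ‖e.2.1 c - e.2.1 d‖ =
          ‖e.1 A ⟨_, hc⟩ - e.1 A ⟨_, hd⟩‖ * ‖e.2.1 a - e.2.1 b‖} ∩
        ({e | ∀ (A : Γ.ConnectedSets) (a b : U) (ha : Sum.inl a ∈ A.1) (hb : Sum.inl b ∈ A.1),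
          inner ℝ (e.1 A ⟨_, ha⟩ - e.1 A ⟨_, hb⟩) (e.2.1 a - e.2.1 b) =
          ‖e.1 A ⟨_, ha⟩ - e.1 A ⟨_, hb⟩‖ * ‖e.2.1 a - e.2.1 b‖} ∩
        ({e | e.2.2.down ∈ Set.Icc (0 : ℝ) 1} ∩
        {e | Fintype.card U ≠ 1 → e.2.2.down = 0}))))) := by
      ext e
      exact ⟨fun h => ⟨h.1, h.2, h.3, h.4, h.5, h.6, h.7⟩,
        fun ⟨h1, h2, h3, h4, h5, h6, h7⟩ => ⟨h1, h2, h3, h4, h5, h6, h7⟩⟩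
    rw [heq]
    have hm : ∀ (A B : Γ.ConnectedSets) (h : A.1 ⊆ B.1), Continuous fun e : Γ.Ambient =>
        (fun a : A.1 => e.1 B ⟨a, h a.2⟩) := fun A B h => by fun_prop
    refine IsClosed.inter ?_ (IsClosed.inter ?_ (IsClosed.inter ?_ (IsClosed.inter ?_
      (IsClosed.inter ?_ (IsClosed.inter ?_ ?_)))))
    · simp only [Set.ofPred_forall, Set.ofPred_and]
      exact isClosed_iInter fun A => (isClosed_eq (by fun_prop) continuous_const).inter
        (isClosed_eq (by fun_prop) continuous_const)
    · simp only [Set.ofPred_forall]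
      refine isClosed_iInter fun A => isClosed_iInter fun B => isClosed_iInter fun h =>
        isClosed_iInter fun a => isClosed_eq ?_ ?_
      · exact (h1 _ _).sub (contDiff_mean.continuous.comp (hm A B h))
      · exact (continuous_size.comp (hm A B h)).smul (h1 _ _)
    · simp only [Set.ofPred_forall]
      exact isClosed_iInter fun a => h4.isClosed.preimage (h2 a)
    · simp only [Set.ofPred_forall]
      refine isClosed_iInter fun A => isClosed_iInter fun a => isClosed_iInter fun b =>
        isClosed_iInter fun c => isClosed_iInter fun d => isClosed_iInter fun _ =>
        isClosed_iInter fun _ => isClosed_iInter fun _ => isClosed_iInter fun _ =>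
        isClosed_eq (by fun_prop) (by fun_prop)
    · simp only [Set.ofPred_forall]
      refine isClosed_iInter fun A => isClosed_iInter fun a => isClosed_iInter fun b =>
        isClosed_iInter fun _ => isClosed_iInter fun _ => isClosed_eq (by fun_prop) (by fun_prop)
    · exact isClosed_Icc.preimage h3
    · by_cases h : Fintype.card U = 1
      · simp [h]
      · simpa [h] using isClosed_eq h3 continuous_const
  refine closure_minimal ?_ hcl he
  rintro _ ⟨x, hx, rfl⟩
  exact isLimitShape_canon hL hx

theorem isCompact_compactification [CompactSpace M] (hLc : Continuous L) :
    IsCompact (Γ.compactification L) := by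
  have h1 : IsCompact ((Set.univ.pi fun A : Γ.ConnectedSets =>
      {f : A.1 → E3 | ∑ a, f a = 0 ∧ ∑ a, ‖f a‖ ^ 2 = 1}) ×ˢ
      ((Set.univ.pi fun _ : U => Set.range L) ×ˢ (ULift.up.{u} '' Set.Icc (0 : ℝ) 1))) :=
    (isCompact_univ_pi fun A => isCompact_sphereMaps).prod
      ((isCompact_univ_pi fun _ => isCompact_range hLc).prod
        (isCompact_Icc.image continuous_uliftUp))
  refine h1.of_isClosed_subset isClosed_closure ?_
  intro e he
  have := isLimitShape_of_mem hL hLc he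
  exact ⟨fun A _ => this.sphere A, fun a _ => this.pos_mem a, ⟨_, this.scale_mem, rfl⟩⟩

end Config

end Diagram

/-! ### The clusters at a point of the compactification -/

/-- A finite type can be numbered compatibly with a real-valued function. -/
theorem exists_injective_key {V : Type*} [Fintype V] (f : V → ℝ) :
    ∃ key : V → ℕ, Function.Injective key ∧ ∀ v w, f v < f w → key v < key w := by
  classical
  let e := Fintype.equivFin V
  let k : V → ℝ ×ₗ Fin (Fintype.card V) := fun v => toLex (f v, e v)
  have hk : Function.Injective k := fun v w h => e.injective (congrArg (fun z => (ofLex z).2) h)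
  have hmono : ∀ v w, k v < k w →
      (Finset.univ.filter fun z => k z < k v).card <
        (Finset.univ.filter fun z => k z < k w).card := by
    intro v w h
    refine Finset.card_lt_card (Finset.ssubset_iff_of_subset ?_ |>.2 ⟨v, by simpa using h, by simp⟩)
    intro z hz
    simp only [Finset.mem_filter, Finset.mem_univ, true_and] at hz ⊢
    exact hz.trans h
  refine ⟨fun v => (Finset.univ.filter fun z => k z < k v).card, fun v w h => ?_, fun v w h => ?_⟩
  · rcases lt_trichotomy (k v) (k w) with h' | h' | h'
    · exact absurd h (hmono v w h').ne
    · exact hk h'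
    · exact absurd h (hmono w v h').ne'
  · exact hmono v w (Prod.Lex.toLex_lt_toLex.2 (Or.inl h))

/-- Two functions which agree on a set agree at the points of its closure where both are
continuous. -/
theorem eq_of_mem_closure {X Y : Type*} [TopologicalSpace X] [TopologicalSpace Y] [T2Space Y]
    {S : Set X} {p : X} (hp : p ∈ closure S) {f g : X → Y} (hf : ContinuousAt f p)
    (hg : ContinuousAt g p) (h : ∀ᶠ e in 𝓝 p, e ∈ S → f e = g e) : f p = g p := by
  have hne := mem_closure_iff_nhdsWithin_neBot.1 hp
  refine tendsto_nhds_unique_of_eventuallyEq (hf.mono_left nhdsWithin_le_nhds)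
    (hg.mono_left nhdsWithin_le_nhds) (l := 𝓝[S] p) ?_
  exact eventually_nhdsWithin_iff.2 h

theorem le_of_mem_closure {X : Type*} [TopologicalSpace X]
    {S : Set X} {p : X} (hp : p ∈ closure S) {f g : X → ℝ} (hf : ContinuousAt f p)
    (hg : ContinuousAt g p) (h : ∀ᶠ e in 𝓝 p, e ∈ S → f e ≤ g e) : f p ≤ g p := by
  have hne := mem_closure_iff_nhdsWithin_neBot.1 hp
  refine le_of_tendsto_of_tendsto (hf.mono_left nhdsWithin_le_nhds)
    (hg.mono_left nhdsWithin_le_nhds) (b := 𝓝[S] p) ?_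
  exact eventually_nhdsWithin_iff.2 h

namespace Diagram

variable {U : Type v} {T : Type w} {M : Type u}
  [TopologicalSpace M] [ChartedSpace (EuclideanHalfSpace 1) M] [Fintype U] [Fintype T]
  {Γ : Diagram U T M} {L : M → E3}

theorem shape_canon_sub (x : U ⊕ T → E3) {A : Finset (U ⊕ T)} (hA : IsConnSet Γ.fullGraph A)
    {v w : U ⊕ T} (hv : v ∈ A) (hw : w ∈ A) :
    shape (Γ.canon x) A v - shape (Γ.canon x) A w = (size fun a : A => x a)⁻¹ • (x v - x w) := by
  rw [shape_eq hA hv, shape_eq hA hw]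
  exact nrm_sub (fun a : A => x a) _ _

/-- Local parameters of the curve near the positions of the univalent vertices in `p`, chosen equal
for vertices which have the same position. -/
structure Footing (Γ : Diagram U T M) (L : M → E3) (p : Γ.Ambient) where
  prm : ∀ m, LocalParam L m
  foot : U → M
  foot_eq : ∀ a, L (foot a) = p.2.1 a

namespace Footing

variable {p : Γ.Ambient} (d : Footing Γ L p)

/-- The local parameter at a univalent vertex. -/
def par (a : U) : LocalParam L (d.foot a) := d.prm (d.foot a)

/-- The value of the local parameter at `p`. -/
def s₀ (a : U) : ℝ := (d.par a).σ (p.2.1 a)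

theorem s₀_eq (a : U) : d.s₀ a = (d.par a).σ (L (d.foot a)) := by rw [s₀, d.foot_eq]

theorem σ_congr {a b : U} (h : d.foot a = d.foot b) : (d.par a).σ = (d.par b).σ :=
  congrArg (fun m => (d.prm m).σ) h

theorem ℓ_congr {a b : U} (h : d.foot a = d.foot b) : (d.par a).ℓ = (d.par b).ℓ :=
  congrArg (fun m => (d.prm m).ℓ) h

theorem s₀_congr {a b : U} (h : d.foot a = d.foot b) : d.s₀ a = d.s₀ b := by
  rw [s₀, s₀, ← d.foot_eq, ← d.foot_eq, d.σ_congr h, h]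

theorem slope_s₀_ne (a : U) : (d.par a).slope (d.s₀ a, d.s₀ a) ≠ 0 := by
  refine (d.par a).slope_ne ?_
  rw [d.s₀_eq, sub_self, abs_zero]
  exact (d.par a).ε_pos

/-- The configurations whose canonical image is close to `p` are given by the local parameters. -/
theorem eventually_good : ∀ᶠ e in 𝓝 p, ∀ x ∈ Γ.configSpace L, Γ.canon x = e → ∀ a,
    (d.par a).ℓ ((d.par a).σ (x (Sum.inl a))) = x (Sum.inl a) ∧
      0 < (d.par a).σ (x (Sum.inl a)) := by
  have h : ∀ a, ∀ᶠ e in 𝓝 p, e.2.1 a ∈ (d.par a).nhd := fun a =>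
    (contDiff_pos (Γ := Γ) a).continuous.continuousAt.eventually
      ((d.par a).isOpen_nhd.mem_nhds
        (by change p.2.1 a ∈ _; rw [← d.foot_eq]; exact (d.par a).mem_nhd))
  filter_upwards [Filter.eventually_all.2 h] with e he x hx hxe a
  have h1 : x (Sum.inl a) ∈ (d.par a).nhd := by
    have := he a
    rwa [← hxe] at this
  obtain ⟨-, i, hi, hxi⟩ := hx
  obtain ⟨i₀, -, hcls⟩ := Γ.isotopy
  rw [hcls] at hi
  have hin := (pathComponentIn_subset hi).2 a
  rw [hxi] at h1 ⊢
  exact ⟨(d.par a).ℓ_σ _ h1, ((d.par a).interior_iff _ h1).1 hin⟩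

/-- A function with the sign of the difference of the parameters of the univalent vertices `b` and
`a`, defined in terms of the shape of `A`. -/
def cross (A : Finset (U ⊕ T)) (a b : U) (e : Γ.Ambient) : ℝ :=
  inner ℝ (shape e A (Sum.inl b) - shape e A (Sum.inl a))
    ((d.par a).slope ((d.par a).σ (e.2.1 a), (d.par a).σ (e.2.1 b)))

theorem contDiff_slope_pos (a b : U) : ContDiff ℝ ∞ fun e : Γ.Ambient =>
    (d.par a).slope ((d.par a).σ (e.2.1 a), (d.par a).σ (e.2.1 b)) :=
  (d.par a).contDiff_slope.comp (((d.par a).contDiff_σ.comp (contDiff_pos a)).prodMk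
    ((d.par a).contDiff_σ.comp (contDiff_pos b)))

theorem continuous_cross (A : Finset (U ⊕ T)) (a b : U) : Continuous (d.cross A a b) :=
  ((contDiff_shape A _).continuous.sub (contDiff_shape A _).continuous).inner
    (d.contDiff_slope_pos a b).continuous

/-- The differences of two univalent vertices in the shape of `A` are multiples of the slope of the
curve, by a factor with the sign of the difference of the parameters. -/
theorem eventually_shape_sub {A : Finset (U ⊕ T)} (hA : IsConnSet Γ.fullGraph A) {a b : U}
    (ha : Sum.inl a ∈ A) (hb : Sum.inl b ∈ A) (hab : d.foot a = d.foot b) :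
    ∀ᶠ e in 𝓝 p, ∀ x ∈ Γ.configSpace L, Γ.canon x = e →
      shape e A (Sum.inl b) - shape e A (Sum.inl a) = ((size fun v : A => x v)⁻¹ *
        ((d.par a).σ (x (Sum.inl b)) - (d.par a).σ (x (Sum.inl a)))) •
        (d.par a).slope ((d.par a).σ (e.2.1 a), (d.par a).σ (e.2.1 b)) := by
  filter_upwards [d.eventually_good] with e he x hx hxe
  have h1 := (he x hx hxe a).1
  have h2 := (he x hx hxe b).1
  rw [← d.σ_congr hab, ← d.ℓ_congr hab] at h2
  subst hxe
  rw [shape_canon_sub x hA hb ha, mul_smul]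
  congr 1
  simp only [canon]
  rw [← (d.par a).slope_eq, h1, h2]

/-- The difference of two univalent vertices with equal positions is tangent to the curve in the
shape of `A`, so that `cross` is not zero if the shape separates them. -/
theorem abs_cross (hp : p ∈ Γ.compactification L)
    {A : Finset (U ⊕ T)} (hA : IsConnSet Γ.fullGraph A) {a b : U} (ha : Sum.inl a ∈ A)
    (hb : Sum.inl b ∈ A) (hab : d.foot a = d.foot b) :
    |d.cross A a b p| = ‖shape p A (Sum.inl b) - shape p A (Sum.inl a)‖ *
      ‖(d.par a).slope ((d.par a).σ (p.2.1 a), (d.par a).σ (p.2.1 b))‖ := by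
  refine eq_of_mem_closure hp (d.continuous_cross A a b).abs.continuousAt
    (Continuous.continuousAt ?_) (f := fun e => |d.cross A a b e|)
    (g := fun e => ‖shape e A (Sum.inl b) - shape e A (Sum.inl a)‖ *
      ‖(d.par a).slope ((d.par a).σ (e.2.1 a), (d.par a).σ (e.2.1 b))‖) ?_
  · exact ((contDiff_shape A _).continuous.sub (contDiff_shape A _).continuous).norm.mul
      (d.contDiff_slope_pos a b).continuous.norm
  · filter_upwards [d.eventually_shape_sub hA ha hb hab] with e he
    rintro ⟨x, hx, hxe⟩
    simp only [cross]
    rw [he x hx hxe, real_inner_smul_left, abs_mul, norm_smul, Real.norm_eq_abs,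
      real_inner_self_eq_norm_mul_norm, abs_mul_abs_self_norm, mul_assoc]
where abs_mul_abs_self_norm {y : E3} : |‖y‖ * ‖y‖| = ‖y‖ * ‖y‖ := abs_of_nonneg (by positivity)

theorem slope_pos_ne {a b : U} (hab : d.foot a = d.foot b) :
    (d.par a).slope ((d.par a).σ (p.2.1 a), (d.par a).σ (p.2.1 b)) ≠ 0 := by
  rw [← d.foot_eq b, ← hab, d.foot_eq]
  exact d.slope_s₀_ne a

variable (hL : Function.Injective L)
include hL

theorem eventually_lt_of_cross_pos {A : Finset (U ⊕ T)} (hA : IsConnSet Γ.fullGraph A) {a b : U}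
    (ha : Sum.inl a ∈ A) (hb : Sum.inl b ∈ A) (hab : d.foot a = d.foot b)
    (h : 0 < d.cross A a b p) : ∀ᶠ e in 𝓝 p, ∀ x ∈ Γ.configSpace L, Γ.canon x = e →
      (d.par a).σ (x (Sum.inl a)) < (d.par a).σ (x (Sum.inl b)) := by
  filter_upwards [d.eventually_shape_sub hA ha hb hab,
    (d.continuous_cross A a b).continuousAt.eventually (lt_mem_nhds h)] with e he h0 x hx hxe
  simp only [cross] at h0
  rw [he x hx hxe, real_inner_smul_left, real_inner_self_eq_norm_mul_norm] at h0
  have h1 := size_pos (IsConnSet.exists_ne hL hx hA)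
  by_contra! hle
  have : (size fun v : A => x v)⁻¹ *
      ((d.par a).σ (x (Sum.inl b)) - (d.par a).σ (x (Sum.inl a))) ≤ 0 :=
    mul_nonpos_of_nonneg_of_nonpos (inv_nonneg.2 h1.le) (by linarith)
  have h2 : 0 ≤ ‖(d.par a).slope ((d.par a).σ (e.2.1 a), (d.par a).σ (e.2.1 b))‖ *
      ‖(d.par a).slope ((d.par a).σ (e.2.1 a), (d.par a).σ (e.2.1 b))‖ := by positivity
  linarith [mul_nonpos_of_nonpos_of_nonneg this h2]

theorem eventually_lt_of_cross_neg {A : Finset (U ⊕ T)} (hA : IsConnSet Γ.fullGraph A) {a b : U}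
    (ha : Sum.inl a ∈ A) (hb : Sum.inl b ∈ A) (hab : d.foot a = d.foot b)
    (h : d.cross A a b p < 0) : ∀ᶠ e in 𝓝 p, ∀ x ∈ Γ.configSpace L, Γ.canon x = e →
      (d.par a).σ (x (Sum.inl b)) < (d.par a).σ (x (Sum.inl a)) := by
  filter_upwards [d.eventually_shape_sub hA ha hb hab,
    (d.continuous_cross A a b).continuousAt.eventually (gt_mem_nhds h)] with e he h0 x hx hxe
  simp only [cross] at h0
  rw [he x hx hxe, real_inner_smul_left, real_inner_self_eq_norm_mul_norm] at h0
  by_contra! hle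
  have h1 := size_nonneg fun v : A => x v
  have : 0 ≤ (size fun v : A => x v)⁻¹ *
      ((d.par a).σ (x (Sum.inl b)) - (d.par a).σ (x (Sum.inl a))) :=
    mul_nonneg (inv_nonneg.2 h1) (by linarith)
  have h2 : 0 ≤ ‖(d.par a).slope ((d.par a).σ (e.2.1 a), (d.par a).σ (e.2.1 b))‖ *
      ‖(d.par a).slope ((d.par a).σ (e.2.1 a), (d.par a).σ (e.2.1 b))‖ := by positivity
  linarith [mul_nonneg this h2]

end Footing

/-- The combinatorial structure of a point `p` of the compactification: the nested family of the
clusters of `p`, and a ranking of the vertices in which the univalent vertices come first and which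
follows the curve at the univalent vertices with equal positions. A cluster is collapsed to a point
in the shapes of the larger ones (`const`), and every connected set is visible in the shape of some
cluster that contains it (`sep`). -/
structure ClusterData [DecidableEq (U ⊕ T)] (Γ : Diagram U T M) (L : M → E3) (p : Γ.Ambient)
    extends Footing Γ L p where
  𝒯 : Nest (U ⊕ T)
  conn : ∀ A ∈ 𝒯.cl, IsConnSet Γ.fullGraph A
  const : ∀ A ∈ 𝒯.cl, ∀ B ∈ 𝒯.cl, B ⊂ A → ∀ v ∈ B, ∀ w ∈ B, shape p A v = shape p A w
  sep : ∀ B, IsConnSet Γ.fullGraph B →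
    ∃ A ∈ 𝒯.cl, B ⊆ A ∧ ∃ v ∈ B, ∃ w ∈ B, shape p A v ≠ shape p A w
  key_lt : ∀ a t, 𝒯.key (Sum.inl a) < 𝒯.key (Sum.inr t)
  order : ∀ᶠ e in 𝓝 p, ∀ x ∈ Γ.configSpace L, Γ.canon x = e → ∀ a b,
    toFooting.foot a = toFooting.foot b → 𝒯.key (Sum.inl a) < 𝒯.key (Sum.inl b) →
    (toFooting.par a).σ (x (Sum.inl a)) < (toFooting.par a).σ (x (Sum.inl b))

theorem exists_shape_ne {p : Γ.Ambient} (hp : IsLimitShape Γ L p) {A : Finset (U ⊕ T)}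
    (hA : IsConnSet Γ.fullGraph A) : ∃ v ∈ A, ∃ w ∈ A, shape p A v ≠ shape p A w := by
  by_contra! hc
  have h := hp.sphere ⟨A, hA⟩
  obtain ⟨v, hv⟩ : A.Nonempty := Finset.card_pos.1 (by have := hA.1; omega)
  have h1 : ∀ a : A, p.1 ⟨A, hA⟩ a = p.1 ⟨A, hA⟩ ⟨v, hv⟩ := fun a => by
    have := hc a a.2 v hv
    rwa [shape_eq hA a.2, shape_eq hA hv] at this
  have h2 : p.1 ⟨A, hA⟩ ⟨v, hv⟩ = 0 := by
    have h3 := h.1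
    simp only [h1, Finset.sum_const, Finset.card_univ, ← Nat.cast_smul_eq_nsmul ℝ] at h3
    have : Nonempty A := ⟨⟨v, hv⟩⟩
    have hc : (Fintype.card A : ℝ) ≠ 0 := by positivity
    exact (smul_eq_zero.1 h3).resolve_left hc
  have h3 := h.2
  simp only [h1] at h3
  simp [h2] at h3

/-- The clusters are given by the shapes at `p`. The ranking is copied from a configuration whose
canonical image is close to `p`: the order of two univalent vertices with equal positions is
determined by the sign of `cross` at `p`, hence is the same for all such configurations. -/
theorem nonempty_clusterData [DecidableEq (U ⊕ T)] [Nonempty U] [CompactSpace M]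
    [IsManifold (𝓡∂ 1) ∞ M] (hL : Manifold.IsSmoothEmbedding (𝓡∂ 1) 𝓘(ℝ, E3) ∞ L)
    {p : Γ.Ambient} (hp : p ∈ Γ.compactification L) : Nonempty (ClusterData Γ L p) := by
  have hinj := hL.isEmbedding.injective
  have hlim := isLimitShape_of_mem hinj hL.isEmbedding.continuous hp
  choose foot hfoot using hlim.pos_mem
  let d : Footing Γ L p := ⟨fun m => (exists_localParam hL m).some, foot, hfoot⟩
  obtain ⟨cl, hcl1, hcl2, hcl3, hcl4, hcl5⟩ := exists_clusters (G := Γ.fullGraph)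
    (fun A v => shape p A v) isConnSet_univ (fun A hA => exists_shape_ne hlim hA) (by
      intro A B hA hB hAB
      have hr := hlim.restrict ⟨A, hA⟩ ⟨B, hB⟩ hAB
      by_cases h0 : size (fun a : A => p.1 ⟨B, hB⟩ ⟨a, hAB a.2⟩) = 0
      · left
        intro v hv w hw
        rw [shape_eq hB (hAB hv), shape_eq hB (hAB hw)]
        exact (eq_mean_of_size_eq_zero h0 ⟨v, hv⟩).trans (eq_mean_of_size_eq_zero h0 ⟨w, hw⟩).symm
      · right
        intro v hv w hw
        rw [shape_eq hB (hAB hv), shape_eq hB (hAB hw), shape_eq hA hv, shape_eq hA hw,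
          ← sub_left_inj (a := mean fun a : A => p.1 ⟨B, hB⟩ ⟨a, hAB a.2⟩), hr ⟨v, hv⟩, hr ⟨w, hw⟩]
        exact ⟨fun h => smul_right_injective E3 h0 h, fun h => by rw [h]⟩)
  -- for two univalent vertices with equal positions, the shape of the pair determines their order
  have hadj : ∀ a b : U, a ≠ b → Γ.fullGraph.Adj (Sum.inl a) (Sum.inl b) := fun a b hab =>
    fullGraph_adj.2 (Or.inr ⟨by simpa using hab, rfl, rfl⟩)
  have hsign : ∀ a b, a ≠ b → d.foot a = d.foot b →
      (∀ᶠ e in 𝓝 p, ∀ x ∈ Γ.configSpace L, Γ.canon x = e →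
        (d.par a).σ (x (Sum.inl a)) < (d.par a).σ (x (Sum.inl b))) ∨
      (∀ᶠ e in 𝓝 p, ∀ x ∈ Γ.configSpace L, Γ.canon x = e →
        (d.par a).σ (x (Sum.inl b)) < (d.par a).σ (x (Sum.inl a))) := by
    intro a b hab hf
    have hA := IsConnSet.pair (hadj a b hab)
    have ha : Sum.inl a ∈ ({Sum.inl a, Sum.inl b} : Finset (U ⊕ T)) := by simp
    have hb : Sum.inl b ∈ ({Sum.inl a, Sum.inl b} : Finset (U ⊕ T)) := by simp
    have hne : d.cross {Sum.inl a, Sum.inl b} a b p ≠ 0 := by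
      rw [← abs_ne_zero, d.abs_cross hp hA ha hb hf]
      refine mul_ne_zero (norm_ne_zero_iff.2 (sub_ne_zero.2 ?_))
        (norm_ne_zero_iff.2 (d.slope_pos_ne hf))
      obtain ⟨v, hv, w, hw, hvw⟩ := exists_shape_ne hlim hA
      simp only [Finset.mem_insert, Finset.mem_singleton] at hv hw
      rcases hv with rfl | rfl <;> rcases hw with rfl | rfl
      · exact absurd rfl hvw
      · exact hvw.symm
      · exact hvw
      · exact absurd rfl hvw
    rcases hne.lt_or_gt with h | h
    · exact Or.inr (d.eventually_lt_of_cross_neg hinj hA ha hb hf h)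
    · exact Or.inl (d.eventually_lt_of_cross_pos hinj hA ha hb hf h)
  -- a configuration close to `p` gives the ranking
  let Lt : U → U → Prop := fun a b => ∀ᶠ e in 𝓝 p, ∀ x ∈ Γ.configSpace L, Γ.canon x = e →
        (d.par a).σ (x (Sum.inl a)) < (d.par a).σ (x (Sum.inl b))
  have hcmp : ∀ᶠ e in 𝓝 p, ∀ a b, Lt a b → ∀ x ∈ Γ.configSpace L, Γ.canon x = e →
        (d.par a).σ (x (Sum.inl a)) < (d.par a).σ (x (Sum.inl b)) := by
    refine Filter.eventually_all.2 fun a => Filter.eventually_all.2 fun b => ?_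
    by_cases h : Lt a b
    · filter_upwards [h] with e he _ using he
    · exact Filter.Eventually.of_forall fun e h' => absurd h' h
  obtain ⟨_, hz, ⟨z, hzC, rfl⟩⟩ := mem_closure_iff_nhds.1 hp _ hcmp
  obtain ⟨key, hkey, hkl⟩ := exists_injective_key (V := U ⊕ T) (Sum.elim
    (fun a => (d.par a).σ (z (Sum.inl a))) (fun _ => (∑ a, |(d.par a).σ (z (Sum.inl a))|) + 1))
  refine ⟨{ d with
    𝒯 := ⟨cl, fun A hA => Finset.card_pos.1 (by have := (hcl1 A hA).1; omega), hcl2, hcl3, key,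
      hkey⟩
    conn := hcl1, const := hcl4, sep := hcl5
    key_lt := fun a t => hkl _ _ ?_
    order := ?_ }⟩
  · simp only [Sum.elim_inl, Sum.elim_inr]
    have := Finset.single_le_sum (f := fun a => |(d.par a).σ (z (Sum.inl a))|)
      (fun _ _ => abs_nonneg _) (Finset.mem_univ a)
    have h2 := le_abs_self ((d.par a).σ (z (Sum.inl a)))
    linarith
  · filter_upwards [hcmp] with e he x hx hxe a b hf hk
    have hab : a ≠ b := by rintro rfl; exact lt_irrefl _ hk
    rcases hsign a b hab hf with h | h
    · exact he a b h x hx hxe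
    · exfalso
      have h' : Lt b a := by
        change ∀ᶠ e in 𝓝 p, _
        rw [← d.σ_congr hf]
        exact h
      have h1 := hz b a h' z hzC rfl
      rw [← d.σ_congr hf] at h1
      have := hkl (Sum.inl b) (Sum.inl a) (by
        simp only [Sum.elim_inl]
        rwa [← d.σ_congr hf])
      exact lt_asymm this hk

end Diagram

/-! ### The formulas for the coordinates -/

namespace Diagram

variable {U : Type v} {T : Type w} {M : Type u}
  [TopologicalSpace M] [ChartedSpace (EuclideanHalfSpace 1) M] [Fintype U] [Fintype T]
  {Γ : Diagram U T M} {L : M → E3} {p : Γ.Ambient}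

namespace ClusterData

variable [DecidableEq (U ⊕ T)] [Nonempty U] (d : ClusterData Γ L p)

/-- Near the position of `p`, all choices of parameters in the given order along the curve belong to
the isotopy class: they can be joined by a segment to those of a configuration close to `p`. -/
theorem eventually_mem_cls (hL : Topology.IsEmbedding L) (hp : p ∈ Γ.compactification L) :
    ∀ᶠ s in 𝓝 (fun a => d.s₀ a), (∀ a, 0 < s a) → (∀ a b, d.foot a = d.foot b →
      d.𝒯.key (Sum.inl a) < d.𝒯.key (Sum.inl b) → s a < s b) →
      ∃ i ∈ Γ.cls, ∀ a, L (i a) = (d.par a).ℓ (s a) := by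
  have hℓ₀ : ∀ a, (d.par a).ℓ (d.s₀ a) = L (d.foot a) := fun a => by
    rw [d.s₀_eq]
    exact (d.par a).ℓ_σ _ (d.par a).mem_nhd
  have e1 : ∀ᶠ s in 𝓝 (fun a => d.s₀ a), ∀ a, |s a - (d.par a).σ (L (d.foot a))| < (d.par a).ε := by
    refine Filter.eventually_all.2 fun a => ?_
    refine (isOpen_lt (f := fun s : U → ℝ => |s a - (d.par a).σ (L (d.foot a))|) (by fun_prop)
      continuous_const).mem_nhds ?_
    change |d.s₀ a - _| < _
    rw [d.s₀_eq, sub_self, abs_zero]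
    exact (d.par a).ε_pos
  have e2 : ∀ᶠ s in 𝓝 (fun a => d.s₀ a), ∀ a b, d.foot a ≠ d.foot b →
      (d.par a).ℓ (s a) ≠ (d.par b).ℓ (s b) := by
    refine Filter.eventually_all.2 fun a => Filter.eventually_all.2 fun b => ?_
    by_cases h : d.foot a = d.foot b
    · exact Filter.Eventually.of_forall fun s h' => absurd h h'
    · have ha : Continuous fun s : U → ℝ => (d.par a).ℓ (s a) :=
        (d.par a).contDiff_ℓ.continuous.comp (continuous_apply a)
      have hb : Continuous fun s : U → ℝ => (d.par b).ℓ (s b) :=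
        (d.par b).contDiff_ℓ.continuous.comp (continuous_apply b)
      filter_upwards [(isOpen_ne_fun ha hb).mem_nhds (show (d.par a).ℓ (d.s₀ a) ≠ _ by
        rw [hℓ₀, hℓ₀]
        exact fun h' => h (hL.injective h'))] with s hs _ using hs
  obtain ⟨η, hη, hball⟩ := Metric.eventually_nhds_iff.1 (e1.and e2)
  -- the convex set of all admissible parameters close to those of `p`
  let D : Set (U → ℝ) := {s | dist s (fun a => d.s₀ a) < η ∧ (∀ a, 0 < s a) ∧
    ∀ a b, d.foot a = d.foot b → d.𝒯.key (Sum.inl a) < d.𝒯.key (Sum.inl b) → s a < s b}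
  have hDconv : Convex ℝ D := by
    refine (convex_ball (fun a => d.s₀ a) η).inter (Convex.inter ?_ ?_)
    · intro s hs s' hs' α β hα hβ hαβ a
      have h1 := hs a
      have h2 := hs' a
      simp only [Pi.add_apply, Pi.smul_apply, smul_eq_mul]
      rcases hα.eq_or_lt with rfl | hα'
      · rw [zero_add] at hαβ
        subst hαβ
        simpa using h2
      · have := mul_pos hα' h1
        have := mul_nonneg hβ h2.le
        linarith
    · intro s hs s' hs' α β hα hβ hαβ a b hf hk
      have h1 := hs a b hf hk
      have h2 := hs' a b hf hk
      simp only [Pi.add_apply, Pi.smul_apply, smul_eq_mul]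
      rcases hα.eq_or_lt with rfl | hα'
      · rw [zero_add] at hαβ
        subst hαβ
        simpa using h2
      · have := mul_lt_mul_of_pos_left h1 hα'
        have := mul_le_mul_of_nonneg_left h2.le hβ
        linarith
  have hex : ∀ s : U → ℝ, ∃ i : U → M, s ∈ D → ∀ a, L (i a) = (d.par a).ℓ (s a) := by
    intro s
    by_cases hs : s ∈ D
    · have h : ∀ a, ∃ m, L m = (d.par a).ℓ (s a) := fun a =>
        (d.par a).ℓ_mem _ ((hball hs.1).1 a) (hs.2.1 a).le
      choose i hi using h
      exact ⟨i, fun _ => hi⟩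
    · exact ⟨d.foot, fun h => absurd h hs⟩
  choose I hI using hex
  have hIc : ContinuousOn I D := by
    refine continuousOn_pi.2 fun a => ?_
    rw [hL.isInducing.continuousOn_iff]
    refine ContinuousOn.congr (f := fun s : U → ℝ => (d.par a).ℓ (s a)) ?_ fun s hs => hI s hs a
    exact ((d.par a).contDiff_ℓ.continuous.comp (continuous_apply a)).continuousOn
  have hIm : Set.MapsTo I D (interiorInjections U M) := by
    intro s hs
    have hb := hball hs.1
    refine ⟨fun a b hab => ?_, fun a => ?_⟩
    · by_contra hne
      have hLab := congrArg L hab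
      rw [hI s hs, hI s hs] at hLab
      by_cases hf : d.foot a = d.foot b
      · have h1 := congrArg (d.par a).σ hLab
        rw [(d.par a).σ_ℓ _ (hb.1 a), d.σ_congr hf, (d.par b).σ_ℓ _ (hb.1 b)] at h1
        have hk : d.𝒯.key (Sum.inl a) ≠ d.𝒯.key (Sum.inl b) :=
          fun h => hne (Sum.inl_injective (d.𝒯.key_inj h))
        rcases hk.lt_or_gt with h | h
        · exact (hs.2.2 a b hf h).ne h1
        · exact (hs.2.2 b a hf.symm h).ne h1.symm
      · exact hb.2 a b hf hLab
    · have h1 := (d.par a).ℓ_mem_nhd _ (hb.1 a)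
      rw [← hI s hs] at h1
      rw [(d.par a).interior_iff _ h1, hI s hs, (d.par a).σ_ℓ _ (hb.1 a)]
      exact hs.2.1 a
  -- a configuration close to `p`
  have e3 : ∀ᶠ e : Γ.Ambient in 𝓝 p,
      dist (fun a => (d.par a).σ (e.2.1 a)) (fun a => d.s₀ a) < η := by
    have hc : Continuous fun e : Γ.Ambient => fun a => (d.par a).σ (e.2.1 a) :=
      continuous_pi fun a => (d.par a).contDiff_σ.continuous.comp (contDiff_pos a).continuous
    exact hc.continuousAt.eventually (Metric.ball_mem_nhds _ hη)
  obtain ⟨_, ⟨⟨hz1, hz2⟩, hz3⟩, ⟨z, hzC, rfl⟩⟩ :=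
    mem_closure_iff_nhds.1 hp _ ((d.order.and d.eventually_good).and e3)
  have hzD : (fun a => (d.par a).σ (z (Sum.inl a))) ∈ D := by
    refine ⟨hz3, fun a => (hz2 z hzC rfl a).2, fun a b hf hk => ?_⟩
    have := hz1 z hzC rfl a b hf hk
    change (d.par a).σ _ < (d.par b).σ _
    rwa [← d.σ_congr hf]
  have hgood := hz2 z hzC rfl
  obtain ⟨-, iz, hiz, hziz⟩ := hzC
  have hIz : I (fun a => (d.par a).σ (z (Sum.inl a))) = iz := by
    funext a
    apply hL.injective
    rw [hI _ hzD, ← hziz]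
    exact (hgood a).1
  refine Metric.eventually_nhds_iff.2 ⟨η, hη, fun s hs h0 hord => ?_⟩
  have hsD : s ∈ D := ⟨hs, h0, hord⟩
  refine ⟨I s, ?_, hI s hsD⟩
  obtain ⟨i₀, -, hcls⟩ := Γ.isotopy
  rw [hcls] at hiz ⊢
  have hj : JoinedIn D (fun a => (d.par a).σ (z (Sum.inl a))) s :=
    (hDconv.isPathConnected ⟨s, hsD⟩).joinedIn _ hzD _ hsD
  have h1 : JoinedIn (interiorInjections U M) iz (I s) := by
    rw [← hIz]
    exact (hj.map_continuousOn hIc).mono hIm.image_subset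
  exact JoinedIn.trans hiz h1

/-- The shape of a cluster at `p` is compatible with the order of the univalent vertices along the
curve. -/
theorem cross_pos (hp : p ∈ Γ.compactification L) {A : Finset (U ⊕ T)} (hA : A ∈ d.𝒯.cl) {a b : U}
    (ha : Sum.inl a ∈ A) (hb : Sum.inl b ∈ A) (hf : d.foot a = d.foot b)
    (hk : d.𝒯.key (Sum.inl a) < d.𝒯.key (Sum.inl b))
    (hne : shape p A (Sum.inl b) ≠ shape p A (Sum.inl a)) : 0 < d.cross A a b p := by
  have h0 : 0 ≤ d.cross A a b p := by
    refine le_of_mem_closure hp (f := fun _ => 0) (g := d.cross A a b) continuousAt_const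
      (d.continuous_cross A a b).continuousAt ?_
    filter_upwards [d.order, d.eventually_shape_sub (d.conn A hA) ha hb hf] with e h1 h2
    rintro ⟨x, hx, hxe⟩
    have h3 := h1 x hx hxe a b hf hk
    rw [Footing.cross, h2 x hx hxe, real_inner_smul_left]
    exact mul_nonneg (mul_nonneg (inv_nonneg.2 (size_nonneg _)) (sub_nonneg.2 h3.le))
      real_inner_self_nonneg
  refine lt_of_le_of_ne h0 (Ne.symm ?_)
  rw [← abs_ne_zero, d.abs_cross hp (d.conn A hA) ha hb hf]
  exact mul_ne_zero (norm_ne_zero_iff.2 (sub_ne_zero.2 hne))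
    (norm_ne_zero_iff.2 (d.slope_pos_ne hf))

end ClusterData

/-- The index set of the coordinates of configurations: one parameter for each univalent vertex,
three coordinates for each trivalent vertex. -/
abbrev Idx (U : Type v) (T : Type w) : Type (max v w) := U ⊕ T × Fin 3

/-- The vertex to which a coordinate belongs. -/
def vt : Idx U T → U ⊕ T := Sum.map id Prod.fst

/-- A coordinate of a vertex (the only one, for a univalent vertex). -/
def idx : U ⊕ T → Idx U T := Sum.elim Sum.inl fun t => Sum.inr (t, 0)

@[simp] theorem vt_inl (a : U) : vt (Sum.inl a : Idx U T) = Sum.inl a := rfl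

@[simp] theorem vt_inr (t : T) (l : Fin 3) : vt (Sum.inr (t, l) : Idx U T) = Sum.inr t := rfl

/-- The position of a univalent vertex in a point of the ambient space. -/
def vpos (e : Γ.Ambient) : U ⊕ T → E3 := Sum.elim e.2.1 0

namespace Footing

variable (d : Footing Γ L p)

/-- The parametrisation of the curve at a univalent vertex. -/
def ℓV : U ⊕ T → ℝ → E3 := Sum.elim (fun a => (d.par a).ℓ) 0

/-- The parameter function at a univalent vertex. -/
def σV : U ⊕ T → E3 → ℝ := Sum.elim (fun a => (d.par a).σ) 0

theorem contDiff_ℓV (v : U ⊕ T) : ContDiff ℝ ∞ (d.ℓV v) := by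
  rcases v with a | t
  · exact (d.par a).contDiff_ℓ
  · exact contDiff_const

theorem contDiff_σV (v : U ⊕ T) : ContDiff ℝ ∞ (d.σV v) := by
  rcases v with a | t
  · exact (d.par a).contDiff_σ
  · exact contDiff_const

end Footing

/-- The choices of which the coordinates near `p` are made, given the clusters:
the set `Z` of the univalent vertices whose curve parameter is a coordinate; the cluster `W` of the
univalent vertices, whose scale in space is `R`; for each cluster `A` a coordinate `ν A`, of sign
`ε A`, by which the scale of `A` is measured; and the functions `gauge` and `scl` that relate the
last coordinate to the overall scale.

There are three cases. If the positions of the univalent vertices are not all equal, then `Z` has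
several elements, `W` has a scale of order one, and `R = 1`. If they are all equal but there are
several univalent vertices, then `Z` has a single element and `R` is the coordinate `ν univ`. If
there is a single univalent vertex, then `W` is the set of all vertices, and `R` is the coordinate
`ν univ` or, if the configurations become infinitely large at `p`, its inverse. -/
structure ScaleData [DecidableEq (U ⊕ T)] (d : ClusterData Γ L p) where
  Z : Set (U ⊕ T)
  W : Finset (U ⊕ T)
  ν : Finset (U ⊕ T) → Idx U T
  ε : Finset (U ⊕ T) → ℝ
  R : (Idx U T → ℝ) → ℝ
  gauge : Γ.Ambient → ℝ
  scl : (Idx U T → ℝ) → ℝ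

namespace ScaleData

variable [DecidableEq (U ⊕ T)] [Nonempty U] {d : ClusterData Γ L p} (S : ScaleData d)

/-- The coordinates by which the scale of a cluster is measured. In the shape of the cluster this
coordinate is normalised to `± 1`; the value `t j` serves for the ratio of the scale of the cluster
to that of the next larger one. -/
def IsNormal (j : Idx U T) : Prop := S.ν (d.𝒯.P (vt j)) = j ∧ vt j ∉ S.Z

open Classical in
/-- The coordinates of `v - pred v`, in the scale of the cluster `P v`. -/
def wt (j : Idx U T) (t : Idx U T → ℝ) : ℝ := if S.IsNormal j then S.ε (d.𝒯.P (vt j)) else t j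

open Classical in
/-- The ratio of the scale of `C` to that of the next larger cluster. If the scale of `C` is measured
by a coordinate in `Z`, then `C = W`, and the ratio is the coordinate `ν univ`, as the scale of `W`
is of order one and that of the largest cluster is arbitrarily large. -/
def us (t : Idx U T → ℝ) (C : Finset (U ⊕ T)) : ℝ :=
  t (if vt (S.ν C) ∈ S.Z then S.ν Finset.univ else S.ν C)

/-- The ratio of the scales of two clusters. -/
def ρ (t : Idx U T → ℝ) (B A : Finset (U ⊕ T)) : ℝ := d.𝒯.ratio (S.us t) B A

/-- The curve parameter of a univalent vertex. -/
def prm : U ⊕ T → (Idx U T → ℝ) → ℝ :=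
  d.𝒯.walk (· ∈ S.Z) (fun v t => t (idx v))
    fun v b t => b t + S.R t * S.ρ t (d.𝒯.P v) S.W * S.wt (idx v) t

open Classical in
/-- The vector from `pred v` to `v`, in the scale of the cluster `P v`. -/
def incr (v : U ⊕ T) (t : Idx U T → ℝ) : E3 :=
  match v with
  | Sum.inl a => if Sum.inl a ∈ S.Z then
      d.ℓV (Sum.inl a) (S.prm (Sum.inl a) t) -
        d.ℓV (d.𝒯.pred (Sum.inl a)) (S.prm (d.𝒯.pred (Sum.inl a)) t)
    else S.wt (Sum.inl a) t • (d.par a).slope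
      (S.prm (d.𝒯.pred (Sum.inl a)) t, S.prm (Sum.inl a) t)
  | Sum.inr τ => WithLp.toLp 2 fun l => S.wt (Sum.inr (τ, l)) t

/-- The position of the vertex `v` of the cluster `A` relative to the base of `A`, in the scale of
`A`: the sum of the increments along the predecessors. It is smooth also where ratios of scales
vanish. -/
def pos (A : Finset (U ⊕ T)) : U ⊕ T → (Idx U T → ℝ) → E3 :=
  d.𝒯.walk (· = d.𝒯.base A) 0 fun v b t => b t + S.ρ t (d.𝒯.P v) A • S.incr v t

/-- The configuration with given coordinates. -/
def config (t : Idx U T → ℝ) : U ⊕ T → E3 :=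
  d.𝒯.walk (fun v => v.isLeft) (fun v => d.ℓV v (S.prm v t))
    fun v b => b + (S.R t * S.ρ t (d.𝒯.P v) Finset.univ / S.ρ t S.W Finset.univ) • S.incr v t

open Classical in
/-- The covector that extracts the coordinate `j` from `v - pred v`. At a univalent vertex outside
`Z` it extracts the multiple of the slope of the curve. -/
def covector (j : Idx U T) (e : Γ.Ambient) : E3 :=
  match j with
  | Sum.inl a => if Sum.inl a ∈ S.Z then
      (‖vpos e (Sum.inl a) - vpos e (d.𝒯.pred (Sum.inl a))‖ ^ 2)⁻¹ •
        (vpos e (Sum.inl a) - vpos e (d.𝒯.pred (Sum.inl a)))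
    else (‖(d.par a).slope (d.σV (d.𝒯.pred (Sum.inl a)) (vpos e (d.𝒯.pred (Sum.inl a))),
        (d.par a).σ (e.2.1 a))‖ ^ 2)⁻¹ •
      (d.par a).slope (d.σV (d.𝒯.pred (Sum.inl a)) (vpos e (d.𝒯.pred (Sum.inl a))),
        (d.par a).σ (e.2.1 a))
  | Sum.inr (_, l) => EuclideanSpace.single l 1

/-- The coordinate `j`, as measured in the shape of `A`. -/
def form (j : Idx U T) (A : Finset (U ⊕ T)) (e : Γ.Ambient) : ℝ :=
  inner ℝ (shape e A (vt j) - shape e A (d.𝒯.pred (vt j))) (S.covector j e)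

/-- The scale of the cluster `C`, as measured in the shape of `A`. -/
def width (C A : Finset (U ⊕ T)) (e : Γ.Ambient) : ℝ := S.ε C * S.form (S.ν C) A e

/-- The coordinate `j` of a configuration. -/
def realForm (j : Idx U T) (x : U ⊕ T → E3) : ℝ :=
  inner ℝ (x (vt j) - x (d.𝒯.pred (vt j))) (S.covector j (Γ.canon x))

/-- The scale of the cluster `C` in a configuration. -/
def realWidth (C : Finset (U ⊕ T)) (x : U ⊕ T → E3) : ℝ := S.ε C * S.realForm (S.ν C) x

open Classical in
/-- The coordinates, as functions on the ambient space: a parameter of the curve, a ratio of the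
scales of successive clusters (both measured in the shape of the larger one), or a coordinate in the
shape of a cluster relative to its scale. -/
def coord (e : Γ.Ambient) (j : Idx U T) : ℝ :=
  if vt j ∈ S.Z then d.σV (vt j) (vpos e (vt j))
  else if S.IsNormal j then
    if d.𝒯.P (vt j) = Finset.univ then
      if vt (S.ν S.W) ∈ S.Z then
        S.width S.W (d.𝒯.par S.W) e / S.width (d.𝒯.par S.W) (d.𝒯.par S.W) e
      else S.gauge e
    else S.width (d.𝒯.P (vt j)) (d.𝒯.par (d.𝒯.P (vt j))) e /
      S.width (d.𝒯.par (d.𝒯.P (vt j))) (d.𝒯.par (d.𝒯.P (vt j))) e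
  else S.form j (d.𝒯.P (vt j)) e / S.width (d.𝒯.P (vt j)) (d.𝒯.P (vt j)) e

/-- The point of the ambient space with given coordinates: this extends `canon ∘ config` to the
boundary. -/
def chart (t : Idx U T → ℝ) : Γ.Ambient :=
  (fun B => nrm fun a : B.1 => S.pos (d.sep B.1 B.2).choose a t,
    fun a => d.ℓV (Sum.inl a) (S.prm (Sum.inl a) t), ⟨S.scl t⟩)

/-- The coordinates which are nonnegative, and positive on the interior. -/
def IsConstrained (j : Idx U T) : Prop := S.IsNormal j ∨ vt j ∈ S.Z

/-- The interior of the domain of coordinates. -/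
def Pos (t : Idx U T → ℝ) : Prop := ∀ j, S.IsConstrained j → 0 < t j

/-- The conditions on the choices in `ScaleData`: the membership of `Z` and the cluster `W` fit with
the recursion for the curve parameters; the scale of each cluster `A` is measured by a coordinate of
a vertex whose smallest nontrivial cluster is `A`, and is positive at `p`; the function `gauge` is
the coordinate `ν univ` of the points near `p`, and `scl` the overall scale of the configuration
with given coordinates. -/
structure IsScale : Prop where
  root_mem : d.𝒯.root ∈ S.Z
  exists_inl : ∀ v ∈ S.Z, ∃ a, v = Sum.inl a
  W_mem : S.W ∈ d.𝒯.cl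
  P_of_mem : ∀ v ∈ S.Z, v ≠ d.𝒯.root → d.𝒯.P v = S.W ∧ ∀ t, S.R t = 1
  P_subset : ∀ a, Sum.inl a ∉ S.Z → d.𝒯.P (Sum.inl a) ⊆ S.W
  foot_pred : ∀ a b, Sum.inl a ∉ S.Z → d.𝒯.pred (Sum.inl a) = Sum.inl b → d.foot b = d.foot a
  P_ν : ∀ A ∈ d.𝒯.cl, d.𝒯.P (vt (S.ν A)) = A
  ν_ne : ∀ A ∈ d.𝒯.cl, vt (S.ν A) ≠ d.𝒯.root
  ε_sq : ∀ A ∈ d.𝒯.cl, S.ε A * S.ε A = 1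
  eq_W : ∀ A ∈ d.𝒯.cl, vt (S.ν A) ∈ S.Z → A = S.W ∧ S.ε A = 1
  width_pos : ∀ A ∈ d.𝒯.cl, 0 < S.width A A p
  contDiff_R : ContDiff ℝ ∞ S.R ∨ ∀ a, Sum.inl a ∈ S.Z
  contDiffAt_R : ∀ t, S.Pos t → ContDiffAt ℝ ∞ S.R t ∧ 0 < S.R t
  contDiffAt_gauge : vt (S.ν S.W) ∉ S.Z → ∀ᶠ e in 𝓝 p, ContDiffAt ℝ ∞ S.gauge e
  gauge_spec : vt (S.ν S.W) ∉ S.Z → ∀ᶠ e in 𝓝 p, ∀ x ∈ Γ.configSpace L, Γ.canon x = e →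
    0 < S.gauge e ∧ ∀ t : Idx U T → ℝ, t (S.ν Finset.univ) = S.gauge e → S.R t = S.realWidth S.W x
  gauge_eq : vt (S.ν S.W) ∉ S.Z → ∀ t, S.Pos t → S.config t ∈ Γ.configSpace L →
    (∀ a, (d.par a).σ (S.config t (Sum.inl a)) = S.prm (Sum.inl a) t) →
    (∀ A ∈ d.𝒯.cl, S.realWidth A (S.config t) =
      S.R t * S.ρ t A Finset.univ / S.ρ t S.W Finset.univ) →
    S.gauge (Γ.canon (S.config t)) = t (S.ν Finset.univ)
  scl_eq : ∀ t, S.Pos t → S.config t ∈ Γ.configSpace L →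
    (∀ v, S.config t v - S.config t d.𝒯.root =
      (S.R t / S.ρ t S.W Finset.univ) • S.pos Finset.univ v t) → scale U (S.config t) = S.scl t
  contDiffAt_scl : (∃ v w, S.pos Finset.univ v (S.coord p) ≠ S.pos Finset.univ w (S.coord p)) →
    ∀ᶠ t in 𝓝 (S.coord p), ContDiffAt ℝ ∞ S.scl t

variable {S}

theorem exists_pred_inl (a : U) : ∃ b, d.𝒯.pred (Sum.inl a) = Sum.inl b := by
  rcases h : d.𝒯.pred (Sum.inl a) with b | t
  · exact ⟨b, rfl⟩
  · have h1 : d.𝒯.key (d.𝒯.pred (Sum.inl a)) ≤ d.𝒯.key (Sum.inl a) :=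
      d.𝒯.key_base_le (Nest.mem_P _)
    rw [h] at h1
    exact absurd (d.key_lt a t) h1.not_gt

/-! Smoothness. -/

theorem contDiff_wt (j : Idx U T) : ContDiff ℝ ∞ (S.wt j) := by
  unfold wt
  split_ifs
  · exact contDiff_const
  · exact contDiff_apply ℝ ℝ j

theorem contDiff_ρ (A B : Finset (U ⊕ T)) : ContDiff ℝ ∞ fun t => S.ρ t B A := by
  unfold ρ Nest.ratio us
  exact contDiff_prod fun C _ => contDiff_apply ℝ ℝ _

theorem contDiff_prm (hR : ContDiff ℝ ∞ S.R ∨ ∀ a, Sum.inl a ∈ S.Z) (a : U) :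
    ContDiff ℝ ∞ (S.prm (Sum.inl a)) := by
  refine Nest.walk_induction (p := fun v (f : (Idx U T → ℝ) → ℝ) =>
    (∃ a, v = Sum.inl a) → ContDiff ℝ ∞ f) (fun v _ _ => contDiff_apply ℝ ℝ _) ?_ _ ⟨a, rfl⟩
  rintro _ hv - b hb ⟨a, rfl⟩
  obtain ⟨a', ha'⟩ := exists_pred_inl (d := d) a
  rcases hR with hR | hR
  · exact (hb ⟨a', ha'⟩).add ((hR.mul (contDiff_ρ _ _)).mul (contDiff_wt _))
  · exact absurd (hR a) hv

theorem contDiff_incr (hR : ContDiff ℝ ∞ S.R ∨ ∀ a, Sum.inl a ∈ S.Z) (v : U ⊕ T) :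
    ContDiff ℝ ∞ (S.incr v) := by
  rcases v with a | τ
  · obtain ⟨b, hb⟩ := exists_pred_inl (d := d) a
    unfold incr
    simp only [hb]
    split_ifs
    · exact ((d.contDiff_ℓV _).comp (contDiff_prm hR a)).sub
        ((d.contDiff_ℓV _).comp (contDiff_prm hR b))
    · exact (contDiff_wt _).smul ((d.par a).contDiff_slope.comp
        ((contDiff_prm hR b).prodMk (contDiff_prm hR a)))
  · exact contDiff_euclidean.2 fun l => contDiff_wt _

theorem contDiff_pos (hR : ContDiff ℝ ∞ S.R ∨ ∀ a, Sum.inl a ∈ S.Z) (A : Finset (U ⊕ T))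
    (v : U ⊕ T) :
    ContDiff ℝ ∞ (S.pos A v) := by
  refine Nest.walk_induction (p := fun _ (f : (Idx U T → ℝ) → E3) => ContDiff ℝ ∞ f)
    (fun v _ => contDiff_const) (fun v _ _ b hb => ?_) _
  exact hb.add ((contDiff_ρ _ _).smul (contDiff_incr hR v))

theorem Pos.us_pos {t : Idx U T → ℝ} (hS : S.IsScale) (ht : S.Pos t) :
    ∀ C ∈ d.𝒯.cl, C ≠ Finset.univ → 0 < S.us t C := by
  intro C hC hne
  unfold us
  split_ifs with h
  · refine ht _ (Or.inl ⟨by rw [hS.P_ν _ d.𝒯.univ_mem], fun h' => hne ?_⟩)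
    rw [(hS.eq_W C hC h).1, (hS.eq_W _ d.𝒯.univ_mem h').1]
  · exact ht _ (Or.inl ⟨by rw [hS.P_ν _ hC], h⟩)

theorem Pos.ρ_pos {t : Idx U T → ℝ} (hS : S.IsScale) (ht : S.Pos t) (A B : Finset (U ⊕ T)) :
    0 < S.ρ t B A := Nest.ratio_pos (ht.us_pos hS)

theorem IsScale.contDiffAt_config (hS : S.IsScale) {t : Idx U T → ℝ} (ht : S.Pos t) :
    ContDiffAt ℝ ∞ S.config t := by
  refine contDiffAt_pi.2 fun v => ?_
  induction hn : d.𝒯.key v using Nat.strong_induction_on generalizing v with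
  | _ n ih =>
    by_cases hv : v.isLeft
    · obtain ⟨a, rfl⟩ := Sum.isLeft_iff.1 hv
      have : (fun t => S.config t (Sum.inl a)) =
          fun t => d.ℓV (Sum.inl a) (S.prm (Sum.inl a) t) := by
        funext t
        exact Nest.walk_halt (Or.inl rfl)
      rw [this]
      exact ((d.contDiff_ℓV _).comp (contDiff_prm hS.contDiff_R a)).contDiffAt
    · have hr : v ≠ d.𝒯.root := by
        rintro rfl
        obtain ⟨a, ha⟩ := hS.exists_inl _ hS.root_mem
        rw [ha] at hv
        exact hv rfl
      have : (fun t => S.config t v) = fun t => S.config t (d.𝒯.pred v) +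
          (S.R t * S.ρ t (d.𝒯.P v) Finset.univ / S.ρ t S.W Finset.univ) • S.incr v t := by
        funext t
        exact Nest.walk_step hv hr
      rw [this]
      have h1 : ContDiffAt ℝ ∞ (fun t => S.R t * S.ρ t (d.𝒯.P v) Finset.univ /
          S.ρ t S.W Finset.univ) t :=
        ((hS.contDiffAt_R t ht).1.mul (contDiff_ρ _ _).contDiffAt).div
          (contDiff_ρ _ _).contDiffAt (ht.ρ_pos hS _ _).ne'
      exact (ih _ (hn ▸ Nest.key_pred_lt hr) _ rfl).add
        (h1.smul (contDiff_incr hS.contDiff_R v).contDiffAt)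

end ScaleData

end Diagram

/-! ### Configurations and coordinates determine each other -/

namespace Diagram

variable {U : Type v} {T : Type w} {M : Type u}
  [TopologicalSpace M] [ChartedSpace (EuclideanHalfSpace 1) M] [Fintype U] [Fintype T]
  {Γ : Diagram U T M} {L : M → E3} {p : Γ.Ambient}

namespace ScaleData

variable [DecidableEq (U ⊕ T)] [Nonempty U] {d : ClusterData Γ L p} {S : ScaleData d}

theorem prm_of_mem {v : U ⊕ T} (h : v ∈ S.Z) (t : Idx U T → ℝ) : S.prm v t = t (idx v) :=
  congrFun (Nest.walk_halt (𝒯 := d.𝒯) (halt := (· ∈ S.Z)) (Or.inl h)) t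

theorem prm_step {v : U ⊕ T} (h : v ∉ S.Z) (hv : v ≠ d.𝒯.root) (t : Idx U T → ℝ) : S.prm v t =
    S.prm (d.𝒯.pred v) t + S.R t * S.ρ t (d.𝒯.P v) S.W * S.wt (idx v) t :=
  congrFun (Nest.walk_step (𝒯 := d.𝒯) (halt := (· ∈ S.Z)) h hv) t

theorem pos_base (A : Finset (U ⊕ T)) (t : Idx U T → ℝ) : S.pos A (d.𝒯.base A) t = 0 :=
  congrFun (Nest.walk_halt (𝒯 := d.𝒯) (halt := (· = d.𝒯.base A)) (Or.inl rfl)) t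

theorem pos_step {A : Finset (U ⊕ T)} {v : U ⊕ T} (h : v ≠ d.𝒯.base A) (hv : v ≠ d.𝒯.root)
    (t : Idx U T → ℝ) : S.pos A v t =
      S.pos A (d.𝒯.pred v) t + S.ρ t (d.𝒯.P v) A • S.incr v t :=
  congrFun (Nest.walk_step (𝒯 := d.𝒯) (halt := (· = d.𝒯.base A)) h hv) t

theorem config_inl (a : U) (t : Idx U T → ℝ) :
    S.config t (Sum.inl a) = (d.par a).ℓ (S.prm (Sum.inl a) t) :=
  Nest.walk_halt (𝒯 := d.𝒯) (halt := fun v => v.isLeft) (Or.inl rfl)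

theorem config_step {v : U ⊕ T} (h : ¬ v.isLeft) (hv : v ≠ d.𝒯.root) (t : Idx U T → ℝ) :
    S.config t v = S.config t (d.𝒯.pred v) +
      (S.R t * S.ρ t (d.𝒯.P v) Finset.univ / S.ρ t S.W Finset.univ) • S.incr v t :=
  Nest.walk_step (𝒯 := d.𝒯) (halt := fun v => v.isLeft) h hv

theorem ne_of_inl_ne (hL : Function.Injective L) {x : U ⊕ T → E3} (hx : x ∈ Γ.configSpace L)
    {a b : U} (h : a ≠ b) : x (Sum.inl a) ≠ x (Sum.inl b) :=
  configSpace_ne hL hx (fullGraph_adj.2 (Or.inr ⟨by simpa using h, rfl, rfl⟩))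

theorem inl_ne_root (hS : S.IsScale) {a : U} (h : Sum.inl a ∉ S.Z) :
    (Sum.inl a : U ⊕ T) ≠ d.𝒯.root := fun h' => h (h' ▸ hS.root_mem)

theorem ne_root (hS : S.IsScale) {v : U ⊕ T} (h : v ∉ S.Z) : v ≠ d.𝒯.root :=
  fun h' => h (h' ▸ hS.root_mem)

theorem inr_notMem (hS : S.IsScale) (t : T) : Sum.inr t ∉ S.Z := fun h => by
  obtain ⟨a, ha⟩ := hS.exists_inl _ h
  exact absurd ha (by simp)

theorem pred_inl_ne {a b : U} (h : (Sum.inl a : U ⊕ T) ≠ d.𝒯.root)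
    (hb : d.𝒯.pred (Sum.inl a) = Sum.inl b) : a ≠ b := by
  rintro rfl
  exact Nest.pred_ne h hb

theorem inner_div_sq (c : ℝ) {g : E3} (hg : g ≠ 0) :
    inner ℝ (c • g) ((‖g‖ ^ 2)⁻¹ • g) = c := by
  rw [real_inner_smul_left, real_inner_smul_right, real_inner_self_eq_norm_sq,
    inv_mul_cancel₀ (pow_ne_zero 2 (norm_ne_zero_iff.2 hg)), mul_one]

theorem realForm_inr (τ : T) (l : Fin 3) (x : U ⊕ T → E3) :
    S.realForm (Sum.inr (τ, l)) x = (x (Sum.inr τ) - x (d.𝒯.pred (Sum.inr τ))) l := by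
  simp [realForm, covector, EuclideanSpace.inner_single_right]

theorem realForm_of_mem (hL : Function.Injective L) {x : U ⊕ T → E3}
    (hx : x ∈ Γ.configSpace L) {a : U} (ha : Sum.inl a ∈ S.Z)
    (hr : (Sum.inl a : U ⊕ T) ≠ d.𝒯.root) : S.realForm (Sum.inl a) x = 1 := by
  obtain ⟨b, hb⟩ := exists_pred_inl (d := d) a
  have hne := ne_of_inl_ne hL hx (pred_inl_ne hr hb)
  have := inner_div_sq 1 (sub_ne_zero.2 hne)
  rw [one_smul] at this
  simp only [realForm, covector, if_pos ha, vt_inl, hb]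
  exact this

/-- The relation between positions and parameters of two univalent vertices with a common local
parameter. -/
theorem sub_pred_eq (d : ClusterData Γ L p) {x : U ⊕ T → E3}
    (hg : ∀ a, (d.par a).ℓ ((d.par a).σ (x (Sum.inl a))) = x (Sum.inl a)) {a b : U}
    (hf : d.foot b = d.foot a) :
    x (Sum.inl a) - x (Sum.inl b) =
      ((d.par a).σ (x (Sum.inl a)) - (d.par b).σ (x (Sum.inl b))) •
        (d.par a).slope ((d.par b).σ (x (Sum.inl b)), (d.par a).σ (x (Sum.inl a))) := by
  rw [← (d.par a).slope_eq, hg a, ← d.ℓ_congr hf, hg b]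

theorem realForm_of_notMem (hL : Function.Injective L) {x : U ⊕ T → E3}
    (hx : x ∈ Γ.configSpace L)
    (hg : ∀ a, (d.par a).ℓ ((d.par a).σ (x (Sum.inl a))) = x (Sum.inl a)) {a b : U}
    (ha : Sum.inl a ∉ S.Z) (hr : (Sum.inl a : U ⊕ T) ≠ d.𝒯.root)
    (hb : d.𝒯.pred (Sum.inl a) = Sum.inl b) (hf : d.foot b = d.foot a) :
    S.realForm (Sum.inl a) x = (d.par a).σ (x (Sum.inl a)) - (d.par b).σ (x (Sum.inl b)) := by
  have h1 := sub_pred_eq d hg hf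
  have hne := ne_of_inl_ne hL hx (pred_inl_ne hr hb)
  have hg0 : (d.par a).slope ((d.par b).σ (x (Sum.inl b)), (d.par a).σ (x (Sum.inl a))) ≠ 0 := by
    intro h0
    rw [h0, smul_zero, sub_eq_zero] at h1
    exact hne h1
  have h2 := inner_div_sq ((d.par a).σ (x (Sum.inl a)) - (d.par b).σ (x (Sum.inl b))) hg0
  rw [← h1] at h2
  simp only [realForm, covector, if_neg ha, vt_inl, hb]
  exact h2

theorem form_canon (x : U ⊕ T → E3) {A : Finset (U ⊕ T)} (hA : A ∈ d.𝒯.cl) {j : Idx U T}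
    (hj : d.𝒯.P (vt j) ⊆ A) :
    S.form j A (Γ.canon x) = (size fun a : A => x a)⁻¹ * S.realForm j x := by
  rw [form, realForm, shape_canon_sub x (d.conn A hA) (hj (Nest.mem_P _)) (hj (Nest.pred_mem_P _)),
    real_inner_smul_left]

theorem width_canon (hS : S.IsScale) (x : U ⊕ T → E3) {A C : Finset (U ⊕ T)} (hA : A ∈ d.𝒯.cl)
    (hC : C ∈ d.𝒯.cl) (h : C ⊆ A) :
    S.width C A (Γ.canon x) = (size fun a : A => x a)⁻¹ * S.realWidth C x := by
  rw [width, realWidth, form_canon x hA (by rwa [hS.P_ν C hC])]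
  ring

theorem width_div_canon (hS : S.IsScale) (hL : Function.Injective L) {x : U ⊕ T → E3}
    (hx : x ∈ Γ.configSpace L) {A C : Finset (U ⊕ T)} (hA : A ∈ d.𝒯.cl) (hC : C ∈ d.𝒯.cl)
    (h : C ⊆ A) : S.width C A (Γ.canon x) / S.width A A (Γ.canon x) =
      S.realWidth C x / S.realWidth A x := by
  rw [width_canon hS x hA hC h, width_canon hS x hA hA subset_rfl,
    mul_div_mul_left _ _ (inv_ne_zero (size_pos (IsConnSet.exists_ne hL hx (d.conn A hA))).ne')]

theorem coord_of_mem (e : Γ.Ambient) {a : U} (ha : Sum.inl a ∈ S.Z) :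
    S.coord e (Sum.inl a) = (d.par a).σ (e.2.1 a) := if_pos ha

theorem coord_of_notMem (hL : Function.Injective L) {x : U ⊕ T → E3}
    (hx : x ∈ Γ.configSpace L) (hS : S.IsScale) {j : Idx U T} (hj : vt j ∉ S.Z)
    (hn : ¬ S.IsNormal j) :
    S.coord (Γ.canon x) j = S.realForm j x / S.realWidth (d.𝒯.P (vt j)) x := by
  rw [coord, if_neg hj, if_neg hn, form_canon x (Nest.P_mem _) subset_rfl,
    width_canon hS x (Nest.P_mem _) (Nest.P_mem _) subset_rfl,
    mul_div_mul_left _ _ (inv_ne_zero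
      (size_pos (IsConnSet.exists_ne hL hx (d.conn _ (Nest.P_mem _)))).ne')]

theorem coord_normal (hL : Function.Injective L) {x : U ⊕ T → E3}
    (hx : x ∈ Γ.configSpace L) (hS : S.IsScale) {C : Finset (U ⊕ T)} (hC : C ∈ d.𝒯.cl)
    (hne : C ≠ Finset.univ) (hZ : vt (S.ν C) ∉ S.Z) :
    S.coord (Γ.canon x) (S.ν C) = S.realWidth C x / S.realWidth (d.𝒯.par C) x := by
  have hn : S.IsNormal (S.ν C) := ⟨by rw [hS.P_ν C hC], hZ⟩
  rw [coord, if_neg hZ, if_pos hn, hS.P_ν C hC, if_neg hne,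
    width_div_canon hS hL hx (Nest.par_mem C) hC (Nest.ssubset_par hne).subset]

theorem coord_univ (hL : Function.Injective L) {x : U ⊕ T → E3}
    (hx : x ∈ Γ.configSpace L) (hS : S.IsScale) (hne : S.W ≠ Finset.univ)
    (hZ : vt (S.ν S.W) ∈ S.Z) : vt (S.ν Finset.univ) ∉ S.Z ∧
    S.coord (Γ.canon x) (S.ν Finset.univ) = S.realWidth S.W x / S.realWidth (d.𝒯.par S.W) x := by
  have hu : vt (S.ν Finset.univ) ∉ S.Z := fun h => hne (hS.eq_W _ d.𝒯.univ_mem h).1.symm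
  have hn : S.IsNormal (S.ν Finset.univ) := ⟨by rw [hS.P_ν _ d.𝒯.univ_mem], hu⟩
  refine ⟨hu, ?_⟩
  rw [coord, if_neg hu, if_pos hn, hS.P_ν _ d.𝒯.univ_mem, if_pos rfl, if_pos hZ,
    width_div_canon hS hL hx (Nest.par_mem _) hS.W_mem (Nest.ssubset_par hne).subset]

theorem coord_gauge (hS : S.IsScale) (e : Γ.Ambient) (hZ : vt (S.ν S.W) ∉ S.Z) :
    vt (S.ν Finset.univ) ∉ S.Z ∧ S.coord e (S.ν Finset.univ) = S.gauge e := by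
  have hu : vt (S.ν Finset.univ) ∉ S.Z := fun h => hZ (by
    rw [← (hS.eq_W _ d.𝒯.univ_mem h).1]
    exact h)
  have hn : S.IsNormal (S.ν Finset.univ) := ⟨by rw [hS.P_ν _ d.𝒯.univ_mem], hu⟩
  refine ⟨hu, ?_⟩
  rw [coord, if_neg hu, if_pos hn, hS.P_ν _ d.𝒯.univ_mem, if_pos rfl, if_neg hZ]

theorem realWidth_W (hS : S.IsScale) (hL : Function.Injective L) {x : U ⊕ T → E3}
    (hx : x ∈ Γ.configSpace L) (hZ : vt (S.ν S.W) ∈ S.Z) :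
    S.realWidth S.W x = 1 ∧ ∀ t, S.R t = 1 := by
  have hr := hS.ν_ne _ hS.W_mem
  refine ⟨?_, (hS.P_of_mem _ hZ hr).2⟩
  obtain ⟨a, ha⟩ := hS.exists_inl _ hZ
  have hνa : S.ν S.W = Sum.inl a := by
    rcases h : S.ν S.W with b | ⟨τ, l⟩
    · rw [h, vt_inl] at ha
      rw [Sum.inl_injective ha]
    · rw [h, vt_inr] at ha
      exact absurd ha (by simp)
  rw [hνa, vt_inl] at hZ hr
  rw [realWidth, (hS.eq_W _ hS.W_mem (by rwa [hνa, vt_inl])).2, hνa, realForm_of_mem hL hx hZ hr,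
    one_mul]

/-! Every configuration close to `p` is recovered from its coordinates. -/

section Recover

variable (hS : S.IsScale) (hL : Function.Injective L) {x : U ⊕ T → E3}
  (hx : x ∈ Γ.configSpace L)
  (hg : ∀ a, (d.par a).ℓ ((d.par a).σ (x (Sum.inl a))) = x (Sum.inl a))
  (hw : ∀ A ∈ d.𝒯.cl, 0 < S.realWidth A x)
  (hR : S.R (S.coord (Γ.canon x)) = S.realWidth S.W x)
include hS hL hx hg hw hR

theorem ρ_coord {A B : Finset (U ⊕ T)} (hA : A ∈ d.𝒯.cl) (hB : B ∈ d.𝒯.cl) (h : B ⊆ A) :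
    S.ρ (S.coord (Γ.canon x)) B A = S.realWidth B x / S.realWidth A x := by
  refine Nest.ratio_eq_div (r := fun A => S.realWidth A x) (fun A hA => (hw A hA).ne') ?_ hA hB h
  intro C hC hne
  unfold us
  split_ifs with hZ
  · obtain ⟨rfl, -⟩ := hS.eq_W C hC hZ
    exact (coord_univ hL hx hS hne hZ).2
  · exact coord_normal hL hx hS hC hne hZ

theorem wt_coord {j : Idx U T} (hj : vt j ∉ S.Z) :
    S.realWidth (d.𝒯.P (vt j)) x * S.wt j (S.coord (Γ.canon x)) = S.realForm j x := by
  have hP := Nest.P_mem (𝒯 := d.𝒯) (vt j)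
  unfold wt
  split_ifs with hn
  · rw [realWidth, hn.1]
    linear_combination S.realForm j x * hS.ε_sq _ hP
  · rw [coord_of_notMem hL hx hS hj hn, mul_div_cancel₀ _ (hw _ hP).ne']

theorem prm_coord (a : U) : S.prm (Sum.inl a) (S.coord (Γ.canon x)) =
    (d.par a).σ (x (Sum.inl a)) := by
  induction hn : d.𝒯.key (Sum.inl a) using Nat.strong_induction_on generalizing a with
  | _ n ih =>
    by_cases ha : Sum.inl a ∈ S.Z
    · rw [prm_of_mem ha]
      exact coord_of_mem _ ha
    · have hr := inl_ne_root hS ha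
      obtain ⟨b, hb⟩ := exists_pred_inl (d := d) a
      have hlt := Nest.key_pred_lt hr
      rw [hb, hn] at hlt
      have hib := ih _ hlt b rfl
      rw [prm_step ha hr, hb]
      have hP := Nest.P_mem (𝒯 := d.𝒯) (Sum.inl a)
      rw [hib, hR, ρ_coord hS hL hx hg hw hR hS.W_mem hP (hS.P_subset a ha),
        mul_div_cancel₀ _ (hw _ hS.W_mem).ne']
      have h1 := wt_coord hS hL hx hg hw hR (j := Sum.inl a) ha
      rw [realForm_of_notMem hL hx hg ha hr hb (hS.foot_pred a b ha hb)] at h1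
      change _ + S.realWidth (d.𝒯.P (vt (Sum.inl a))) x * S.wt (Sum.inl a) _ = _
      rw [h1]
      ring

theorem incr_coord {v : U ⊕ T} (hv : v ≠ d.𝒯.root) :
    S.realWidth (d.𝒯.P v) x • S.incr v (S.coord (Γ.canon x)) = x v - x (d.𝒯.pred v) := by
  have hprm := prm_coord hS hL hx hg hw hR
  rcases v with a | τ
  · obtain ⟨b, hb⟩ := exists_pred_inl (d := d) a
    unfold incr
    simp only [hb]
    split_ifs with ha
    · obtain ⟨hPW, hR1⟩ := hS.P_of_mem _ ha hv
      rw [hPW, ← hR, hR1, one_smul, hprm, hprm]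
      change (d.par a).ℓ _ - (d.par b).ℓ _ = _
      rw [hg, hg]
    · rw [hprm, hprm, smul_smul]
      have h1 := wt_coord hS hL hx hg hw hR (j := Sum.inl a) ha
      rw [vt_inl] at h1
      rw [h1, realForm_of_notMem hL hx hg ha hv hb (hS.foot_pred a b ha hb),
        sub_pred_eq d hg (hS.foot_pred a b ha hb)]
  · ext l
    have h1 := wt_coord hS hL hx hg hw hR (j := Sum.inr (τ, l)) (inr_notMem hS τ)
    rw [realForm_inr] at h1
    exact h1

theorem pos_coord {A : Finset (U ⊕ T)} (hA : A ∈ d.𝒯.cl) {v : U ⊕ T} (hv : v ∈ A) :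
    S.realWidth A x • S.pos A v (S.coord (Γ.canon x)) = x v - x (d.𝒯.base A) := by
  refine Nest.induction_on_mem hA (p := fun v => S.realWidth A x •
    S.pos A v (S.coord (Γ.canon x)) = x v - x (d.𝒯.base A)) ?_ ?_ hv
  · rw [pos_base, sub_self, smul_zero]
  · intro v hv hb hP ih
    have hr := Nest.ne_root_of_ne_base hv hb
    rw [pos_step hb hr]
    rw [smul_add, ih, ρ_coord hS hL hx hg hw hR hA (Nest.P_mem v) hP, smul_smul,
      mul_div_cancel₀ _ (hw A hA).ne', incr_coord hS hL hx hg hw hR hr]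
    abel

theorem config_coord : S.config (S.coord (Γ.canon x)) = x := by
  funext v
  refine Nest.induction_on_mem d.𝒯.univ_mem (p := fun v => S.config (S.coord (Γ.canon x)) v = x v)
    ?_ ?_ (Finset.mem_univ v)
  · change S.config _ d.𝒯.root = x d.𝒯.root
    obtain ⟨a, ha⟩ := hS.exists_inl _ hS.root_mem
    rw [ha, config_inl, prm_coord hS hL hx hg hw hR]
    exact hg a
  · intro v _ hb _ ih
    by_cases hv : v.isLeft
    · obtain ⟨a, rfl⟩ := Sum.isLeft_iff.1 hv
      rw [config_inl, prm_coord hS hL hx hg hw hR]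
      exact hg a
    · rw [config_step hv hb]
      have hu := d.𝒯.univ_mem
      have h1 : S.R (S.coord (Γ.canon x)) * S.ρ (S.coord (Γ.canon x)) (d.𝒯.P v) Finset.univ /
          S.ρ (S.coord (Γ.canon x)) S.W Finset.univ = S.realWidth (d.𝒯.P v) x := by
        rw [hR, ρ_coord hS hL hx hg hw hR hu (Nest.P_mem v) (Finset.subset_univ _),
          ρ_coord hS hL hx hg hw hR hu hS.W_mem (Finset.subset_univ _)]
        have h2 := (hw _ hu).ne'
        have h3 := (hw _ hS.W_mem).ne'
        field_simp
      rw [ih, h1, incr_coord hS hL hx hg hw hR hb]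
      abel

theorem pos_coord_eq {A : Finset (U ⊕ T)} (hA : A ∈ d.𝒯.cl) {v : U ⊕ T} (hv : v ∈ A) :
    S.pos A v (S.coord (Γ.canon x)) = (S.width A A (Γ.canon x))⁻¹ •
      (shape (Γ.canon x) A v - shape (Γ.canon x) A (d.𝒯.base A)) := by
  have h1 := pos_coord hS hL hx hg hw hR hA hv
  have h2 := (size_pos (IsConnSet.exists_ne hL hx (d.conn A hA))).ne'
  rw [shape_canon_sub x (d.conn A hA) hv (Nest.base_mem ⟨v, hv⟩), ← h1,
    width_canon hS x hA hA subset_rfl, smul_smul, smul_smul, mul_inv, inv_inv]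
  have h3 := (hw A hA).ne'
  rw [show size (fun a : A => x a) * (S.realWidth A x)⁻¹ *
    (size fun a : A => x a)⁻¹ * S.realWidth A x = 1 by field_simp, one_smul]

theorem Pos_coord (hσ : ∀ a, 0 < (d.par a).σ (x (Sum.inl a)))
    (hgauge : vt (S.ν S.W) ∉ S.Z → 0 < S.gauge (Γ.canon x)) : S.Pos (S.coord (Γ.canon x)) := by
  intro j hj
  by_cases hZ : vt j ∈ S.Z
  · obtain ⟨a, ha⟩ := hS.exists_inl _ hZ
    rcases j with b | ⟨τ, l⟩
    · have hZ' : Sum.inl b ∈ S.Z := hZ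
      rw [coord_of_mem _ hZ']
      exact hσ b
    · exact absurd hZ (inr_notMem hS τ)
  · have hn := hj.resolve_right hZ
    obtain ⟨C, hC, rfl⟩ : ∃ C ∈ d.𝒯.cl, S.ν C = j := ⟨_, Nest.P_mem _, hn.1⟩
    by_cases hne : C = Finset.univ
    · subst hne
      by_cases hW : vt (S.ν S.W) ∈ S.Z
      · have hne : S.W ≠ Finset.univ := fun h => hZ (h ▸ hW)
        rw [(coord_univ hL hx hS hne hW).2]
        exact div_pos (hw _ hS.W_mem) (hw _ (Nest.par_mem _))
      · rw [(coord_gauge hS _ hW).2]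
        exact hgauge hW
    · rw [coord_normal hL hx hS hC hne hZ]
      exact div_pos (hw _ hC) (hw _ (Nest.par_mem _))

end Recover

/-! Conversely, the coordinates are recovered from the configuration. -/

section Converse

variable (hS : S.IsScale) {t : Idx U T → ℝ} (ht : S.Pos t)
include hS ht

theorem config_sub_pred {v : U ⊕ T} (hv : v ≠ d.𝒯.root) :
    S.config t v - S.config t (d.𝒯.pred v) =
      (S.R t * S.ρ t (d.𝒯.P v) Finset.univ / S.ρ t S.W Finset.univ) • S.incr v t := by
  have hW := (ht.ρ_pos hS Finset.univ S.W).ne'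
  rcases v with a | τ
  · obtain ⟨b, hb⟩ := exists_pred_inl (d := d) a
    rw [hb, config_inl, config_inl]
    unfold incr
    simp only [hb]
    split_ifs with ha
    · obtain ⟨hPW, hR1⟩ := hS.P_of_mem _ ha hv
      rw [hPW, hR1, one_mul, div_self hW, one_smul]
      rfl
    · have hf := hS.foot_pred a b ha hb
      have hP := Nest.P_mem (𝒯 := d.𝒯) (Sum.inl a)
      have h1 : S.prm (Sum.inl a) t = S.prm (Sum.inl b) t +
          S.R t * S.ρ t (d.𝒯.P (Sum.inl a)) S.W * S.wt (Sum.inl a) t := by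
        rw [prm_step ha hv, hb]
        rfl
      have h2 : S.ρ t (d.𝒯.P (Sum.inl a)) Finset.univ =
          S.ρ t (d.𝒯.P (Sum.inl a)) S.W * S.ρ t S.W Finset.univ :=
        Nest.ratio_mul _ ⟨_, Nest.mem_P _⟩ hS.W_mem (hS.P_subset a ha) (Finset.subset_univ _)
      rw [d.ℓ_congr hf, (d.par a).slope_eq, smul_smul, h2]
      congr 1
      rw [h1]
      field_simp
      ring
  · rw [config_step (by simp) hv]
    simp

theorem config_sub_base {A : Finset (U ⊕ T)} (hA : A ∈ d.𝒯.cl) {v : U ⊕ T} (hv : v ∈ A) :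
    S.config t v - S.config t (d.𝒯.base A) =
      (S.R t * S.ρ t A Finset.univ / S.ρ t S.W Finset.univ) • S.pos A v t := by
  refine Nest.induction_on_mem hA (p := fun v => S.config t v - S.config t (d.𝒯.base A) =
      (S.R t * S.ρ t A Finset.univ / S.ρ t S.W Finset.univ) • S.pos A v t) ?_ ?_ hv
  · rw [pos_base, sub_self, smul_zero]
  · intro v hv hb hP ih
    have hr := Nest.ne_root_of_ne_base hv hb
    have h2 : S.ρ t (d.𝒯.P v) Finset.univ = S.ρ t (d.𝒯.P v) A * S.ρ t A Finset.univ :=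
      Nest.ratio_mul _ ⟨_, Nest.mem_P _⟩ hA hP (Finset.subset_univ _)
    rw [pos_step hb hr]
    rw [smul_add, ← ih, smul_smul, ← sub_add_sub_cancel _ (S.config t (d.𝒯.pred v)),
      config_sub_pred hS ht hr, h2, add_comm]
    congr 2
    ring

theorem config_sub {A : Finset (U ⊕ T)} (hA : A ∈ d.𝒯.cl) {v w : U ⊕ T} (hv : v ∈ A)
    (hw : w ∈ A) : S.config t v - S.config t w =
      (S.R t * S.ρ t A Finset.univ / S.ρ t S.W Finset.univ) • (S.pos A v t - S.pos A w t) := by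
  rw [smul_sub, ← config_sub_base hS ht hA hv, ← config_sub_base hS ht hA hw]
  abel

variable (hL : Function.Injective L) (hC : S.config t ∈ Γ.configSpace L)
  (hσ : ∀ a, (d.par a).σ (S.config t (Sum.inl a)) = S.prm (Sum.inl a) t)
include hL hC hσ

theorem realForm_config {j : Idx U T} (hj : vt j ∉ S.Z) : S.realForm j (S.config t) =
    (S.R t * S.ρ t (d.𝒯.P (vt j)) Finset.univ / S.ρ t S.W Finset.univ) * S.wt j t := by
  have hr := ne_root hS hj
  rcases j with a | ⟨τ, l⟩
  · have hj : Sum.inl a ∉ S.Z := hj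
    obtain ⟨b, hb⟩ := exists_pred_inl (d := d) a
    have hg : ∀ a, (d.par a).ℓ ((d.par a).σ (S.config t (Sum.inl a))) = S.config t (Sum.inl a) :=
      fun a => by rw [hσ, config_inl]
    have h1 : S.prm (Sum.inl a) t = S.prm (Sum.inl b) t +
        S.R t * S.ρ t (d.𝒯.P (Sum.inl a)) S.W * S.wt (Sum.inl a) t := by
      rw [prm_step hj hr, hb]
      rfl
    have h2 : S.ρ t (d.𝒯.P (Sum.inl a)) Finset.univ =
        S.ρ t (d.𝒯.P (Sum.inl a)) S.W * S.ρ t S.W Finset.univ :=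
      Nest.ratio_mul _ ⟨_, Nest.mem_P _⟩ hS.W_mem (hS.P_subset a hj) (Finset.subset_univ _)
    have hW := (ht.ρ_pos hS Finset.univ S.W).ne'
    rw [realForm_of_notMem hL hC hg hj hr hb (hS.foot_pred a b hj hb), hσ, hσ, h1, vt_inl, h2]
    field_simp
    ring
  · have hr : (Sum.inr τ : U ⊕ T) ≠ d.𝒯.root := hr
    rw [realForm_inr, config_sub_pred hS ht hr]
    rfl

theorem realWidth_config {A : Finset (U ⊕ T)} (hA : A ∈ d.𝒯.cl) : S.realWidth A (S.config t) =
    S.R t * S.ρ t A Finset.univ / S.ρ t S.W Finset.univ := by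
  by_cases hZ : vt (S.ν A) ∈ S.Z
  · obtain ⟨rfl, -⟩ := hS.eq_W A hA hZ
    obtain ⟨h1, h2⟩ := realWidth_W hS hL hC hZ
    rw [h1, h2, one_mul, div_self (ht.ρ_pos hS _ _).ne']
  · have hn : S.IsNormal (S.ν A) := ⟨by rw [hS.P_ν A hA], hZ⟩
    rw [realWidth, realForm_config hS ht hL hC hσ hZ, wt, if_pos hn, hS.P_ν A hA]
    linear_combination (S.R t * S.ρ t A Finset.univ / S.ρ t S.W Finset.univ) * hS.ε_sq A hA

theorem coord_config : S.coord (Γ.canon (S.config t)) = t := by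
  funext j
  have hRp := (hS.contDiffAt_R t ht).2
  have hW := (ht.ρ_pos hS Finset.univ S.W).ne'
  have hus : ∀ C ∈ d.𝒯.cl, C ≠ Finset.univ → S.realWidth C (S.config t) /
      S.realWidth (d.𝒯.par C) (S.config t) = S.us t C := by
    intro C hCm hne
    have h1 : S.ρ t C Finset.univ = S.us t C * S.ρ t (d.𝒯.par C) Finset.univ := by
      rw [← Nest.ratio_par (S.us t) hCm hne]
      exact Nest.ratio_mul _ (d.𝒯.nonempty C hCm) (Nest.par_mem C) (Nest.ssubset_par hne).subset
        (Finset.subset_univ _)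
    have h2 := (ht.ρ_pos hS Finset.univ (d.𝒯.par C)).ne'
    rw [realWidth_config hS ht hL hC hσ hCm, realWidth_config hS ht hL hC hσ (Nest.par_mem C), h1]
    field_simp
  by_cases hZ : vt j ∈ S.Z
  · rcases j with a | ⟨τ, l⟩
    · have hZ' : Sum.inl a ∈ S.Z := hZ
      rw [coord_of_mem _ hZ']
      change (d.par a).σ (S.config t (Sum.inl a)) = _
      rw [hσ, prm_of_mem hZ']
      rfl
    · exact absurd hZ (inr_notMem hS τ)
  · by_cases hn : S.IsNormal j
    · obtain ⟨C, hCm, rfl⟩ : ∃ C ∈ d.𝒯.cl, S.ν C = j := ⟨_, Nest.P_mem _, hn.1⟩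
      by_cases hne : C = Finset.univ
      · subst hne
        by_cases hWZ : vt (S.ν S.W) ∈ S.Z
        · have hne : S.W ≠ Finset.univ := fun h => hZ (h ▸ hWZ)
          rw [(coord_univ hL hC hS hne hWZ).2, hus _ hS.W_mem hne, us, if_pos hWZ]
        · rw [(coord_gauge hS _ hWZ).2]
          exact hS.gauge_eq hWZ t ht hC hσ fun A hA => realWidth_config hS ht hL hC hσ hA
      · rw [coord_normal hL hC hS hCm hne hZ, hus C hCm hne, us, if_neg hZ]
    · have h2 := (ht.ρ_pos hS Finset.univ (d.𝒯.P (vt j))).ne'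
      have h3 := hRp.ne'
      rw [coord_of_notMem hL hC hS hZ hn, realForm_config hS ht hL hC hσ hZ,
        realWidth_config hS ht hL hC hσ (Nest.P_mem _), wt, if_neg hn]
      field_simp

theorem canon_config : Γ.canon (S.config t) = S.chart t := by
  have hRp := (hS.contDiffAt_R t ht).2
  refine Prod.ext ?_ (Prod.ext ?_ ?_)
  · funext B
    have hA := (d.sep B.1 B.2).choose_spec
    set A := (d.sep B.1 B.2).choose
    refine nrm_affine (c := S.R t * S.ρ t A Finset.univ / S.ρ t S.W Finset.univ)
      (b := S.config t (d.𝒯.base A))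
      (div_pos (mul_pos hRp (ht.ρ_pos hS _ _)) (ht.ρ_pos hS _ _)) fun a => ?_
    rw [← config_sub_base hS ht hA.1 (hA.2.1 a.2), sub_add_cancel]
  · funext a
    exact config_inl a t
  · refine congrArg ULift.up (hS.scl_eq t ht hC fun v => ?_)
    have := config_sub_base hS ht d.𝒯.univ_mem (Finset.mem_univ v)
    rwa [ρ, Nest.ratio_self, mul_one] at this

end Converse

end ScaleData

end Diagram

/-! ### Local coordinates of the compactification -/

/-- Coordinates at the point `p` of the closure of the image of `C` under the map `can`: near `p`,
the coordinates are `G`, and the point of the closure with given coordinates is `Φ`. The image of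
`C` itself is given by the condition that the coordinates in `Cn` are positive; the point of `C`
with given coordinates is `X`. -/
structure LocalModel (J : Type*) [Fintype J] {E F : Type*} [NormedAddCommGroup E]
    [NormedSpace ℝ E] [NormedAddCommGroup F] [NormedSpace ℝ F] (C : Set F) (can : F → E)
    (p : E) where
  Cn : Set J
  G : E → J → ℝ
  Φ : (J → ℝ) → E
  X : (J → ℝ) → F
  contDiffAt_G : ∀ᶠ e in 𝓝 p, ContDiffAt ℝ ∞ G e
  contDiffAt_Φ : ∀ᶠ t in 𝓝 (G p), ContDiffAt ℝ ∞ Φ t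
  contDiffAt_X : ∀ᶠ t in 𝓝 (G p), (∀ j ∈ Cn, 0 < t j) → ContDiffAt ℝ ∞ X t
  X_G : ∀ᶠ e in 𝓝 p, ∀ x ∈ C, can x = e → (∀ j ∈ Cn, 0 < G e j) ∧ X (G e) = x
  G_X : ∀ᶠ t in 𝓝 (G p), (∀ j ∈ Cn, 0 < t j) → X t ∈ C ∧ G (can (X t)) = t ∧ can (X t) = Φ t

theorem eventually_contDiffAt_normalize {E : Type*} [NormedAddCommGroup E] [NormedSpace ℝ E]
    {g : E → E3} (hg : ContDiff ℝ ∞ g) {p : E} (h : g p ≠ 0) :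
    ∀ᶠ e in 𝓝 p, ContDiffAt ℝ ∞ (fun e => (‖g e‖ ^ 2)⁻¹ • g e) e := by
  filter_upwards [hg.continuous.continuousAt.eventually_ne h] with e he
  exact ((hg.norm_sq ℝ).contDiffAt.inv (pow_ne_zero 2 (norm_ne_zero_iff.2 he))).smul hg.contDiffAt

namespace Diagram

variable {U : Type v} {T : Type w} {M : Type u}
  [TopologicalSpace M] [ChartedSpace (EuclideanHalfSpace 1) M] [Fintype U] [Fintype T]
  {Γ : Diagram U T M} {L : M → E3} {p : Γ.Ambient}

theorem contDiff_vpos (v : U ⊕ T) : ContDiff ℝ ∞ fun e : Γ.Ambient => vpos e v := by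
  rcases v with a | t
  · exact contDiff_pos a
  · exact contDiff_const

namespace ScaleData

variable [DecidableEq (U ⊕ T)] [Nonempty U] {d : ClusterData Γ L p} {S : ScaleData d}

section Smooth

variable (hS : S.IsScale)
include hS

theorem eventually_contDiffAt_covector {j : Idx U T}
    (hj : vt j ∉ S.Z ∨ ∃ C ∈ d.𝒯.cl, S.ν C = j) :
    ∀ᶠ e in 𝓝 p, ContDiffAt ℝ ∞ (S.covector j) e := by
  rcases j with a | ⟨τ, l⟩
  · by_cases ha : Sum.inl a ∈ S.Z
    · obtain ⟨C, hC, hν⟩ := hj.resolve_left fun h => h ha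
      have h1 : S.covector (Sum.inl a) = fun e =>
          (‖vpos e (Sum.inl a) - vpos e (d.𝒯.pred (Sum.inl a))‖ ^ 2)⁻¹ •
          (vpos e (Sum.inl a) - vpos e (d.𝒯.pred (Sum.inl a))) := by
        funext e
        simp only [covector, if_pos ha]
      rw [h1]
      refine eventually_contDiffAt_normalize ((contDiff_vpos _).sub (contDiff_vpos _)) fun h0 => ?_
      have h2 := hS.width_pos C hC
      rw [width, form, hν, h1] at h2
      simp [h0] at h2
    · have h1 : S.covector (Sum.inl a) = fun e =>
          (‖(d.par a).slope (d.σV (d.𝒯.pred (Sum.inl a)) (vpos e (d.𝒯.pred (Sum.inl a))),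
            (d.par a).σ (e.2.1 a))‖ ^ 2)⁻¹ •
          (d.par a).slope (d.σV (d.𝒯.pred (Sum.inl a)) (vpos e (d.𝒯.pred (Sum.inl a))),
            (d.par a).σ (e.2.1 a)) := by
        funext e
        simp only [covector, if_neg ha]
      rw [h1]
      refine eventually_contDiffAt_normalize ((d.par a).contDiff_slope.comp
        (((d.contDiff_σV _).comp (contDiff_vpos _)).prodMk
        ((d.par a).contDiff_σ.comp (Diagram.contDiff_pos a)))) ?_
      obtain ⟨b, hb⟩ := exists_pred_inl (d := d) a
      have hf := hS.foot_pred a b ha hb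
      rw [hb]
      have h2 : d.σV (Sum.inl b) (vpos p (Sum.inl b)) = d.s₀ a := by
        rw [← d.s₀_congr hf]
        rfl
      change (d.par a).slope (d.σV (Sum.inl b) (vpos p (Sum.inl b)), (d.par a).σ (p.2.1 a)) ≠ 0
      rw [h2]
      exact d.slope_s₀_ne a
  · exact Filter.Eventually.of_forall fun e => contDiffAt_const

theorem eventually_contDiffAt_form {j : Idx U T} (A : Finset (U ⊕ T))
    (hj : vt j ∉ S.Z ∨ ∃ C ∈ d.𝒯.cl, S.ν C = j) :
    ∀ᶠ e in 𝓝 p, ContDiffAt ℝ ∞ (S.form j A) e := by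
  filter_upwards [eventually_contDiffAt_covector hS hj] with e he
  exact ((contDiff_shape _ _).sub (contDiff_shape _ _)).contDiffAt.inner ℝ he

theorem eventually_contDiffAt_width {C : Finset (U ⊕ T)} (A : Finset (U ⊕ T)) (hC : C ∈ d.𝒯.cl) :
    ∀ᶠ e in 𝓝 p, ContDiffAt ℝ ∞ (S.width C A) e := by
  filter_upwards [eventually_contDiffAt_form hS A (Or.inr ⟨C, hC, rfl⟩)] with e he
  exact contDiffAt_const.mul he

theorem eventually_width_pos : ∀ᶠ e in 𝓝 p, ∀ A ∈ d.𝒯.cl, 0 < S.width A A e := by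
  refine (Filter.eventually_all_finset _).2 fun A hA => ?_
  exact (eventually_contDiffAt_width hS A hA).self_of_nhds.continuousAt.eventually
    (lt_mem_nhds (hS.width_pos A hA))

theorem eventually_contDiffAt_width_div {A C : Finset (U ⊕ T)} (hA : A ∈ d.𝒯.cl)
    (hC : C ∈ d.𝒯.cl) : ∀ᶠ e in 𝓝 p, ContDiffAt ℝ ∞ (fun e => S.width C A e / S.width A A e) e := by
  filter_upwards [eventually_contDiffAt_width hS A hC, eventually_contDiffAt_width hS A hA,
    eventually_width_pos hS] with e h1 h2 h3
  exact h1.div h2 (h3 A hA).ne'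

theorem eventually_contDiffAt_coord : ∀ᶠ e in 𝓝 p, ContDiffAt ℝ ∞ S.coord e := by
  have h : ∀ j, ∀ᶠ e in 𝓝 p, ContDiffAt ℝ ∞ (fun e => S.coord e j) e := by
    intro j
    unfold coord
    split_ifs with hZ hn hu hW
    · exact Filter.Eventually.of_forall fun e =>
        ((d.contDiff_σV _).comp (contDiff_vpos _)).contDiffAt
    · exact eventually_contDiffAt_width_div hS (Nest.par_mem _) hS.W_mem
    · exact hS.contDiffAt_gauge hW
    · exact eventually_contDiffAt_width_div hS (Nest.par_mem _) (Nest.P_mem _)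
    · filter_upwards [eventually_contDiffAt_form hS (d.𝒯.P (vt j)) (Or.inl hZ),
        eventually_contDiffAt_width hS _ (Nest.P_mem (vt j)), eventually_width_pos hS]
        with e h1 h2 h3
      exact h1.div h2 (h3 _ (Nest.P_mem _)).ne'
  filter_upwards [Filter.eventually_all.2 h] with e he using contDiffAt_pi.2 he

theorem continuousAt_coord : ContinuousAt S.coord p :=
  (eventually_contDiffAt_coord hS).self_of_nhds.continuousAt

variable (hL : Function.Injective L)
include hL

/-- Near `p`, the assumptions under which configurations are recovered from their coordinates are
satisfied. -/
theorem eventually_recover : ∀ᶠ e in 𝓝 p, ∀ x ∈ Γ.configSpace L, Γ.canon x = e →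
    (∀ a, (d.par a).ℓ ((d.par a).σ (x (Sum.inl a))) = x (Sum.inl a)) ∧
    (∀ A ∈ d.𝒯.cl, 0 < S.realWidth A x) ∧
    S.R (S.coord (Γ.canon x)) = S.realWidth S.W x ∧ S.Pos (S.coord (Γ.canon x)) := by
  have hg : ∀ᶠ e in 𝓝 p, vt (S.ν S.W) ∉ S.Z → ∀ x ∈ Γ.configSpace L, Γ.canon x = e →
      0 < S.gauge e ∧
        ∀ t : Idx U T → ℝ, t (S.ν Finset.univ) = S.gauge e → S.R t = S.realWidth S.W x := by
    by_cases hZ : vt (S.ν S.W) ∉ S.Z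
    · filter_upwards [hS.gauge_spec hZ] with e he _ using he
    · exact Filter.Eventually.of_forall fun e h => absurd h hZ
  filter_upwards [eventually_width_pos hS, d.eventually_good, hg] with e h1 h2 h3 x hx hxe
  have hw : ∀ A ∈ d.𝒯.cl, 0 < S.realWidth A x := by
    intro A hA
    have h4 := h1 A hA
    rw [← hxe, width_canon hS x hA hA subset_rfl] at h4
    exact pos_of_mul_pos_right h4 (inv_nonneg.2 (size_nonneg _))
  have hR : S.R (S.coord (Γ.canon x)) = S.realWidth S.W x := by
    by_cases hZ : vt (S.ν S.W) ∈ S.Z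
    · obtain ⟨h5, h6⟩ := realWidth_W hS hL hx hZ
      rw [h5, h6]
    · refine (h3 hZ x hx hxe).2 _ ?_
      rw [← hxe]
      exact (coord_gauge hS _ hZ).2
  refine ⟨fun a => (h2 x hx hxe a).1, hw, hR, ?_⟩
  exact Pos_coord hS hL hx (fun a => (h2 x hx hxe a).1) hw hR (fun a => (h2 x hx hxe a).2)
    fun hZ => hxe ▸ (h3 hZ x hx hxe).1

variable (hp : p ∈ Γ.compactification L)
include hp

/-- The recursion for the curve parameters gives the correct values at `p` itself, by continuity. -/
theorem prm_coord_self (a : U) : S.prm (Sum.inl a) (S.coord p) = d.s₀ a := by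
  refine eq_of_mem_closure hp (f := fun e => S.prm (Sum.inl a) (S.coord e))
    (g := fun e => (d.par a).σ (e.2.1 a)) ?_ ?_ ?_
  · exact (contDiff_prm hS.contDiff_R a).continuous.continuousAt.comp (continuousAt_coord hS)
  · exact ((d.par a).contDiff_σ.comp (Diagram.contDiff_pos a)).continuous.continuousAt
  · filter_upwards [eventually_recover hS hL] with e he
    rintro ⟨x, hx, rfl⟩
    obtain ⟨h1, h2, h3, -⟩ := he x hx rfl
    exact prm_coord hS hL hx h1 h2 h3 a

/-- The shapes of the clusters are determined by the coordinates at `p` itself, by continuity. -/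
theorem pos_coord_self {A : Finset (U ⊕ T)} (hA : A ∈ d.𝒯.cl) {v : U ⊕ T} (hv : v ∈ A) :
    S.pos A v (S.coord p) = (S.width A A p)⁻¹ • (shape p A v - shape p A (d.𝒯.base A)) := by
  refine eq_of_mem_closure hp (f := fun e => S.pos A v (S.coord e))
    (g := fun e => (S.width A A e)⁻¹ • (shape e A v - shape e A (d.𝒯.base A))) ?_ ?_ ?_
  · exact (contDiff_pos hS.contDiff_R A v).continuous.continuousAt.comp (continuousAt_coord hS)
  · exact ((eventually_contDiffAt_width hS A hA).self_of_nhds.continuousAt.inv₀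
      (hS.width_pos A hA).ne').smul
      ((contDiff_shape _ _).sub (contDiff_shape _ _)).continuous.continuousAt
  · filter_upwards [eventually_recover hS hL] with e he
    rintro ⟨x, hx, rfl⟩
    obtain ⟨h1, h2, h3, -⟩ := he x hx rfl
    exact pos_coord_eq hS hL hx h1 h2 h3 hA hv

theorem pos_sub_coord_self {A : Finset (U ⊕ T)} (hA : A ∈ d.𝒯.cl) {v w : U ⊕ T} (hv : v ∈ A)
    (hw : w ∈ A) : S.pos A v (S.coord p) - S.pos A w (S.coord p) =
      (S.width A A p)⁻¹ • (shape p A v - shape p A w) := by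
  rw [pos_coord_self hS hL hp hA hv, pos_coord_self hS hL hp hA hw, ← smul_sub,
    sub_sub_sub_cancel_right]

theorem pos_coord_self_ne {A : Finset (U ⊕ T)} (hA : A ∈ d.𝒯.cl) {v w : U ⊕ T} (hv : v ∈ A)
    (hw : w ∈ A) (h : shape p A v ≠ shape p A w) :
    S.pos A v (S.coord p) ≠ S.pos A w (S.coord p) := by
  rw [← sub_ne_zero, pos_sub_coord_self hS hL hp hA hv hw]
  exact smul_ne_zero (inv_ne_zero (hS.width_pos A hA).ne') (sub_ne_zero.2 h)

/-- The parameters of the univalent vertices with equal positions at `p` are in the order of the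
ranking, as this can be read off from the shape of a cluster, which depends continuously on `t`. -/
theorem eventually_prm_lt : ∀ᶠ t in 𝓝 (S.coord p), S.Pos t → ∀ a b, d.foot a = d.foot b →
    d.𝒯.key (Sum.inl a) < d.𝒯.key (Sum.inl b) → S.prm (Sum.inl a) t < S.prm (Sum.inl b) t := by
  suffices h : ∀ a b, d.foot a = d.foot b → d.𝒯.key (Sum.inl a) < d.𝒯.key (Sum.inl b) →
      ∀ᶠ t in 𝓝 (S.coord p), S.Pos t → S.prm (Sum.inl a) t < S.prm (Sum.inl b) t by
    have h' : ∀ᶠ t in 𝓝 (S.coord p), ∀ a b, d.foot a = d.foot b →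
        d.𝒯.key (Sum.inl a) < d.𝒯.key (Sum.inl b) →
        S.Pos t → S.prm (Sum.inl a) t < S.prm (Sum.inl b) t := by
      refine Filter.eventually_all.2 fun a => Filter.eventually_all.2 fun b => ?_
      by_cases hf : d.foot a = d.foot b
      · by_cases hk : d.𝒯.key (Sum.inl a) < d.𝒯.key (Sum.inl b)
        · filter_upwards [h a b hf hk] with t ht _ _ using ht
        · exact Filter.Eventually.of_forall fun t _ h' => absurd h' hk
      · exact Filter.Eventually.of_forall fun t h' => absurd h' hf
    filter_upwards [h'] with t ht h0 a b hf hk using ht a b hf hk h0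
  intro a b hf hk
  have hab : (Sum.inl a : U ⊕ T) ≠ Sum.inl b := fun h => hk.ne (congrArg _ h)
  obtain ⟨A, hA, hsub, hne⟩ := d.sep _ (IsConnSet.pair (fullGraph_adj.2 (Or.inr ⟨hab, rfl, rfl⟩)))
  have ha : Sum.inl a ∈ A := hsub (by simp)
  have hb : Sum.inl b ∈ A := hsub (by simp)
  have hne' : shape p A (Sum.inl b) ≠ shape p A (Sum.inl a) := by
    obtain ⟨v, hv, w, hw, hvw⟩ := hne
    simp only [Finset.mem_insert, Finset.mem_singleton] at hv hw
    rcases hv with rfl | rfl <;> rcases hw with rfl | rfl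
    · exact absurd rfl hvw
    · exact hvw.symm
    · exact hvw
    · exact absurd rfl hvw
  have hcross := d.cross_pos hp hA ha hb hf hk hne'
  have hcont : Continuous fun t => inner ℝ (S.pos A (Sum.inl b) t - S.pos A (Sum.inl a) t)
      ((d.par a).slope (S.prm (Sum.inl a) t, S.prm (Sum.inl b) t)) :=
    ((contDiff_pos hS.contDiff_R A _).continuous.sub
      (contDiff_pos hS.contDiff_R A _).continuous).inner
      ((d.par a).contDiff_slope.continuous.comp
        ((contDiff_prm hS.contDiff_R a).continuous.prodMk
          (contDiff_prm hS.contDiff_R b).continuous))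
  have h0 : 0 < inner ℝ (S.pos A (Sum.inl b) (S.coord p) - S.pos A (Sum.inl a) (S.coord p))
      ((d.par a).slope (S.prm (Sum.inl a) (S.coord p), S.prm (Sum.inl b) (S.coord p))) := by
    rw [pos_sub_coord_self hS hL hp hA hb ha, prm_coord_self hS hL hp, prm_coord_self hS hL hp,
      real_inner_smul_left, Footing.s₀, Footing.s₀, ← d.σ_congr hf]
    exact mul_pos (inv_pos.2 (hS.width_pos A hA)) hcross
  filter_upwards [hcont.continuousAt.eventually (lt_mem_nhds h0)] with t ht hpos
  have h1 := config_sub hS hpos hA hb ha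
  rw [config_inl, config_inl, ← d.ℓ_congr hf, (d.par a).slope_eq] at h1
  have hc : 0 < S.R t * S.ρ t A Finset.univ / S.ρ t S.W Finset.univ :=
    div_pos (mul_pos (hS.contDiffAt_R t hpos).2 (hpos.ρ_pos hS _ _)) (hpos.ρ_pos hS _ _)
  have h2 := congrArg (fun y => inner ℝ y
    ((d.par a).slope (S.prm (Sum.inl a) t, S.prm (Sum.inl b) t))) h1
  simp only [real_inner_smul_left] at h2
  have h3 := mul_pos hc ht
  rw [← h2] at h3
  exact sub_pos.1 (pos_of_mul_pos_left h3 real_inner_self_nonneg)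

theorem prm_pos {t : Idx U T → ℝ} (ht : S.Pos t) (hlt : ∀ a b, d.foot a = d.foot b →
    d.𝒯.key (Sum.inl a) < d.𝒯.key (Sum.inl b) → S.prm (Sum.inl a) t < S.prm (Sum.inl b) t) (a : U) :
    0 < S.prm (Sum.inl a) t := by
  induction hn : d.𝒯.key (Sum.inl a) using Nat.strong_induction_on generalizing a with
  | _ n ih =>
    by_cases ha : Sum.inl a ∈ S.Z
    · rw [prm_of_mem ha]
      exact ht _ (Or.inr ha)
    · obtain ⟨b, hb⟩ := exists_pred_inl (d := d) a
      have hk := Nest.key_pred_lt (inl_ne_root hS ha)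
      rw [hb] at hk
      exact (ih _ (hn ▸ hk) b rfl).trans (hlt b a (hS.foot_pred a b ha hb) hk)

/-- Positive coordinates close to those of `p` belong to configurations: the ends of an edge are
distinct since they are so in the shape of some cluster at `p`, and the positions on the curve belong
to the isotopy class since they are in the order of the ranking. -/
theorem eventually_config (hLe : Topology.IsEmbedding L) :
    ∀ᶠ t in 𝓝 (S.coord p), S.Pos t → S.config t ∈ Γ.configSpace L ∧
      ∀ a, (d.par a).σ (S.config t (Sum.inl a)) = S.prm (Sum.inl a) t := by
  have hprm : ContinuousAt (fun t => fun a => S.prm (Sum.inl a) t) (S.coord p) :=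
    (continuous_pi fun a => (contDiff_prm hS.contDiff_R a).continuous).continuousAt
  have hprm0 : (fun a => S.prm (Sum.inl a) (S.coord p)) = fun a => d.s₀ a :=
    funext fun a => prm_coord_self hS hL hp a
  have h1 := d.eventually_mem_cls hLe hp
  rw [← hprm0] at h1
  have h2 : ∀ᶠ t in 𝓝 (S.coord p), ∀ a,
      |S.prm (Sum.inl a) t - (d.par a).σ (L (d.foot a))| < (d.par a).ε := by
    refine Filter.eventually_all.2 fun a => ?_
    have hc : Continuous fun t => |S.prm (Sum.inl a) t - (d.par a).σ (L (d.foot a))| :=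
      ((contDiff_prm hS.contDiff_R a).continuous.sub continuous_const).abs
    refine hc.continuousAt.eventually (gt_mem_nhds ?_)
    change |S.prm (Sum.inl a) (S.coord p) - _| < _
    rw [prm_coord_self hS hL hp, d.s₀_eq, sub_self, abs_zero]
    exact (d.par a).ε_pos
  have h3 : ∀ᶠ t in 𝓝 (S.coord p), ∀ v w, Γ.graph.Adj v w → S.Pos t →
      S.config t v ≠ S.config t w := by
    refine Filter.eventually_all.2 fun v => Filter.eventually_all.2 fun w => ?_
    by_cases hvw : Γ.graph.Adj v w
    · obtain ⟨A, hA, hsub, hne⟩ := d.sep _ (IsConnSet.pair (fullGraph_adj.2 (Or.inl hvw)))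
      have hv : v ∈ A := hsub (by simp)
      have hw : w ∈ A := hsub (by simp)
      have hne' : shape p A v ≠ shape p A w := by
        obtain ⟨v', hv', w', hw', hvw'⟩ := hne
        simp only [Finset.mem_insert, Finset.mem_singleton] at hv' hw'
        rcases hv' with rfl | rfl <;> rcases hw' with rfl | rfl
        · exact absurd rfl hvw'
        · exact hvw'
        · exact hvw'.symm
        · exact absurd rfl hvw'
      have hopen := (isOpen_ne_fun (contDiff_pos hS.contDiff_R A v).continuous
        (contDiff_pos hS.contDiff_R A w).continuous).mem_nhds
          (pos_coord_self_ne hS hL hp hA hv hw hne')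
      filter_upwards [hopen] with t ht _ hpos
      rw [← sub_ne_zero, config_sub hS hpos hA hv hw]
      exact smul_ne_zero (div_pos (mul_pos (hS.contDiffAt_R t hpos).2 (hpos.ρ_pos hS _ _))
        (hpos.ρ_pos hS _ _)).ne' (sub_ne_zero.2 ht)
    · exact Filter.Eventually.of_forall fun t h' => absurd h' hvw
  filter_upwards [hprm.eventually h1, h2, h3, eventually_prm_lt hS hL hp] with t h1 h2 h3 h4 hpos
  obtain ⟨i, hi, hLi⟩ := h1 (prm_pos hS hL hp hpos (h4 hpos)) (h4 hpos)
  refine ⟨⟨fun v w hvw => h3 v w hvw hpos, i, hi, fun a => ?_⟩, fun a => ?_⟩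
  · rw [config_inl, hLi]
  · rw [config_inl, (d.par a).σ_ℓ _ (h2 a)]

theorem eventually_contDiffAt_chart : ∀ᶠ t in 𝓝 (S.coord p), ContDiffAt ℝ ∞ S.chart t := by
  have h1 : ∀ᶠ t in 𝓝 (S.coord p), ∀ B : Γ.ConnectedSets, ContDiffAt ℝ ∞
      (fun t => nrm fun a : B.1 => S.pos (d.sep B.1 B.2).choose a t) t := by
    refine Filter.eventually_all.2 fun B => ?_
    obtain ⟨hA, hsub, v, hv, w, hw, hvw⟩ := (d.sep B.1 B.2).choose_spec
    set A := (d.sep B.1 B.2).choose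
    filter_upwards [(isOpen_ne_fun (contDiff_pos hS.contDiff_R A v).continuous
        (contDiff_pos hS.contDiff_R A w).continuous).mem_nhds
        (pos_coord_self_ne hS hL hp hA (hsub hv) (hsub hw) hvw)] with t ht
    refine ContDiffAt.comp t (contDiffAt_nrm ⟨⟨v, hv⟩, ⟨w, hw⟩, ht⟩) ?_
    exact contDiffAt_pi.2 fun a => (contDiff_pos hS.contDiff_R A a).contDiffAt
  have h2 : ∀ᶠ t in 𝓝 (S.coord p), ContDiffAt ℝ ∞ S.scl t := by
    refine hS.contDiffAt_scl ?_
    obtain ⟨A, hA, hsub, v, hv, w, hw, hvw⟩ := d.sep _ (d.conn _ d.𝒯.univ_mem)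
    obtain rfl := Finset.univ_subset_iff.1 hsub
    exact ⟨v, w, pos_coord_self_ne hS hL hp hA hv hw hvw⟩
  filter_upwards [h1, h2] with t h1 h2
  refine ContDiffAt.prodMk (contDiffAt_pi.2 h1) (ContDiffAt.prodMk ?_ ?_)
  · exact contDiffAt_pi.2 fun a =>
      ((d.contDiff_ℓV _).comp (contDiff_prm hS.contDiff_R a)).contDiffAt
  · exact (ContinuousLinearEquiv.ulift (R₁ := ℝ) (M₁ := ℝ)).symm.contDiff.contDiffAt.comp t h2

/-- The local coordinates at `p`. -/
def localModel (hLe : Topology.IsEmbedding L) :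
    LocalModel (Idx U T) (Γ.configSpace L) Γ.canon p where
  Cn := {j | S.IsConstrained j}
  G := S.coord
  Φ := S.chart
  X := S.config
  contDiffAt_G := eventually_contDiffAt_coord hS
  contDiffAt_Φ := eventually_contDiffAt_chart hS hL hp
  contDiffAt_X := Filter.Eventually.of_forall fun _ ht => hS.contDiffAt_config ht
  X_G := by
    filter_upwards [eventually_recover hS hL] with e he x hx hxe
    obtain ⟨h1, h2, h3, h4⟩ := he x hx hxe
    subst hxe
    exact ⟨h4, config_coord hS hL hx h1 h2 h3⟩
  G_X := by
    filter_upwards [eventually_config hS hL hp hLe] with t ht hpos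
    obtain ⟨h1, h2⟩ := ht hpos
    exact ⟨h1, coord_config hS hpos hL h1 h2, canon_config hS hpos hL h1 h2⟩

end Smooth

end ScaleData

end Diagram

/-! ### Existence of local coordinates -/

namespace Diagram

variable {U : Type v} {T : Type w} {M : Type u}
  [TopologicalSpace M] [ChartedSpace (EuclideanHalfSpace 1) M] [Fintype U] [Fintype T]
  {Γ : Diagram U T M} {L : M → E3} {p : Γ.Ambient}

namespace ScaleData

variable [DecidableEq (U ⊕ T)] [Nonempty U] {d : ClusterData Γ L p}

theorem exists_root_inl (d : ClusterData Γ L p) : ∃ a, d.𝒯.root = Sum.inl a := by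
  rcases h : d.𝒯.root with a | t
  · exact ⟨a, rfl⟩
  · have h1 : d.𝒯.key d.𝒯.root ≤ _ :=
      d.𝒯.key_base_le (Finset.mem_univ (Sum.inl (Classical.arbitrary U)))
    rw [h] at h1
    exact absurd (d.key_lt _ t) h1.not_gt

/-- If the shape of `A` is not constant on a set of vertices, then it separates some vertex of that
set from its predecessor. -/
theorem exists_shape_pred_ne {A : Finset (U ⊕ T)} (hA : A ∈ d.𝒯.cl) {s : Set (U ⊕ T)}
    (hs : ∀ v ∈ s, d.𝒯.pred v ∈ s)
    (h : ∃ v ∈ A, ∃ w ∈ A, v ∈ s ∧ w ∈ s ∧ shape p A v ≠ shape p A w) :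
    ∃ v ∈ s, v ≠ d.𝒯.root ∧ d.𝒯.P v = A ∧ shape p A v ≠ shape p A (d.𝒯.pred v) := by
  by_contra! hc
  have key : ∀ v ∈ A, v ∈ s → shape p A v = shape p A (d.𝒯.base A) := by
    intro v hv
    refine Nest.induction_on_mem hA
      (p := fun v => v ∈ s → shape p A v = shape p A (d.𝒯.base A)) (fun _ => rfl) ?_ hv
    intro v hv hb hP ih hvs
    rw [← ih (hs v hvs)]
    rcases hP.eq_or_ssubset with h' | h'
    · exact hc v hvs (Nest.ne_root_of_ne_base hv hb) h'
    · exact d.const A hA _ (Nest.P_mem v) h' _ (Nest.mem_P v) _ (Nest.pred_mem_P v)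
  obtain ⟨v, hv, w, hw, hvs, hws, hne⟩ := h
  exact hne ((key v hv hvs).trans (key w hw hws).symm)

theorem slope_congr {a b : U} (h : d.foot a = d.foot b) : (d.par a).slope = (d.par b).slope :=
  congrArg (fun m => (d.prm m).slope) h

/-- A vertex which is separated from its predecessor provides a coordinate that measures the scale
of a cluster. -/
theorem exists_form_pos (hp : p ∈ Γ.compactification L) (hlim : IsLimitShape Γ L p)
    (S : ScaleData d)
    (hf : ∀ a b, Sum.inl a ∉ S.Z → d.𝒯.pred (Sum.inl a) = Sum.inl b → d.foot b = d.foot a)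
    (hZ : ∀ a b, Sum.inl a ∈ S.Z → Sum.inl a ≠ d.𝒯.root → d.𝒯.pred (Sum.inl a) = Sum.inl b →
      shape p (d.𝒯.P (Sum.inl a)) (Sum.inl a) ≠ shape p (d.𝒯.P (Sum.inl a)) (Sum.inl b) →
      p.2.1 a ≠ p.2.1 b)
    {v : U ⊕ T} (hv : v ≠ d.𝒯.root)
    (hne : shape p (d.𝒯.P v) v ≠ shape p (d.𝒯.P v) (d.𝒯.pred v)) :
    ∃ (j : Idx U T) (ε : ℝ), vt j = v ∧ ε * ε = 1 ∧ (v.isLeft → ε = 1) ∧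
      0 < ε * S.form j (d.𝒯.P v) p := by
  rcases v with a | τ
  · refine ⟨Sum.inl a, 1, rfl, one_mul 1, fun _ => rfl, ?_⟩
    obtain ⟨b, hb⟩ := exists_pred_inl (d := d) a
    have hA := Nest.P_mem (𝒯 := d.𝒯) (Sum.inl a)
    have haA := Nest.mem_P (𝒯 := d.𝒯) (Sum.inl a)
    have hbA := Nest.pred_mem_P (𝒯 := d.𝒯) (Sum.inl a)
    have hk := Nest.key_pred_lt hv
    rw [hb] at hne hbA hk
    rw [one_mul]
    by_cases ha : Sum.inl a ∈ S.Z
    · have hpos := sub_ne_zero.2 (hZ a b ha hv hb hne)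
      have h1 : S.form (Sum.inl a) (d.𝒯.P (Sum.inl a)) p =
          (‖p.2.1 a - p.2.1 b‖ ^ 2)⁻¹ * inner ℝ (shape p (d.𝒯.P (Sum.inl a)) (Sum.inl a) -
            shape p (d.𝒯.P (Sum.inl a)) (Sum.inl b)) (p.2.1 a - p.2.1 b) := by
        rw [← real_inner_smul_right]
        simp only [form, covector, if_pos ha, vt_inl, hb]
        rfl
      rw [h1]
      refine mul_pos (inv_pos.2 (pow_pos (norm_pos_iff.2 hpos) 2)) ?_
      rw [shape_eq (d.conn _ hA) haA, shape_eq (d.conn _ hA) hbA] at hne ⊢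
      rw [hlim.pos_inner ⟨_, d.conn _ hA⟩ a b haA hbA]
      exact mul_pos (norm_pos_iff.2 (sub_ne_zero.2 hne)) (norm_pos_iff.2 hpos)
    · have hfab := hf a b ha hb
      have h1 : S.form (Sum.inl a) (d.𝒯.P (Sum.inl a)) p =
          (‖(d.par a).slope ((d.par b).σ (p.2.1 b), (d.par a).σ (p.2.1 a))‖ ^ 2)⁻¹ *
            d.cross (d.𝒯.P (Sum.inl a)) b a p := by
        rw [Footing.cross, ← real_inner_smul_right, slope_congr hfab, d.σ_congr hfab]
        simp only [form, covector, if_neg ha, vt_inl, hb]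
        rw [← d.σ_congr hfab]
        rfl
      rw [h1]
      refine mul_pos (inv_pos.2 (pow_pos (norm_pos_iff.2 ?_) 2))
        (d.cross_pos hp hA hbA haA hfab hk hne)
      rw [← d.σ_congr hfab, ← slope_congr hfab]
      exact d.slope_pos_ne hfab
  · have hl : ∃ l, (shape p (d.𝒯.P (Sum.inr τ)) (Sum.inr τ) -
        shape p (d.𝒯.P (Sum.inr τ)) (d.𝒯.pred (Sum.inr τ))) l ≠ 0 := by
      by_contra! h
      refine hne (sub_eq_zero.1 ?_)
      ext l
      exact h l
    obtain ⟨l, hl⟩ := hl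
    have h1 : S.form (Sum.inr (τ, l)) (d.𝒯.P (Sum.inr τ)) p =
        (shape p (d.𝒯.P (Sum.inr τ)) (Sum.inr τ) -
        shape p (d.𝒯.P (Sum.inr τ)) (d.𝒯.pred (Sum.inr τ))) l := by
      simp [form, covector, EuclideanSpace.inner_single_right]
    rcases hl.lt_or_gt with h | h
    · refine ⟨Sum.inr (τ, l), -1, rfl, by norm_num, fun h => by simp at h, ?_⟩
      rw [h1]
      linarith
    · refine ⟨Sum.inr (τ, l), 1, rfl, by norm_num, fun _ => rfl, ?_⟩
      rw [h1, one_mul]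
      exact h

/-- A choice of a coordinate for each cluster, which belongs to a univalent vertex if the shape of
the cluster is not constant on the univalent vertices. -/
theorem exists_normals (hp : p ∈ Γ.compactification L) (hlim : IsLimitShape Γ L p)
    (S : ScaleData d)
    (hf : ∀ a b, Sum.inl a ∉ S.Z → d.𝒯.pred (Sum.inl a) = Sum.inl b → d.foot b = d.foot a)
    (hZ : ∀ a b, Sum.inl a ∈ S.Z → Sum.inl a ≠ d.𝒯.root → d.𝒯.pred (Sum.inl a) = Sum.inl b →
      shape p (d.𝒯.P (Sum.inl a)) (Sum.inl a) ≠ shape p (d.𝒯.P (Sum.inl a)) (Sum.inl b) →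
      p.2.1 a ≠ p.2.1 b) :
    ∃ (ν : Finset (U ⊕ T) → Idx U T) (ε : Finset (U ⊕ T) → ℝ), ∀ A ∈ d.𝒯.cl,
      d.𝒯.P (vt (ν A)) = A ∧ vt (ν A) ≠ d.𝒯.root ∧ ε A * ε A = 1 ∧
      ((vt (ν A)).isLeft → ε A = 1) ∧ 0 < ε A * S.form (ν A) A p ∧
      ((∃ a b, Sum.inl a ∈ A ∧ Sum.inl b ∈ A ∧ shape p A (Sum.inl a) ≠ shape p A (Sum.inl b)) →
        (vt (ν A)).isLeft) := by
  have key : ∀ A, ∃ (j : Idx U T) (ε : ℝ), A ∈ d.𝒯.cl →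
      d.𝒯.P (vt j) = A ∧ vt j ≠ d.𝒯.root ∧ ε * ε = 1 ∧
      ((vt j).isLeft → ε = 1) ∧ 0 < ε * S.form j A p ∧
      ((∃ a b, Sum.inl a ∈ A ∧ Sum.inl b ∈ A ∧ shape p A (Sum.inl a) ≠ shape p A (Sum.inl b)) →
        (vt j).isLeft) := by
    intro A
    by_cases hA : A ∈ d.𝒯.cl
    · by_cases hU : ∃ a b, Sum.inl a ∈ A ∧ Sum.inl b ∈ A ∧
        shape p A (Sum.inl a) ≠ shape p A (Sum.inl b)
      · obtain ⟨a, b, ha, hb, hab⟩ := hU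
        obtain ⟨v, hvs, hvr, rfl, hv⟩ := exists_shape_pred_ne hA (s := {v | v.isLeft}) (by
          rintro v hv
          obtain ⟨a, rfl⟩ := Sum.isLeft_iff.1 hv
          obtain ⟨b, hb⟩ := exists_pred_inl (d := d) a
          rw [hb]
          rfl) ⟨_, ha, _, hb, rfl, rfl, hab⟩
        obtain ⟨j, ε, rfl, h1, h2, h3⟩ := exists_form_pos hp hlim S hf hZ hvr hv
        exact ⟨j, ε, fun _ => ⟨rfl, hvr, h1, h2, h3, fun _ => hvs⟩⟩
      · obtain ⟨v, hv, w, hw, hvw⟩ := exists_shape_ne hlim (d.conn A hA)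
        obtain ⟨v, -, hvr, rfl, hv⟩ := exists_shape_pred_ne hA (s := Set.univ)
          (fun _ _ => Set.mem_univ _) ⟨v, hv, w, hw, Set.mem_univ _, Set.mem_univ _, hvw⟩
        obtain ⟨j, ε, rfl, h1, h2, h3⟩ := exists_form_pos hp hlim S hf hZ hvr hv
        exact ⟨j, ε, fun _ => ⟨rfl, hvr, h1, h2, h3, fun h => absurd h hU⟩⟩
    · exact ⟨Sum.inl (Classical.arbitrary U), 0, fun h => absurd h hA⟩
  choose ν ε h using key
  exact ⟨ν, ε, h⟩

section SeveralUnivalent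

variable (hp : p ∈ Γ.compactification L) (hlim : IsLimitShape Γ L p)
  (hL : Function.Injective L) {W : Finset (U ⊕ T)} (hW : W ∈ d.𝒯.cl)
  (hUW : ∀ a : U, Sum.inl a ∈ W)
include hUW hW

theorem P_inl_subset {a : U} (ha : Sum.inl a ≠ d.𝒯.root) : d.𝒯.P (Sum.inl a) ⊆ W := by
  refine Nest.P_subset hW (hUW a) fun h => ha ?_
  obtain ⟨r, hr⟩ := exists_root_inl d
  have hroot : d.𝒯.base Finset.univ ∈ W := by
    change d.𝒯.root ∈ W
    rw [hr]
    exact hUW r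
  rw [← h]
  exact d.𝒯.base_eq_of_subset (Finset.subset_univ W) hroot

variable (hne : ∃ a b : U, shape p W (Sum.inl a) ≠ shape p W (Sum.inl b))
  (hU : Fintype.card U ≠ 1)
include hp hlim hL hne hU

/-- If the positions of the univalent vertices are not all equal, the parameters of those which
are not in a common cluster with their predecessor are coordinates. -/
theorem exists_isScale_of_spread (hpos : ∃ a b : U, p.2.1 a ≠ p.2.1 b) :
    ∃ S : ScaleData d, S.IsScale := by
  obtain ⟨c, e, hce⟩ := hne
  obtain ⟨c', e', hce'⟩ := hpos
  have hpn : ∀ a b : U, ‖shape p W (Sum.inl a) - shape p W (Sum.inl b)‖ * ‖p.2.1 c' - p.2.1 e'‖ =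
      ‖shape p W (Sum.inl c') - shape p W (Sum.inl e')‖ * ‖p.2.1 a - p.2.1 b‖ := by
    intro a b
    simp only [shape_eq (d.conn W hW) (hUW _)]
    exact hlim.pos_norm ⟨W, d.conn W hW⟩ a b c' e' (hUW _) (hUW _) (hUW _) (hUW _)
  have hc : ‖p.2.1 c' - p.2.1 e'‖ ≠ 0 := norm_ne_zero_iff.2 (sub_ne_zero.2 hce')
  have hs : ‖shape p W (Sum.inl c') - shape p W (Sum.inl e')‖ ≠ 0 := by
    intro h0
    have h1 := hpn c e
    rw [h0, zero_mul] at h1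
    exact mul_ne_zero (norm_ne_zero_iff.2 (sub_ne_zero.2 hce)) hc h1
  let Z : Set (U ⊕ T) := {v | v = d.𝒯.root ∨ ∃ a, v = Sum.inl a ∧ d.𝒯.P v = W}
  have hf : ∀ a b, Sum.inl a ∉ Z → d.𝒯.pred (Sum.inl a) = Sum.inl b → d.foot b = d.foot a := by
    intro a b ha hb
    have ha1 : (Sum.inl a : U ⊕ T) ≠ d.𝒯.root := fun h => ha (Or.inl h)
    have ha2 : d.𝒯.P (Sum.inl a) ≠ W := fun h => ha (Or.inr ⟨a, rfl, h⟩)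
    have hsub := (P_inl_subset hW hUW ha1).ssubset_of_ne ha2
    have h1 := d.const W hW _ (Nest.P_mem _) hsub _ (Nest.mem_P _) _ (Nest.pred_mem_P (Sum.inl a))
    rw [hb] at h1
    have h2 := hpn a b
    rw [h1, sub_self, norm_zero, zero_mul] at h2
    have h3 := (mul_eq_zero.1 h2.symm).resolve_left hs
    rw [norm_eq_zero, sub_eq_zero, ← d.foot_eq, ← d.foot_eq] at h3
    exact (hL h3).symm
  have hZ : ∀ a b, Sum.inl a ∈ Z → Sum.inl a ≠ d.𝒯.root → d.𝒯.pred (Sum.inl a) = Sum.inl b →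
      shape p (d.𝒯.P (Sum.inl a)) (Sum.inl a) ≠ shape p (d.𝒯.P (Sum.inl a)) (Sum.inl b) →
      p.2.1 a ≠ p.2.1 b := by
    intro a b ha har hb hab hpe
    obtain ⟨-, -, hPW⟩ := ha.resolve_left har
    rw [hPW] at hab
    have h1 := hpn a b
    rw [hpe, sub_self, norm_zero, mul_zero] at h1
    exact mul_ne_zero (norm_ne_zero_iff.2 (sub_ne_zero.2 hab)) hc h1
  obtain ⟨ν, ε, h⟩ := exists_normals hp hlim
    (⟨Z, W, fun _ => Sum.inl c, 0, 0, 0, 0⟩ : ScaleData d) hf hZ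
  have hνW : vt (ν W) ∈ Z := by
    obtain ⟨h1, -, -, -, -, h6⟩ := h W hW
    obtain ⟨a, ha⟩ := Sum.isLeft_iff.1 (h6 ⟨c, e, hUW _, hUW _, hce⟩)
    exact Or.inr ⟨a, ha, h1⟩
  exact ⟨⟨Z, W, ν, ε, fun _ => 1, 0, 0⟩, {
    root_mem := Or.inl rfl
    exists_inl := by
      rintro v (rfl | ⟨a, rfl, -⟩)
      · exact exists_root_inl d
      · exact ⟨a, rfl⟩
    W_mem := hW
    P_of_mem := by
      rintro v hv hvr
      obtain ⟨a, -, h⟩ := hv.resolve_left hvr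
      exact ⟨h, fun _ => rfl⟩
    P_subset := fun a ha => P_inl_subset hW hUW fun h => ha (Or.inl h)
    foot_pred := hf
    P_ν := fun A hA => (h A hA).1
    ν_ne := fun A hA => (h A hA).2.1
    ε_sq := fun A hA => (h A hA).2.2.1
    eq_W := by
      intro A hA hν
      obtain ⟨a, ha, h'⟩ := hν.resolve_left (h A hA).2.1
      refine ⟨(h A hA).1.symm.trans h', (h A hA).2.2.2.1 ?_⟩
      rw [ha]
      rfl
    width_pos := fun A hA => (h A hA).2.2.2.2.1
    contDiff_R := Or.inl contDiff_const
    contDiffAt_R := fun t _ => ⟨contDiffAt_const, one_pos⟩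
    contDiffAt_gauge := fun h => absurd hνW h
    gauge_spec := fun h => absurd hνW h
    gauge_eq := fun h => absurd hνW h
    scl_eq := fun t _ _ _ => if_neg hU
    contDiffAt_scl := fun _ => Filter.Eventually.of_forall fun t => contDiffAt_const }⟩

/-- If the positions of the univalent vertices are all equal, one of the coordinates is the
difference of the parameters of a univalent vertex and its predecessor. -/
theorem exists_isScale_of_collapsed (hpos : ∀ a b : U, p.2.1 a = p.2.1 b) :
    ∃ S : ScaleData d, S.IsScale := by
  have hfoot : ∀ a b, d.foot a = d.foot b := fun a b => hL (by rw [d.foot_eq, d.foot_eq, hpos a b])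
  let Z : Set (U ⊕ T) := {d.𝒯.root}
  obtain ⟨ν, ε, h⟩ := exists_normals hp hlim
    (⟨Z, W, fun _ => Sum.inl (Classical.arbitrary U), 0, 0, 0, 0⟩ : ScaleData d)
    (fun a b _ _ => hfoot b a) (fun a b h h' => absurd h h')
  obtain ⟨c, hc⟩ : ∃ c, ν W = Sum.inl c := by
    obtain ⟨c, e, hce⟩ := hne
    have h6 := (h W hW).2.2.2.2.2 ⟨c, e, hUW _, hUW _, hce⟩
    rcases hν : ν W with c | ⟨τ, l⟩
    · exact ⟨c, rfl⟩
    · rw [hν] at h6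
      exact absurd h6 Bool.false_ne_true
  have hcP : d.𝒯.P (Sum.inl c) = W := by
    have := (h W hW).1
    rwa [hc] at this
  have hcr : (Sum.inl c : U ⊕ T) ≠ d.𝒯.root := by
    have := (h W hW).2.1
    rwa [hc] at this
  have hcε : ε W = 1 := by
    have := (h W hW).2.2.2.1
    rw [hc] at this
    exact this rfl
  obtain ⟨b, hb⟩ := exists_pred_inl (d := d) c
  have hk := Nest.key_pred_lt hcr
  rw [hb] at hk
  let S : ScaleData d := ⟨Z, W, ν, ε, fun t => t (ν Finset.univ),
    fun e => (d.par c).σ (e.2.1 c) - (d.par b).σ (e.2.1 b), 0⟩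
  have hνu : S.IsNormal (ν Finset.univ) :=
    ⟨by change ν (d.𝒯.P _) = _; rw [(h _ d.𝒯.univ_mem).1], (h _ d.𝒯.univ_mem).2.1⟩
  exact ⟨S, {
    root_mem := rfl
    exists_inl := by
      rintro v rfl
      exact exists_root_inl d
    W_mem := hW
    P_of_mem := fun v hv hvr => absurd hv hvr
    P_subset := fun a ha => P_inl_subset hW hUW ha
    foot_pred := fun a b _ _ => hfoot b a
    P_ν := fun A hA => (h A hA).1
    ν_ne := fun A hA => (h A hA).2.1
    ε_sq := fun A hA => (h A hA).2.2.1
    eq_W := fun A hA hν => absurd hν (h A hA).2.1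
    width_pos := fun A hA => (h A hA).2.2.2.2.1
    contDiff_R := Or.inl (contDiff_apply ℝ ℝ _)
    contDiffAt_R := fun t ht => ⟨(contDiff_apply ℝ ℝ _).contDiffAt, ht _ (Or.inl hνu)⟩
    contDiffAt_gauge := fun _ => Filter.Eventually.of_forall fun e =>
      (((d.par c).contDiff_σ.comp (Diagram.contDiff_pos c)).sub
        ((d.par b).contDiff_σ.comp (Diagram.contDiff_pos b))).contDiffAt
    gauge_spec := by
      intro _
      filter_upwards [d.order, d.eventually_good] with e h1 h2 x hx hxe
      have h3 := h1 x hx hxe b c (hfoot b c) hk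
      rw [d.σ_congr (hfoot b c)] at h3
      have h4 : S.gauge e = (d.par c).σ (x (Sum.inl c)) - (d.par b).σ (x (Sum.inl b)) := by
        rw [← hxe]
        rfl
      refine ⟨?_, fun t ht => ?_⟩
      · rw [h4, ← d.σ_congr (hfoot c b)]
        exact sub_pos.2 h3
      · change t (ν Finset.univ) = _
        rw [ht, h4, realWidth]
        change _ = ε W * S.realForm (ν W) x
        rw [hcε, one_mul, hc, realForm_of_notMem hL hx (fun a => (h2 x hx hxe a).1) (S := S)
          hcr hcr hb (hfoot b c)]
    gauge_eq := by
      intro _ t ht _ hσ _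
      change (d.par c).σ (S.config t (Sum.inl c)) - (d.par b).σ (S.config t (Sum.inl b)) =
        t (ν Finset.univ)
      have hn : S.IsNormal (Sum.inl c) := ⟨by change ν (d.𝒯.P (Sum.inl c)) = _; rw [hcP, hc], hcr⟩
      rw [hσ, hσ, prm_step (S := S) hcr hcr, hb, hcP]
      change _ + t (ν Finset.univ) * d.𝒯.ratio _ W W * S.wt (Sum.inl c) t - _ = _
      rw [wt, if_pos hn, Nest.ratio_self]
      change _ + _ * ε (d.𝒯.P (Sum.inl c)) - _ = _
      rw [hcP, hcε]
      ring
    scl_eq := fun t _ _ _ => if_neg hU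
    contDiffAt_scl := fun _ => Filter.Eventually.of_forall fun t => contDiffAt_const }⟩

end SeveralUnivalent

section OneUnivalent

theorem size_univ {V : Type*} [Fintype V] (x : V → E3) :
    size (fun a : (Finset.univ : Finset V) => x a) = size x := by
  have hm : mean (fun a : (Finset.univ : Finset V) => x a) = mean x := by
    simp only [mean, Fintype.card_coe, Finset.card_univ]
    rw [Finset.sum_coe_sort Finset.univ x]
  simp only [size, hm]
  rw [Finset.sum_coe_sort Finset.univ fun a => ‖x a - mean x‖ ^ 2]

/-- The conditions on the choices, if there is a single univalent vertex: it remains to relate the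
overall scale to the coordinate `ν univ`. -/
theorem isScale_of_card_eq_one (hL : Function.Injective L) (hU : Fintype.card U = 1)
    (S : ScaleData d) (hZ : S.Z = {d.𝒯.root}) (hW : S.W = Finset.univ)
    (h : ∀ A ∈ d.𝒯.cl, d.𝒯.P (vt (S.ν A)) = A ∧ vt (S.ν A) ≠ d.𝒯.root ∧ S.ε A * S.ε A = 1 ∧
      0 < S.ε A * S.form (S.ν A) A p)
    (hR : ∀ t, 0 < t (S.ν Finset.univ) → ContDiffAt ℝ ∞ S.R t ∧ 0 < S.R t)
    (hgauge : ∀ᶠ e in 𝓝 p, ContDiffAt ℝ ∞ S.gauge e)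
    (hspec : ∀ᶠ e in 𝓝 p, ∀ x ∈ Γ.configSpace L, Γ.canon x = e → 0 < S.gauge e ∧
      ∀ t : Idx U T → ℝ, t (S.ν Finset.univ) = S.gauge e →
        S.R t = size x * S.width Finset.univ Finset.univ e)
    (heq : ∀ t, 0 < t (S.ν Finset.univ) → ∀ x ∈ Γ.configSpace L,
      size x * S.width Finset.univ Finset.univ (Γ.canon x) = S.R t →
        S.gauge (Γ.canon x) = t (S.ν Finset.univ))
    (hscl : ∀ t, 0 < t (S.ν Finset.univ) →
      S.R t * size (fun v => S.pos Finset.univ v t) /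
        (1 + S.R t * size (fun v => S.pos Finset.univ v t)) = S.scl t)
    (hscl' : ∀ t₀, t₀ (S.ν Finset.univ) = S.gauge p →
      (∀ᶠ t in 𝓝 t₀, ContDiffAt ℝ ∞ (fun t => size fun v => S.pos Finset.univ v t) t ∧
        0 < size fun v => S.pos Finset.univ v t) → ∀ᶠ t in 𝓝 t₀, ContDiffAt ℝ ∞ S.scl t) :
    S.IsScale := by
  obtain ⟨a₀, ha₀⟩ := Fintype.card_eq_one_iff.1 hU
  have hinl : ∀ a : U, (Sum.inl a : U ⊕ T) = d.𝒯.root := fun a => by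
    obtain ⟨r, hr⟩ := exists_root_inl d
    rw [hr, ha₀ r, ha₀ a]
  have hmem : ∀ a : U, Sum.inl a ∈ S.Z := fun a => by rw [hZ]; exact hinl a
  have hum := d.𝒯.univ_mem
  have hνu : vt (S.ν Finset.univ) ∉ S.Z := by rw [hZ]; exact (h _ hum).2.1
  have hn : S.IsNormal (S.ν Finset.univ) := ⟨by rw [(h _ hum).1], hνu⟩
  have hw : ∀ x ∈ Γ.configSpace L, S.realWidth Finset.univ x =
      size x * S.width Finset.univ Finset.univ (Γ.canon x) := by
    intro x hx
    have hs : size x ≠ 0 := (size_pos (exists_ne_of_card_eq_one hL hU hx)).ne'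
    rw [width, form_canon x hum (Finset.subset_univ _), size_univ, realWidth]
    field_simp
  exact {
    root_mem := by rw [hZ]; rfl
    exists_inl := by
      rw [hZ]
      rintro v rfl
      exact exists_root_inl d
    W_mem := by rw [hW]; exact hum
    P_of_mem := fun v hv hvr => by rw [hZ] at hv; exact absurd hv hvr
    P_subset := fun a ha => absurd (hmem a) ha
    foot_pred := fun a b ha _ => absurd (hmem a) ha
    P_ν := fun A hA => (h A hA).1
    ν_ne := fun A hA => (h A hA).2.1
    ε_sq := fun A hA => (h A hA).2.2.1
    eq_W := fun A hA hν => by rw [hZ] at hν; exact absurd hν (h A hA).2.1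
    width_pos := fun A hA => (h A hA).2.2.2
    contDiff_R := Or.inr hmem
    contDiffAt_R := fun t ht => hR t (ht _ (Or.inl hn))
    contDiffAt_gauge := fun _ => hgauge
    gauge_spec := by
      intro _
      filter_upwards [hspec] with e he x hx hxe
      refine ⟨(he x hx hxe).1, fun t ht => ?_⟩
      rw [(he x hx hxe).2 t ht, hW, hw x hx, hxe]
    gauge_eq := by
      intro _ t ht hC _ hwd
      refine heq t (ht _ (Or.inl hn)) _ hC ?_
      rw [← hw _ hC, hwd _ hum, hW, ρ, Nest.ratio_self, mul_one, div_one]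
    scl_eq := by
      intro t ht hC hpos
      rw [hW, ρ, Nest.ratio_self, div_one] at hpos
      have h1 : size (S.config t) = S.R t * size fun v => S.pos Finset.univ v t :=
        size_affine (hR t (ht _ (Or.inl hn))).2.le (b := S.config t d.𝒯.root) fun v => by
          rw [← hpos, sub_add_cancel]
      rw [scale, if_pos hU, h1, hscl t (ht _ (Or.inl hn))]
    contDiffAt_scl := by
      rintro ⟨v, w, hvw⟩
      have hc := contDiff_pos (S := S) (Or.inr hmem) Finset.univ
      refine hscl' _ ?_ ?_
      · rw [coord, if_neg hνu, if_pos hn, (h _ hum).1, if_pos rfl, if_neg (by rwa [hW])]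
      · filter_upwards [(isOpen_ne_fun (hc v).continuous (hc w).continuous).mem_nhds hvw] with t ht
        have hsz : ContDiffAt ℝ ∞ size fun v => S.pos Finset.univ v t :=
          contDiffAt_size ⟨v, w, ht⟩
        exact ⟨ContDiffAt.comp (f := fun t v => S.pos Finset.univ v t) t hsz
          (contDiffAt_pi.2 fun v => (hc v).contDiffAt), size_pos ⟨v, w, ht⟩⟩ }

/-- If there is a single univalent vertex, the overall scale is recorded in the compactification. It
is infinite at the point `p` if its bounded version is `1` at `p`. -/
theorem exists_isScale_of_card_eq_one (hp : p ∈ Γ.compactification L) (hlim : IsLimitShape Γ L p)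
    (hL : Function.Injective L) (hU : Fintype.card U = 1) : ∃ S : ScaleData d, S.IsScale := by
  obtain ⟨a₀, ha₀⟩ := Fintype.card_eq_one_iff.1 hU
  have hinl : ∀ a : U, (Sum.inl a : U ⊕ T) = d.𝒯.root := fun a => by
    obtain ⟨r, hr⟩ := exists_root_inl d
    rw [hr, ha₀ r, ha₀ a]
  let Z : Set (U ⊕ T) := {d.𝒯.root}
  obtain ⟨ν, ε, h⟩ := exists_normals hp hlim
    (⟨Z, Finset.univ, fun _ => Sum.inl a₀, 0, 0, 0, 0⟩ : ScaleData d)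
    (fun a b h => absurd (hinl a) h) (fun a b h h' => absurd h h')
  have hum := d.𝒯.univ_mem
  obtain ⟨τ, l, hτ⟩ : ∃ τ l, ν Finset.univ = Sum.inr (τ, l) := by
    rcases hν : ν Finset.univ with a | ⟨τ, l⟩
    · have := (h _ hum).2.1
      rw [hν] at this
      exact absurd (hinl a) this
    · exact ⟨τ, l, rfl⟩
  let S₀ : ScaleData d := ⟨Z, Finset.univ, ν, ε, 0, 0, 0⟩
  have hwc : ContDiff ℝ ∞ (S₀.width Finset.univ Finset.univ) := by
    have h1 : S₀.width Finset.univ Finset.univ = fun e => ε Finset.univ *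
        inner ℝ (shape e Finset.univ (Sum.inr τ) - shape e Finset.univ (d.𝒯.pred (Sum.inr τ)))
          (EuclideanSpace.single l 1) := by
      funext e
      rw [width, form]
      change ε _ * inner ℝ (shape e Finset.univ (vt (ν _)) -
        shape e Finset.univ (d.𝒯.pred (vt (ν _)))) (S₀.covector (ν _) e) = _
      rw [hτ]
      rfl
    rw [h1]
    exact contDiff_const.mul
      (((contDiff_shape _ _).sub (contDiff_shape _ _)).inner ℝ contDiff_const)
  have hwp : ∀ᶠ e in 𝓝 p, 0 < S₀.width Finset.univ Finset.univ e :=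
    hwc.continuous.continuousAt.eventually (lt_mem_nhds (h _ hum).2.2.2.2.1)
  have hsc : ContDiff ℝ ∞ fun e : Γ.Ambient => e.2.2.down :=
    (ContinuousLinearEquiv.ulift (R₁ := ℝ) (M₁ := ℝ)).contDiff.comp
      (contDiff_snd.comp contDiff_snd)
  have hsx : ∀ x ∈ Γ.configSpace L, 0 < size x ∧ (Γ.canon x).2.2.down = size x / (1 + size x) :=
    fun x hx => ⟨size_pos (exists_ne_of_card_eq_one hL hU hx), if_pos hU⟩
  have hτc : ContDiff ℝ ∞ fun t : Idx U T → ℝ => t (ν Finset.univ) := contDiff_apply ℝ ℝ _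
  have hm := hlim.scale_mem
  rcases hm.2.lt_or_eq with h1 | h1
  · let S : ScaleData d := ⟨Z, Finset.univ, ν, ε, fun t => t (ν Finset.univ),
      fun e => e.2.2.down / (1 - e.2.2.down) * S₀.width Finset.univ Finset.univ e, fun t =>
        t (ν Finset.univ) * size (fun v => pos (⟨Z, Finset.univ, ν, ε, fun t => t (ν Finset.univ),
          0, 0⟩ : ScaleData d) Finset.univ v t) / (1 + t (ν Finset.univ) * size (fun v =>
          pos (⟨Z, Finset.univ, ν, ε, fun t => t (ν Finset.univ), 0, 0⟩ : ScaleData d)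
          Finset.univ v t))⟩
    have hg : ∀ x ∈ Γ.configSpace L, S.gauge (Γ.canon x) =
        size x * S₀.width Finset.univ Finset.univ (Γ.canon x) := by
      intro x hx
      obtain ⟨h2, h3⟩ := hsx x hx
      change (Γ.canon x).2.2.down / (1 - (Γ.canon x).2.2.down) * _ = _
      rw [h3]
      congr 1
      field_simp
      ring
    refine ⟨S, isScale_of_card_eq_one hL hU S rfl rfl (fun A hA => ⟨(h A hA).1, (h A hA).2.1,
      (h A hA).2.2.1, (h A hA).2.2.2.2.1⟩) (fun t ht => ⟨hτc.contDiffAt, ht⟩) ?_ ?_ ?_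
      (fun t _ => rfl) ?_⟩
    · filter_upwards [hsc.continuous.continuousAt.eventually (gt_mem_nhds h1)] with e he
      exact (hsc.contDiffAt.div (contDiffAt_const.sub hsc.contDiffAt) (sub_pos.2 he).ne').mul
        hwc.contDiffAt
    · filter_upwards [hwp] with e he x hx hxe
      subst hxe
      rw [hg x hx]
      exact ⟨mul_pos (hsx x hx).1 he, fun t ht => ht⟩
    · intro t _ x hx hR
      rw [hg x hx]
      exact hR
    · intro t₀ ht₀ hN
      have h0 : 0 ≤ t₀ (ν Finset.univ) := by
        change t₀ (ν Finset.univ) = p.2.2.down / (1 - p.2.2.down) *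
          S₀.width Finset.univ Finset.univ p at ht₀
        rw [ht₀]
        exact mul_nonneg (div_nonneg hm.1 (sub_pos.2 h1).le) hwp.self_of_nhds.le
      have hc : ContinuousAt (fun t => 1 + t (ν Finset.univ) *
          size fun v => S.pos Finset.univ v t) t₀ :=
        continuousAt_const.add (hτc.continuous.continuousAt.mul
          hN.self_of_nhds.1.continuousAt)
      filter_upwards [hN, hc.eventually (lt_mem_nhds (add_pos_of_pos_of_nonneg one_pos
        (mul_nonneg h0 hN.self_of_nhds.2.le)))] with t h2 h3
      exact (hτc.contDiffAt.mul h2.1).div (contDiffAt_const.add (hτc.contDiffAt.mul h2.1)) h3.ne'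
  · let S : ScaleData d := ⟨Z, Finset.univ, ν, ε, fun t => (t (ν Finset.univ))⁻¹,
      fun e => (1 - e.2.2.down) / e.2.2.down / S₀.width Finset.univ Finset.univ e, fun t =>
        size (fun v => pos (⟨Z, Finset.univ, ν, ε, fun t => (t (ν Finset.univ))⁻¹,
          0, 0⟩ : ScaleData d) Finset.univ v t) / (t (ν Finset.univ) + size (fun v =>
          pos (⟨Z, Finset.univ, ν, ε, fun t => (t (ν Finset.univ))⁻¹, 0, 0⟩ : ScaleData d)
          Finset.univ v t))⟩
    have hg : ∀ x ∈ Γ.configSpace L, S.gauge (Γ.canon x) =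
        (size x * S₀.width Finset.univ Finset.univ (Γ.canon x))⁻¹ := by
      intro x hx
      obtain ⟨h2, h3⟩ := hsx x hx
      change (1 - (Γ.canon x).2.2.down) / (Γ.canon x).2.2.down / _ = _
      rw [h3, mul_inv, div_eq_mul_inv _ (S₀.width _ _ _)]
      congr 1
      field_simp
      ring
    have hhp : ∀ᶠ e : Γ.Ambient in 𝓝 p, 0 < e.2.2.down :=
      hsc.continuous.continuousAt.eventually (lt_mem_nhds (h1 ▸ one_pos : 0 < p.2.2.down))
    refine ⟨S, isScale_of_card_eq_one hL hU S rfl rfl (fun A hA => ⟨(h A hA).1, (h A hA).2.1,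
      (h A hA).2.2.1, (h A hA).2.2.2.2.1⟩)
      (fun t ht => ⟨hτc.contDiffAt.inv ht.ne', inv_pos.2 ht⟩) ?_ ?_ ?_ ?_ ?_⟩
    · filter_upwards [hhp, hwp] with e he hwe
      exact ((contDiffAt_const.sub hsc.contDiffAt).div hsc.contDiffAt he.ne').div
        hwc.contDiffAt hwe.ne'
    · filter_upwards [hwp] with e he x hx hxe
      subst hxe
      rw [hg x hx]
      refine ⟨inv_pos.2 (mul_pos (hsx x hx).1 he), fun t ht => ?_⟩
      change (t (ν Finset.univ))⁻¹ = _
      change t (ν Finset.univ) = _ at ht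
      rw [ht, inv_inv]
      rfl
    · intro t _ x hx hR
      rw [hg x hx]
      change size x * S₀.width Finset.univ Finset.univ (Γ.canon x) = (t (ν Finset.univ))⁻¹ at hR
      rw [hR, inv_inv]
    · intro t ht
      change (t (ν Finset.univ))⁻¹ * size (fun v => S.pos Finset.univ v t) /
        (1 + (t (ν Finset.univ))⁻¹ * size fun v => S.pos Finset.univ v t) =
        size (fun v => S.pos Finset.univ v t) /
        (t (ν Finset.univ) + size fun v => S.pos Finset.univ v t)
      have ht : 0 < t (ν Finset.univ) := ht
      have hN := size_nonneg fun v => S.pos Finset.univ v t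
      field_simp
    · intro t₀ ht₀ hN
      have h0 : t₀ (ν Finset.univ) = 0 := by
        change t₀ (ν Finset.univ) = (1 - p.2.2.down) / p.2.2.down /
          S₀.width Finset.univ Finset.univ p at ht₀
        rw [ht₀, h1]
        simp
      have hc : ContinuousAt (fun t => t (ν Finset.univ) +
          size fun v => S.pos Finset.univ v t) t₀ :=
        hτc.continuous.continuousAt.add hN.self_of_nhds.1.continuousAt
      have hc0 : 0 < t₀ (ν Finset.univ) + size fun v => S.pos Finset.univ v t₀ := by
        rw [h0, zero_add]
        exact hN.self_of_nhds.2
      filter_upwards [hN, hc.eventually (lt_mem_nhds hc0)] with t h2 h3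
      exact h2.1.div (hτc.contDiffAt.add h2.1) h3.ne'

end OneUnivalent

/-- The choices can be made at all points of the compactification. -/
theorem exists_isScale [CompactSpace M] (hL : Topology.IsEmbedding L)
    (hp : p ∈ Γ.compactification L) (d : ClusterData Γ L p) : ∃ S : ScaleData d, S.IsScale := by
  have hlim := isLimitShape_of_mem hL.injective hL.continuous hp
  by_cases hU : Fintype.card U = 1
  · exact exists_isScale_of_card_eq_one hp hlim hL.injective hU
  · have h2 : 2 ≤ Fintype.card U := by
      have := Fintype.card_pos (α := U)
      omega
    obtain ⟨W, hW, hUW, v, hv, w, hw, hne⟩ := d.sep _ (isConnSet_range_inl h2)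
    have hUW' : ∀ a : U, Sum.inl a ∈ W := fun a => hUW (by simp)
    have hne' : ∃ a b : U, shape p W (Sum.inl a) ≠ shape p W (Sum.inl b) := by
      simp only [Finset.mem_map, Finset.mem_univ, true_and, Function.Embedding.inl_apply] at hv hw
      obtain ⟨a, rfl⟩ := hv
      obtain ⟨b, rfl⟩ := hw
      exact ⟨a, b, hne⟩
    by_cases hpos : ∃ a b : U, p.2.1 a ≠ p.2.1 b
    · exact exists_isScale_of_spread hp hlim hL.injective hW hUW' hne' hU hpos
    · push Not at hpos
      exact exists_isScale_of_collapsed hp hlim hL.injective hW hUW' hne' hU hpos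

end ScaleData

/-- The compactification has local coordinates at all of its points. -/
theorem nonempty_localModel [CompactSpace M] [IsManifold (𝓡∂ 1) ∞ M]
    (hL : Manifold.IsSmoothEmbedding (𝓡∂ 1) 𝓘(ℝ, E3) ∞ L) (hp : p ∈ Γ.compactification L) :
    Nonempty (LocalModel (Idx U T) (Γ.configSpace L) Γ.canon p) := by
  classical
  rcases isEmpty_or_nonempty U with hU | hU
  · -- the diagram is empty
    have hT : IsEmpty T := ⟨fun t => by
      obtain ⟨a, -⟩ := Γ.meets (Sum.inr t)
      exact hU.false a⟩
    obtain ⟨_, x, hx, -⟩ := closure_nonempty_iff.1 ⟨p, hp⟩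
    have himg : Γ.canon '' Γ.configSpace L ⊆ {Γ.canon x} := by
      rintro _ ⟨y, -, rfl⟩
      rw [Subsingleton.elim y x]
      rfl
    have hpx : p = Γ.canon x := closure_minimal himg isClosed_singleton hp
    exact ⟨{
      Cn := ∅
      G := fun _ => 0
      Φ := fun _ => p
      X := fun _ => x
      contDiffAt_G := Filter.Eventually.of_forall fun _ => contDiffAt_const
      contDiffAt_Φ := Filter.Eventually.of_forall fun _ => contDiffAt_const
      contDiffAt_X := Filter.Eventually.of_forall fun _ _ => contDiffAt_const
      X_G := Filter.Eventually.of_forall fun _ y _ _ =>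
        ⟨fun _ h => absurd h (Set.notMem_empty _), Subsingleton.elim _ _⟩
      G_X := Filter.Eventually.of_forall fun _ _ => ⟨hx, Subsingleton.elim _ _, hpx.symm⟩ }⟩
  · obtain ⟨d⟩ := nonempty_clusterData hL hp
    obtain ⟨S, hS⟩ := ScaleData.exists_isScale hL.isEmbedding hp d
    exact ⟨ScaleData.localModel hS hL.isEmbedding.injective hp hL.isEmbedding⟩

end Diagram

/-! ### Manifolds with corners from local coordinates -/

section LocalModels

variable {J E F : Type*} [Fintype J] [NormedAddCommGroup E] [NormedSpace ℝ E]
  [NormedAddCommGroup F] [NormedSpace ℝ F] {C : Set F} {can : F → E} {p : E}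

theorem mem_closure_pos {J : Type*} [Finite J] {Cn : Set J} {t : J → ℝ} (ht : ∀ j ∈ Cn, 0 ≤ t j) :
    t ∈ closure {t : J → ℝ | ∀ j ∈ Cn, 0 < t j} := by
  have hc : Continuous fun ε : ℝ => fun j => t j + ε := by fun_prop
  have h := (hc.continuousWithinAt (s := Set.Ioi 0) (x := 0)).mem_closure
    (t := {t : J → ℝ | ∀ j ∈ Cn, 0 < t j}) (by simp) fun ε hε j hj =>
      add_pos_of_nonneg_of_pos (ht j hj) hε
  simpa using h

namespace LocalModel

variable (m : LocalModel J C can p)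

/-- The charts invert the coordinates also at the boundary. -/
theorem eventually_Φ_G : ∀ᶠ e in 𝓝 p, e ∈ closure (can '' C) →
    (∀ j ∈ m.Cn, 0 ≤ m.G e j) ∧ m.Φ (m.G e) = e := by
  have hG := m.contDiffAt_G.self_of_nhds.continuousAt
  filter_upwards [m.contDiffAt_G, hG.eventually m.contDiffAt_Φ,
    (hG.eventually m.G_X).eventually_nhds, m.X_G.eventually_nhds] with e h1 h2 h3 h4 he
  constructor
  · intro j hj
    refine le_of_mem_closure he (f := fun _ => 0) (g := fun e => m.G e j) continuousAt_const
      ((continuous_apply j).continuousAt.comp h1.continuousAt) ?_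
    filter_upwards [h4] with e' h4
    rintro ⟨x, hx, hxe⟩
    exact ((h4 x hx hxe).1 j hj).le
  · refine eq_of_mem_closure he (f := fun e => m.Φ (m.G e)) (g := fun e => e)
      (ContinuousAt.comp (f := m.G) h2.continuousAt h1.continuousAt) continuousAt_id ?_
    filter_upwards [h3, h4] with e' h3 h4
    rintro ⟨x, hx, hxe⟩
    obtain ⟨h5, h6⟩ := h4 x hx hxe
    rw [← (h3 h5).2.2, h6, hxe]

theorem Φ_G_self (hp : p ∈ closure (can '' C)) : m.Φ (m.G p) = p :=
  (m.eventually_Φ_G.self_of_nhds hp).2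

theorem eventually_G_Φ (hp : p ∈ closure (can '' C)) : ∀ᶠ t in 𝓝 (m.G p), (∀ j ∈ m.Cn, 0 ≤ t j) →
    m.Φ t ∈ closure (can '' C) ∧ m.G (m.Φ t) = t := by
  have hΦ : Filter.Tendsto m.Φ (𝓝 (m.G p)) (𝓝 p) := by
    have := m.contDiffAt_Φ.self_of_nhds.continuousAt
    rwa [ContinuousAt, m.Φ_G_self hp] at this
  filter_upwards [m.contDiffAt_Φ, hΦ.eventually m.contDiffAt_G, m.G_X.eventually_nhds]
    with t h1 h2 h3 ht
  have hcl := mem_closure_pos ht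
  constructor
  · have := mem_closure_iff_nhdsWithin_neBot.1 hcl
    refine isClosed_closure.mem_of_tendsto (h1.continuousAt.mono_left nhdsWithin_le_nhds)
      (b := 𝓝[{t | ∀ j ∈ m.Cn, 0 < t j}] t) ?_
    refine eventually_nhdsWithin_iff.2 ?_
    filter_upwards [h3] with t' h3 ht'
    obtain ⟨h4, -, h5⟩ := h3 ht'
    exact subset_closure ⟨_, h4, h5⟩
  · refine eq_of_mem_closure hcl (f := fun t => m.G (m.Φ t)) (g := fun t => t)
      (ContinuousAt.comp (f := m.Φ) h2.continuousAt h1.continuousAt) continuousAt_id ?_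
    filter_upwards [h3] with t' h3 ht'
    obtain ⟨-, h4, h5⟩ := h3 ht'
    rw [← h5, h4]

end LocalModel

end LocalModels

/-- A chart at `p` of the closure of the image of `C` under `can`, with values in `[0, ∞[ⁿ`: the
restriction to the closure of the map `G`, with inverse `Φ`, such that the image of `C` corresponds
to the points with positive coordinates, where `X` is the inverse of `G ∘ can`. -/
structure CornerChart (n : ℕ) {E F : Type*} [NormedAddCommGroup E] [NormedSpace ℝ E]
    [NormedAddCommGroup F] [NormedSpace ℝ F] (C : Set F) (can : F → E) (p : E) where
  W : Set E
  O : Set (EuclideanSpace ℝ (Fin n))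
  G : E → EuclideanSpace ℝ (Fin n)
  Φ : EuclideanSpace ℝ (Fin n) → E
  X : EuclideanSpace ℝ (Fin n) → F
  isOpen_W : IsOpen W
  isOpen_O : IsOpen O
  mem_W : p ∈ W
  contDiffOn_G : ContDiffOn ℝ ∞ G W
  contDiffOn_Φ : ContDiffOn ℝ ∞ Φ O
  contDiffAt_X : ∀ t ∈ O, (∀ i, 0 < t i) → ContDiffAt ℝ ∞ X t
  map_G : ∀ e ∈ W, e ∈ closure (can '' C) → G e ∈ O ∧ (∀ i, 0 ≤ G e i) ∧ Φ (G e) = e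
  map_Φ : ∀ t ∈ O, (∀ i, 0 ≤ t i) → Φ t ∈ W ∧ Φ t ∈ closure (can '' C) ∧ G (Φ t) = t
  X_mem : ∀ t ∈ O, (∀ i, 0 < t i) → X t ∈ C ∧ can (X t) = Φ t
  G_pos : ∀ x ∈ C, can x ∈ W → (∀ i, 0 < G (can x) i) ∧ X (G (can x)) = x

section Charts

variable {J E F : Type*} [Fintype J] [NormedAddCommGroup E] [NormedSpace ℝ E]
  [NormedAddCommGroup F] [NormedSpace ℝ F] {C : Set F} {can : F → E} {p : E} {n : ℕ}

theorem LocalModel.nonempty_cornerChart (m : LocalModel J C can p) (σ : J ≃ Fin n)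
    (hp : p ∈ closure (can '' C)) : Nonempty (CornerChart n C can p) := by
  classical
  -- the unconstrained coordinates are translated, to make them positive
  let c : J → ℝ := fun j => if j ∈ m.Cn then 0 else 1 - m.G p j
  let A : (J → ℝ) → EuclideanSpace ℝ (Fin n) :=
    fun t => WithLp.toLp 2 fun i => t (σ.symm i) + c (σ.symm i)
  let B : EuclideanSpace ℝ (Fin n) → J → ℝ := fun q j => q (σ j) - c j
  have hA : ContDiff ℝ ∞ A := contDiff_euclidean.2 fun i =>
    (contDiff_apply ℝ ℝ (σ.symm i)).add contDiff_const
  have hB : ContDiff ℝ ∞ B := contDiff_pi.2 fun j =>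
    (contDiff_euclidean.1 contDiff_id (σ j)).sub contDiff_const
  have hAB : ∀ q, A (B q) = q := fun q => by ext i; simp [A, B]
  have hBA : ∀ t, B (A t) = t := fun t => by funext j; simp [A, B]
  have hfree : ∀ᶠ t in 𝓝 (m.G p), ∀ j, j ∉ m.Cn → 0 < t j + c j := by
    refine Filter.eventually_all.2 fun j => ?_
    by_cases hj : j ∈ m.Cn
    · exact Filter.Eventually.of_forall fun t h => absurd hj h
    · have hc : Continuous fun t : J → ℝ => t j + c j := by fun_prop
      filter_upwards [hc.continuousAt.eventually (lt_mem_nhds (a := 0)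
        (show 0 < m.G p j + c j by simp [c, hj]))] with t ht _ using ht
  obtain ⟨W₀, hW₀, hW₀o, hpW₀⟩ := eventually_nhds_iff.1
    (m.contDiffAt_G.and (m.X_G.and m.eventually_Φ_G))
  obtain ⟨O₀, hO₀, hO₀o, hpO₀⟩ := eventually_nhds_iff.1
    (m.contDiffAt_Φ.and (m.contDiffAt_X.and (m.G_X.and ((m.eventually_G_Φ hp).and hfree))))
  have hcn : ∀ j ∈ m.Cn, c j = 0 := fun j hj => if_pos hj
  have hB0 : ∀ q, (∀ i, 0 ≤ q i) → ∀ j ∈ m.Cn, 0 ≤ B q j := fun q hq j hj => by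
    simpa [B, hcn j hj] using hq (σ j)
  have hB1 : ∀ q, (∀ i, 0 < q i) → ∀ j ∈ m.Cn, 0 < B q j := fun q hq j hj => by
    simpa [B, hcn j hj] using hq (σ j)
  have hA0 : ∀ t ∈ O₀, (∀ j ∈ m.Cn, 0 ≤ t j) → ∀ i, 0 ≤ A t i := by
    intro t ht h i
    change 0 ≤ t (σ.symm i) + c (σ.symm i)
    by_cases hj : σ.symm i ∈ m.Cn
    · rw [hcn _ hj, add_zero]
      exact h _ hj
    · exact ((hO₀ t ht).2.2.2.2 _ hj).le
  have hA1 : ∀ t ∈ O₀, (∀ j ∈ m.Cn, 0 < t j) → ∀ i, 0 < A t i := by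
    intro t ht h i
    change 0 < t (σ.symm i) + c (σ.symm i)
    by_cases hj : σ.symm i ∈ m.Cn
    · rw [hcn _ hj, add_zero]
      exact h _ hj
    · exact (hO₀ t ht).2.2.2.2 _ hj
  have hGc : ContinuousOn m.G W₀ := fun e he => (hW₀ e he).1.continuousAt.continuousWithinAt
  have hΦc : ContinuousOn m.Φ O₀ := fun t ht => (hO₀ t ht).1.continuousAt.continuousWithinAt
  exact ⟨{
    W := W₀ ∩ m.G ⁻¹' O₀
    O := B ⁻¹' (O₀ ∩ m.Φ ⁻¹' W₀)
    G := fun e => A (m.G e)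
    Φ := fun q => m.Φ (B q)
    X := fun q => m.X (B q)
    isOpen_W := hGc.isOpen_inter_preimage hW₀o hO₀o
    isOpen_O := (hΦc.isOpen_inter_preimage hO₀o hW₀o).preimage hB.continuous
    mem_W := ⟨hpW₀, hpO₀⟩
    contDiffOn_G := fun e he => (hA.contDiffAt.comp e (hW₀ e he.1).1).contDiffWithinAt
    contDiffOn_Φ := fun q hq => ((hO₀ _ hq.1).1.comp q hB.contDiffAt).contDiffWithinAt
    contDiffAt_X := fun q hq h => ((hO₀ _ hq.1).2.1 (hB1 q h)).comp q hB.contDiffAt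
    map_G := by
      rintro e ⟨he, heO⟩ hcl
      obtain ⟨h1, h2⟩ := (hW₀ e he).2.2 hcl
      refine ⟨?_, hA0 _ heO h1, ?_⟩
      · change B (A (m.G e)) ∈ O₀ ∩ m.Φ ⁻¹' W₀
        rw [hBA]
        exact ⟨heO, show m.Φ (m.G e) ∈ W₀ by rw [h2]; exact he⟩
      · rw [hBA, h2]
    map_Φ := by
      rintro q ⟨hq, hqW⟩ h
      obtain ⟨h1, h2⟩ := (hO₀ _ hq).2.2.2.1 (hB0 q h)
      refine ⟨⟨hqW, ?_⟩, h1, ?_⟩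
      · rw [Set.mem_preimage, h2]
        exact hq
      · rw [h2, hAB]
    X_mem := by
      rintro q ⟨hq, -⟩ h
      obtain ⟨h1, -, h2⟩ := (hO₀ _ hq).2.2.1 (hB1 q h)
      exact ⟨h1, h2⟩
    G_pos := by
      rintro x hx ⟨hW, hO⟩
      obtain ⟨h1, h2⟩ := (hW₀ _ hW).2.1 x hx rfl
      exact ⟨hA1 _ hO h1, by rw [hBA, h2]⟩ }⟩

end Charts

/-- A family of charts of the closure of the image of `C` under `can`. -/
structure CornerAtlas (n : ℕ) {E F : Type*} [NormedAddCommGroup E] [NormedSpace ℝ E]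
    [NormedAddCommGroup F] [NormedSpace ℝ F] (C : Set F) (can : F → E) where
  chart : ∀ p ∈ closure (can '' C), CornerChart n C can p

namespace CornerAtlas

variable {n : ℕ} {E F : Type*} [NormedAddCommGroup E] [NormedSpace ℝ E]
  [NormedAddCommGroup F] [NormedSpace ℝ F] {C : Set F} {can : F → E} (𝒜 : CornerAtlas n C can)

/-- The closure of the image of `C` under `can`, as a manifold with corners. -/
def Space (_ : CornerAtlas n C can) : Type _ := closure (can '' C)

instance : TopologicalSpace 𝒜.Space := inferInstanceAs (TopologicalSpace (closure (can '' C)))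

instance : T2Space 𝒜.Space := inferInstanceAs (T2Space (closure (can '' C)))

variable {𝒜}

/-- The inclusion. -/
def val (p : 𝒜.Space) : E := Subtype.val p

theorem isEmbedding_val : Topology.IsEmbedding (val : 𝒜.Space → E) :=
  Topology.IsEmbedding.subtypeVal

theorem val_mem (p : 𝒜.Space) : val p ∈ closure (can '' C) := Subtype.prop p

/-- The chart at a point. -/
def at' (p : 𝒜.Space) : CornerChart n C can (val p) := 𝒜.chart (val p) (val_mem p)

theorem G_mem (p : 𝒜.Space) {q : 𝒜.Space} (h : val q ∈ (at' p).W) :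
    (at' p).G (val q) ∈ (at' p).O ∧ (∀ i, 0 ≤ (at' p).G (val q) i) ∧
      (at' p).Φ ((at' p).G (val q)) = val q := (at' p).map_G _ h (val_mem q)

theorem model_symm_val {x : EuclideanSpace ℝ (Fin n)} (hx : ∀ i, 0 ≤ x i) :
    ((cornerModel n).symm x).1 = x :=
  (cornerModel n).right_inv ((range_euclideanQuadrant n).ge hx)

open Classical in
/-- The point of the closure with given image in the vector space, with a default value. -/
def ofVal (p : 𝒜.Space) (x : E) : 𝒜.Space :=
  (if h : x ∈ closure (can '' C) then ⟨x, h⟩ else p : closure (can '' C))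

theorem val_ofVal (p : 𝒜.Space) {x : E} (h : x ∈ closure (can '' C)) : val (ofVal p x) = x :=
  congrArg Subtype.val (dif_pos h)

/-- The chart at a point, as a partial homeomorphism. -/
def toOpenPartialHomeomorph (p : 𝒜.Space) :
    OpenPartialHomeomorph 𝒜.Space (EuclideanQuadrant n) where
  toFun q := (cornerModel n).symm ((at' p).G (val q))
  invFun t := ofVal p ((at' p).Φ t.1)
  source := {q | val q ∈ (at' p).W}
  target := {t | t.1 ∈ (at' p).O}
  map_source' q hq := by
    obtain ⟨h1, h2, -⟩ := G_mem p hq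
    change ((cornerModel n).symm ((at' p).G (val q))).1 ∈ (at' p).O
    rwa [model_symm_val h2]
  map_target' t ht := by
    obtain ⟨h1, h2, -⟩ := (at' p).map_Φ t.1 ht t.2
    change val _ ∈ (at' p).W
    rwa [val_ofVal p h2]
  left_inv' q hq := by
    obtain ⟨-, h2, h3⟩ := G_mem p hq
    apply isEmbedding_val.injective
    rw [model_symm_val h2, h3, val_ofVal p (val_mem q)]
  right_inv' t ht := by
    obtain ⟨-, h2, h3⟩ := (at' p).map_Φ t.1 ht t.2
    apply Subtype.ext
    rw [val_ofVal p h2, h3, model_symm_val t.2]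
  open_source := (at' p).isOpen_W.preimage isEmbedding_val.continuous
  open_target := (at' p).isOpen_O.preimage continuous_subtype_val
  continuousOn_toFun := (cornerModel n).continuous_symm.comp_continuousOn
    ((at' p).contDiffOn_G.continuousOn.comp isEmbedding_val.continuous.continuousOn fun _ h => h)
  continuousOn_invFun := by
    rw [isEmbedding_val.isInducing.continuousOn_iff]
    refine ContinuousOn.congr (f := fun t : EuclideanQuadrant n => (at' p).Φ t.1)
      ((at' p).contDiffOn_Φ.continuousOn.comp continuous_subtype_val.continuousOn fun _ h => h) ?_
    intro t ht
    obtain ⟨-, h2, -⟩ := (at' p).map_Φ t.1 ht t.2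
    exact val_ofVal p h2

instance : ChartedSpace (EuclideanQuadrant n) 𝒜.Space where
  atlas := Set.range toOpenPartialHomeomorph
  chartAt := toOpenPartialHomeomorph
  mem_chart_source p := (at' p).mem_W
  chart_mem_atlas p := ⟨p, rfl⟩

theorem val_symm (p : 𝒜.Space) {t : EuclideanSpace ℝ (Fin n)} (ht : t ∈ (at' p).O)
    (h0 : ∀ i, 0 ≤ t i) :
    val ((toOpenPartialHomeomorph p).symm ((cornerModel n).symm t)) = (at' p).Φ t := by
  change val (ofVal p ((at' p).Φ ((cornerModel n).symm t).1)) = _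
  rw [model_symm_val h0, val_ofVal p ((at' p).map_Φ t ht h0).2.1]

instance : IsManifold (cornerModel n) ∞ 𝒜.Space := by
  refine isManifold_of_contDiffOn _ _ _ ?_
  rintro _ _ ⟨p, rfl⟩ ⟨q, rfl⟩
  refine ContDiffOn.congr (f := fun t => (at' q).G ((at' p).Φ t)) ?_ ?_
  · refine (at' q).contDiffOn_G.comp ((at' p).contDiffOn_Φ.mono ?_) ?_
    · rintro t ⟨⟨ht, -⟩, ht'⟩
      change ((cornerModel n).symm t).1 ∈ (at' p).O at ht
      rwa [model_symm_val ((range_euclideanQuadrant n).le ht')] at ht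
    · rintro t ⟨⟨ht, htq⟩, ht'⟩
      have h0 := (range_euclideanQuadrant n).le ht'
      change ((cornerModel n).symm t).1 ∈ (at' p).O at ht
      rw [model_symm_val h0] at ht
      change val ((toOpenPartialHomeomorph p).symm ((cornerModel n).symm t)) ∈ (at' q).W at htq
      rwa [val_symm p ht h0] at htq
  · rintro t ⟨⟨ht, htq⟩, ht'⟩
    have h0 := (range_euclideanQuadrant n).le ht'
    change ((cornerModel n).symm t).1 ∈ (at' p).O at ht
    rw [model_symm_val h0] at ht
    change val ((toOpenPartialHomeomorph p).symm ((cornerModel n).symm t)) ∈ (at' q).W at htq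
    change ((cornerModel n).symm ((at' q).G (val ((toOpenPartialHomeomorph p).symm
      ((cornerModel n).symm t))))).1 = _
    rw [model_symm_val (G_mem q htq).2.1, val_symm p ht h0]

theorem extChartAt_apply (p : 𝒜.Space) {q : 𝒜.Space} (h : val q ∈ (at' p).W) :
    extChartAt (cornerModel n) p q = (at' p).G (val q) :=
  model_symm_val (G_mem p h).2.1

theorem val_extChartAt_symm (p : 𝒜.Space) {t : EuclideanSpace ℝ (Fin n)} (ht : t ∈ (at' p).O)
    (h0 : ∀ i, 0 ≤ t i) : val ((extChartAt (cornerModel n) p).symm t) = (at' p).Φ t :=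
  val_symm p ht h0

theorem G_self_mem (p : 𝒜.Space) : (at' p).G (val p) ∈ (at' p).O := (G_mem p (at' p).mem_W).1

theorem eventually_mem_O (p : 𝒜.Space) : ∀ᶠ t in 𝓝[Set.range (cornerModel n)] ((at' p).G (val p)),
    t ∈ (at' p).O ∧ ∀ i, 0 ≤ t i := by
  filter_upwards [mem_nhdsWithin_of_mem_nhds ((at' p).isOpen_O.mem_nhds (G_self_mem p)),
    self_mem_nhdsWithin] with t h1 h2 using ⟨h1, (range_euclideanQuadrant n).le h2⟩

/-- A function which is smooth in the chart at `p` is smooth, and its derivative is computed in the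
chart. -/
theorem contMDiffAt_of_chart {F' : Type*} [NormedAddCommGroup F'] [NormedSpace ℝ F']
    {p : 𝒜.Space} {f : 𝒜.Space → F'} {h : EuclideanSpace ℝ (Fin n) → F'}
    (hh : ContDiffAt ℝ ∞ h ((at' p).G (val p)))
    (hf : ∀ᶠ t in 𝓝[Set.range (cornerModel n)] ((at' p).G (val p)),
      f ((extChartAt (cornerModel n) p).symm t) = h t) :
    ContMDiffAt (cornerModel n) 𝓘(ℝ, F') ∞ f p ∧
      mfderiv (cornerModel n) 𝓘(ℝ, F') f p = fderiv ℝ h ((at' p).G (val p)) := by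
  have hp := extChartAt_apply p (at' p).mem_W
  have hmem : (at' p).G (val p) ∈ Set.range (cornerModel n) :=
    (range_euclideanQuadrant n).ge (G_mem p (at' p).mem_W).2.1
  have hc : ContinuousAt f p := by
    have h1 : ContinuousAt (fun q => h (extChartAt (cornerModel n) p q)) p :=
      ContinuousAt.comp (g := h) (by rw [hp]; exact hh.continuousAt) (continuousAt_extChartAt p)
    refine h1.congr ?_
    have h2 : Filter.Tendsto (extChartAt (cornerModel n) p) (𝓝 p)
        (𝓝[Set.range (cornerModel n)] ((at' p).G (val p))) := by
      rw [← hp]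
      exact tendsto_nhdsWithin_iff.2 ⟨continuousAt_extChartAt p,
        Filter.Eventually.of_forall fun q => Set.mem_range_self _⟩
    filter_upwards [h2.eventually hf, extChartAt_source_mem_nhds (I := cornerModel n) p]
      with q hq hqs
    rw [← hq, (extChartAt (cornerModel n) p).left_inv hqs]
  have hd : ContMDiffAt (cornerModel n) 𝓘(ℝ, F') ∞ f p := by
    rw [contMDiffAt_iff]
    refine ⟨hc, ?_⟩
    rw [hp]
    refine hh.contDiffWithinAt.congr_of_eventuallyEq ?_ ?_
    · filter_upwards [hf] with t ht
      exact ht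
    · exact hf.self_of_nhdsWithin hmem
  refine ⟨hd, ?_⟩
  rw [(hd.mdifferentiableAt (by simp)).mfderiv, hp,
    ← fderivWithin_eq_fderiv ((cornerModel n).uniqueDiffOn _ hmem) (hh.differentiableAt (by simp))]
  refine Filter.EventuallyEq.fderivWithin_eq ?_ ?_
  · filter_upwards [hf] with t ht
    exact ht
  · exact hf.self_of_nhdsWithin hmem

theorem contDiffAt_Φ (p : 𝒜.Space) : ContDiffAt ℝ ∞ (at' p).Φ ((at' p).G (val p)) :=
  (at' p).contDiffOn_Φ.contDiffAt ((at' p).isOpen_O.mem_nhds (G_self_mem p))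

theorem val_chart (p : 𝒜.Space) :
    ∀ᶠ t in 𝓝[Set.range (cornerModel n)] ((at' p).G (val p)),
      val ((extChartAt (cornerModel n) p).symm t) = (at' p).Φ t := by
  filter_upwards [eventually_mem_O p] with t ht using val_extChartAt_symm p ht.1 ht.2

theorem contMDiff_val : ContMDiff (cornerModel n) 𝓘(ℝ, E) ∞ (val : 𝒜.Space → E) := fun p =>
  (contMDiffAt_of_chart (contDiffAt_Φ p) (val_chart p)).1

theorem contDiffAt_G (p : 𝒜.Space) : ContDiffAt ℝ ∞ (at' p).G (val p) :=
  (at' p).contDiffOn_G.contDiffAt ((at' p).isOpen_W.mem_nhds (at' p).mem_W)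

/-- The inclusion is an immersion. -/
theorem injective_mfderiv_val (p : 𝒜.Space) :
    Function.Injective (mfderiv (cornerModel n) 𝓘(ℝ, E) (val : 𝒜.Space → E) p) := by
  rw [(contMDiffAt_of_chart (contDiffAt_Φ p) (val_chart p)).2]
  have hmem : (at' p).G (val p) ∈ Set.range (cornerModel n) :=
    (range_euclideanQuadrant n).ge (G_mem p (at' p).mem_W).2.1
  have h1 :=
    ((contDiffAt_Φ p).differentiableAt (by simp)).hasFDerivAt
  have h2 : HasFDerivAt (at' p).G (fderiv ℝ (at' p).G (val p)) ((at' p).Φ ((at' p).G (val p))) := by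
    rw [(G_mem p (at' p).mem_W).2.2]
    exact ((contDiffAt_G p).differentiableAt (by simp)).hasFDerivAt
  have h3 := (h2.comp _ h1).hasFDerivWithinAt (s := Set.range (cornerModel n))
  have h4 : HasFDerivWithinAt ((at' p).G ∘ (at' p).Φ)
      (ContinuousLinearMap.id ℝ (EuclideanSpace ℝ (Fin n)))
      (Set.range (cornerModel n)) ((at' p).G (val p)) := by
    refine (hasFDerivWithinAt_id _ _).congr_of_eventuallyEq ?_ ?_
    · filter_upwards [eventually_mem_O p] with t ht
      exact ((at' p).map_Φ t ht.1 ht.2).2.2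
    · exact ((at' p).map_Φ _ (G_self_mem p) (G_mem p (at' p).mem_W).2.1).2.2
  have h5 := ((cornerModel n).uniqueDiffOn _ hmem).eq h3 h4
  exact Function.LeftInverse.injective fun ξ => DFunLike.congr_fun h5 ξ

theorem isInteriorPoint_iff (p : 𝒜.Space) :
    (cornerModel n).IsInteriorPoint p ↔ ∀ i, 0 < (at' p).G (val p) i := by
  have h1 : interior (Set.range (cornerModel n)) = {y | ∀ i, 0 < y i} := by
    rw [show Set.range (cornerModel n) = _ from range_euclideanQuadrant n,
      interior_euclideanQuadrant]
  rw [ModelWithCorners.IsInteriorPoint, h1, extChartAt_apply p (at' p).mem_W]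
  rfl

theorem isInteriorPoint_iff_mem (p : 𝒜.Space) :
    (cornerModel n).IsInteriorPoint p ↔ val p ∈ can '' C := by
  rw [isInteriorPoint_iff]
  constructor
  · intro h
    obtain ⟨h1, h2⟩ := (at' p).X_mem _ (G_self_mem p) h
    exact ⟨_, h1, h2.trans (G_mem p (at' p).mem_W).2.2⟩
  · rintro ⟨x, hx, hxp⟩
    have h1 : can x ∈ (at' p).W := Set.mem_of_eq_of_mem hxp (at' p).mem_W
    have := ((at' p).G_pos x hx h1).1
    rwa [hxp] at this

variable (𝒜) in
/-- The map of `C` to the closure of its image. -/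
def incl (x : C) : 𝒜.Space := ⟨can x, subset_closure ⟨x, x.2, rfl⟩⟩

theorem eq_X (x : C) : (at' (𝒜.incl x)).X ((at' (𝒜.incl x)).G (can x)) = x :=
  ((at' (𝒜.incl x)).G_pos x x.2 (at' (𝒜.incl x)).mem_W).2

theorem incl_injective : Function.Injective 𝒜.incl := by
  intro x y h
  have h1 : can y = can x := congrArg val h.symm
  have h2 := (at' (𝒜.incl x)).G_pos y y.2 (by rw [h1]; exact (at' (𝒜.incl x)).mem_W)
  rw [h1, eq_X] at h2
  exact Subtype.ext h2.2

theorem contDiffAt_X_incl (x : C) :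
    ContDiffAt ℝ ∞ (at' (𝒜.incl x)).X ((at' (𝒜.incl x)).G (can x)) :=
  (at' (𝒜.incl x)).contDiffAt_X _ (G_self_mem _)
    ((at' (𝒜.incl x)).G_pos x x.2 (at' (𝒜.incl x)).mem_W).1

theorem isEmbedding_incl (hcan : ∀ x ∈ C, ContDiffAt ℝ ∞ can x) :
    Topology.IsEmbedding 𝒜.incl := by
  refine ⟨?_, incl_injective⟩
  refine Topology.isInducing_iff_nhds.2 fun x => le_antisymm ?_ ?_
  · refine Filter.tendsto_iff_comap.1 ?_
    change ContinuousAt 𝒜.incl x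
    rw [isEmbedding_val.isInducing.continuousAt_iff]
    exact (hcan x x.2).continuousAt.comp continuousAt_subtype_val
  · have h1 : ContinuousAt (fun e => (at' (𝒜.incl x)).X ((at' (𝒜.incl x)).G e)) (can x) :=
      ContinuousAt.comp (f := (at' (𝒜.incl x)).G) (contDiffAt_X_incl x).continuousAt
        (contDiffAt_G (𝒜.incl x)).continuousAt
    have h2 : ContinuousAt (fun q : 𝒜.Space => (at' (𝒜.incl x)).X ((at' (𝒜.incl x)).G (val q)))
        (𝒜.incl x) := ContinuousAt.comp (f := val)
        (g := fun e => (at' (𝒜.incl x)).X ((at' (𝒜.incl x)).G e)) h1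
        isEmbedding_val.continuous.continuousAt
    rw [nhds_subtype]
    rintro N ⟨N', hN', hN⟩
    rw [← eq_X (𝒜 := 𝒜) x] at hN'
    refine ⟨_, Filter.inter_mem (h2 hN') (((at' (𝒜.incl x)).isOpen_W.preimage
      isEmbedding_val.continuous).mem_nhds (at' (𝒜.incl x)).mem_W), ?_⟩
    rintro y ⟨hy1, hy2⟩
    refine hN ?_
    have h3 : (at' (𝒜.incl x)).X ((at' (𝒜.incl x)).G (can y)) ∈ N' := hy1
    rwa [((at' (𝒜.incl x)).G_pos y y.2 hy2).2] at h3

open Classical in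
/-- The inverse of `incl`, extended by zero. -/
def back (p : 𝒜.Space) : F := if h : ∃ x : C, 𝒜.incl x = p then h.choose else 0

theorem back_incl (x : C) : back (𝒜.incl x) = x := by
  have h : ∃ y : C, 𝒜.incl y = 𝒜.incl x := ⟨x, rfl⟩
  rw [back, dif_pos h, incl_injective h.choose_spec]

theorem back_chart (x : C) : ∀ᶠ t in 𝓝 ((at' (𝒜.incl x)).G (can x)),
    (can ((at' (𝒜.incl x)).X t) = (at' (𝒜.incl x)).Φ t ∧
      (at' (𝒜.incl x)).G ((at' (𝒜.incl x)).Φ t) = t) ∧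
    back ((extChartAt (cornerModel n) (𝒜.incl x)).symm t) = (at' (𝒜.incl x)).X t := by
  have h1 : IsOpen {t : EuclideanSpace ℝ (Fin n) | ∀ i, 0 < t i} := by
    simp only [Set.ofPred_forall]
    exact isOpen_iInter_of_finite fun i => isOpen_lt continuous_const (by fun_prop)
  filter_upwards [h1.mem_nhds ((at' (𝒜.incl x)).G_pos x x.2 (at' (𝒜.incl x)).mem_W).1,
    (at' (𝒜.incl x)).isOpen_O.mem_nhds (G_self_mem _)] with t ht htO
  obtain ⟨h2, h3⟩ := (at' (𝒜.incl x)).X_mem t htO ht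
  refine ⟨⟨h3, ((at' (𝒜.incl x)).map_Φ t htO fun i => (ht i).le).2.2⟩, ?_⟩
  have h4 : (extChartAt (cornerModel n) (𝒜.incl x)).symm t = 𝒜.incl ⟨_, h2⟩ := by
    apply isEmbedding_val.injective
    rw [val_extChartAt_symm _ htO fun i => (ht i).le]
    exact h3.symm
  rw [h4, back_incl]

theorem isCornerCompactification (hK : IsCompact (closure (can '' C)))
    (hcan : ∀ x ∈ C, ContDiffAt ℝ ∞ can x) : IsCornerCompactification n C 𝒜.Space 𝒜.incl where
  isManifold := inferInstance
  compactSpace := isCompact_iff_compactSpace.1 hK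
  t2Space := inferInstance
  isEmbedding := isEmbedding_incl hcan
  range_eq := by
    ext p
    change _ ↔ (cornerModel n).IsInteriorPoint p
    rw [isInteriorPoint_iff_mem]
    constructor
    · rintro ⟨x, rfl⟩
      exact ⟨x, x.2, rfl⟩
    · rintro ⟨x, hx, hxp⟩
      exact ⟨⟨x, hx⟩, isEmbedding_val.injective hxp⟩
  denseRange := by
    intro p
    rw [isEmbedding_val.isInducing.closure_eq_preimage_closure_image, Set.mem_preimage]
    refine closure_mono ?_ (val_mem p)
    rintro _ ⟨x, hx, rfl⟩
    exact ⟨_, ⟨⟨x, hx⟩, rfl⟩, rfl⟩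
  diffeo := by
    refine ⟨back, back_incl, fun p hp => ?_⟩
    obtain ⟨x, hx, hxp⟩ := (isInteriorPoint_iff_mem p).1 hp
    obtain rfl : 𝒜.incl ⟨x, hx⟩ = p := isEmbedding_val.injective hxp
    have h1 := contMDiffAt_of_chart (f := back) (contDiffAt_X_incl (𝒜 := 𝒜) ⟨x, hx⟩)
      (mem_nhdsWithin_of_mem_nhds ((back_chart ⟨x, hx⟩).mono fun t ht => ht.2))
    refine ⟨h1.1, ?_⟩
    rw [h1.2]
    set c := at' (𝒜.incl ⟨x, hx⟩)
    have h2 : HasFDerivAt c.X (fderiv ℝ c.X (c.G (can x))) (c.G (can x)) :=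
      ((contDiffAt_X_incl (𝒜 := 𝒜) ⟨x, hx⟩).differentiableAt (by simp)).hasFDerivAt
    have hX : c.X (c.G (can x)) = x := eq_X ⟨x, hx⟩
    have h3 : HasFDerivAt can (fderiv ℝ can x) (c.X (c.G (can x))) := by
      rw [hX]
      exact ((hcan x hx).differentiableAt (by simp)).hasFDerivAt
    have h4 : HasFDerivAt c.G (fderiv ℝ c.G (can x)) (can (c.X (c.G (can x)))) := by
      rw [hX]
      exact ((contDiffAt_G (𝒜.incl ⟨x, hx⟩)).differentiableAt (by simp)).hasFDerivAt
    have h5 := HasFDerivAt.comp (c.G (can x)) (f := can ∘ c.X) h4 (h3.comp _ h2)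
    have h6 : HasFDerivAt (c.G ∘ can ∘ c.X)
        (ContinuousLinearMap.id ℝ (EuclideanSpace ℝ (Fin n))) (c.G (can x)) := by
      refine (hasFDerivAt_id _).congr_of_eventuallyEq ?_
      filter_upwards [back_chart ⟨x, hx⟩] with t ht
      change c.G (can (c.X t)) = t
      rw [ht.1.1, ht.1.2]
    have h7 := h5.unique h6
    refine Function.Injective.of_comp (f := fun ξ : F => fderiv ℝ c.G (can x)
      (fderiv ℝ can x ξ)) ?_
    exact Function.LeftInverse.injective (g := id) fun ξ => DFunLike.congr_fun h7 ξ

end CornerAtlas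

/-! ### The compactification of the configuration space -/

namespace CornerAtlas

variable {n : ℕ} {E F : Type*} [NormedAddCommGroup E] [NormedSpace ℝ E]
  [NormedAddCommGroup F] [NormedSpace ℝ F] {C : Set F} {can : F → E} {𝒜 : CornerAtlas n C can}

theorem mfderiv_clm_val {F' : Type*} [NormedAddCommGroup F'] [NormedSpace ℝ F'] (ℓ : E →L[ℝ] F')
    (p : 𝒜.Space) (ξ : TangentSpace (cornerModel n) p) :
    mfderiv (cornerModel n) 𝓘(ℝ, F') (fun q : 𝒜.Space => ℓ (val q)) p ξ =
      ℓ (mfderiv (cornerModel n) 𝓘(ℝ, E) (val : 𝒜.Space → E) p ξ) := by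
  have h1 := (contMDiffAt_of_chart (contDiffAt_Φ p) (val_chart p)).2
  have h2 := (contMDiffAt_of_chart (f := fun q : 𝒜.Space => ℓ (val q))
    (h := fun t => ℓ ((at' p).Φ t)) (ℓ.contDiff.contDiffAt.comp _ (contDiffAt_Φ p))
    ((val_chart p).mono fun t ht => congrArg ℓ ht)).2
  have h3 : HasFDerivAt (fun t => ℓ ((at' p).Φ t)) _ _ := ℓ.hasFDerivAt.comp ((at' p).G (val p))
    ((contDiffAt_Φ p).differentiableAt (by simp)).hasFDerivAt
  rw [h3.fderiv] at h2
  rw [h1, h2]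
  rfl

end CornerAtlas

namespace Diagram

variable {U : Type v} {T : Type w} {M : Type u}
  [TopologicalSpace M] [ChartedSpace (EuclideanHalfSpace 1) M] [Fintype U] [Fintype T]
  {Γ : Diagram U T M} {L : M → E3}

section Direction

open Classical in
/-- The ends of the edge `e`. -/
def ends (o : Γ.EdgeOrientation) (e : Γ.graph.edgeSet) : Finset (U ⊕ T) := {o.tail e, o.head e}

theorem adj_ends (o : Γ.EdgeOrientation) (e : Γ.graph.edgeSet) :
    Γ.graph.Adj (o.tail e) (o.head e) := by
  have h := e.2
  rw [← o.edge_eq e] at h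
  exact h

theorem isConnSet_ends (o : Γ.EdgeOrientation) (e : Γ.graph.edgeSet) :
    IsConnSet Γ.fullGraph (ends o e) := by
  classical
  have h := IsConnSet.pair (fullGraph_adj.2 (Or.inl (adj_ends o e)))
  unfold ends
  convert h

theorem tail_mem_ends (o : Γ.EdgeOrientation) (e : Γ.graph.edgeSet) : o.tail e ∈ ends o e := by
  simp [ends]

theorem head_mem_ends (o : Γ.EdgeOrientation) (e : Γ.graph.edgeSet) : o.head e ∈ ends o e := by
  simp [ends]

/-- The vector along an edge, in the shape of the pair of its ends. -/
def edgeVector (o : Γ.EdgeOrientation) (e : Γ.graph.edgeSet) (q : Γ.Ambient) : E3 :=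
  shape q (ends o e) (o.head e) - shape q (ends o e) (o.tail e)

/-- The direction of an edge, as a function on the ambient space. -/
def limitDirection (o : Γ.EdgeOrientation) (e : Γ.graph.edgeSet) (q : Γ.Ambient) : E3 :=
  ‖edgeVector o e q‖⁻¹ • edgeVector o e q

variable (o : Γ.EdgeOrientation) (e : Γ.graph.edgeSet)

theorem contDiff_edgeVector : ContDiff ℝ ∞ (edgeVector o e) :=
  (contDiff_shape _ _).sub (contDiff_shape _ _)

theorem contDiffAt_limitDirection {q : Γ.Ambient} (h : edgeVector o e q ≠ 0) :
    ContDiffAt ℝ ∞ (limitDirection o e) q :=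
  (((contDiff_edgeVector o e).contDiffAt.norm ℝ h).inv (norm_ne_zero_iff.2 h)).smul
    (contDiff_edgeVector o e).contDiffAt

theorem edgeVector_ne {q : Γ.Ambient} (hq : IsLimitShape Γ L q) : edgeVector o e q ≠ 0 := by
  obtain ⟨v, hv, w, hw, hvw⟩ := exists_shape_ne hq (isConnSet_ends o e)
  simp only [ends, Finset.mem_insert, Finset.mem_singleton] at hv hw
  rw [edgeVector, sub_ne_zero]
  rcases hv with rfl | rfl <;> rcases hw with rfl | rfl
  · exact absurd rfl hvw
  · exact hvw.symm
  · exact hvw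
  · exact absurd rfl hvw

theorem limitDirection_canon (hL : Function.Injective L) {x : U ⊕ T → E3}
    (hx : x ∈ Γ.configSpace L) : limitDirection o e (Γ.canon x) = directionMap o x e := by
  have hs := inv_pos.2 (size_pos (IsConnSet.exists_ne hL hx (isConnSet_ends o e)))
  rw [limitDirection, edgeVector, shape_canon_sub x (isConnSet_ends o e) (head_mem_ends o e)
    (tail_mem_ends o e), directionMap, norm_smul, Real.norm_of_nonneg hs.le, smul_smul, mul_inv,
    mul_right_comm, inv_mul_cancel₀ hs.ne', one_mul]

end Direction

variable [CompactSpace M] [IsManifold (𝓡∂ 1) ∞ M]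
  (hL : Manifold.IsSmoothEmbedding (𝓡∂ 1) 𝓘(ℝ, E3) ∞ L)
include hL

theorem nonempty_cornerAtlas :
    Nonempty (CornerAtlas (Fintype.card U + 3 * Fintype.card T) (Γ.configSpace L) Γ.canon) := by
  have hcard : Fintype.card (Idx U T) = Fintype.card U + 3 * Fintype.card T := by
    simp [mul_comm]
  exact ⟨⟨fun p hp => ((nonempty_localModel hL hp).some.nonempty_cornerChart
    (Fintype.equivFinOfCardEq hcard) hp).some⟩⟩

section Compactification

open CornerAtlas

variable {n : ℕ} {𝒜 : CornerAtlas n (Γ.configSpace L) Γ.canon}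

theorem isLimitShape_val (p : 𝒜.Space) : IsLimitShape Γ L (val p) :=
  isLimitShape_of_mem hL.isEmbedding.injective hL.isEmbedding.continuous (val_mem p)

variable (𝒜) in
/-- The canonical map of the compactification. -/
def canonicalMap (p : 𝒜.Space) : Γ.SphereProduct × (U → M) :=
  (fun A => ⟨(val p).1 A, (isLimitShape_val hL p).sphere A⟩,
    fun a => ((isLimitShape_val hL p).pos_mem a).choose)

theorem L_canonicalMap (p : 𝒜.Space) (a : U) : L ((canonicalMap hL 𝒜 p).2 a) = (val p).2.1 a :=
  ((isLimitShape_val hL p).pos_mem a).choose_spec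

theorem continuous_canonicalMap : Continuous (canonicalMap hL 𝒜) := by
  have hv : Continuous (val : 𝒜.Space → Γ.Ambient) := isEmbedding_val.continuous
  refine Continuous.prodMk (continuous_pi fun A => ?_) (continuous_pi fun a => ?_)
  · exact Continuous.subtype_mk ((continuous_apply A).comp (continuous_fst.comp hv)) _
  · rw [hL.isEmbedding.isInducing.continuous_iff]
    exact (((contDiff_pos a).continuous).comp hv).congr fun p => (L_canonicalMap hL p a).symm

theorem contMDiff_canonicalMap_snd (a : U) :
    ContMDiff (cornerModel n) (𝓡∂ 1) ∞ (fun p : 𝒜.Space => (canonicalMap hL 𝒜 p).2 a) := by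
  intro p
  rw [ContMDiffAt.iff_comp_isImmersionAt (hL.isImmersion.isImmersionAt _)]
  refine ⟨((continuous_apply a).comp (continuous_snd.comp
    (continuous_canonicalMap hL))).continuousAt, ?_⟩
  refine ContMDiffAt.congr_of_eventuallyEq (f := fun p : 𝒜.Space => (val p).2.1 a)
    ((contDiff_pos a).contMDiff.comp contMDiff_val p) (Filter.Eventually.of_forall fun q => ?_)
  exact L_canonicalMap hL q a

/-- The evaluation of the shape of `A`. -/
def shapeCLM (Γ : Diagram U T M) (A : Γ.ConnectedSets) : Γ.Ambient →L[ℝ] (A.1 → E3) :=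
  (ContinuousLinearMap.proj A).comp (ContinuousLinearMap.fst ℝ _ _)

/-- The evaluation of the position of `a`. -/
def posCLM (Γ : Diagram U T M) (a : U) : Γ.Ambient →L[ℝ] E3 :=
  (ContinuousLinearMap.proj a).comp
    ((ContinuousLinearMap.fst ℝ _ _).comp (ContinuousLinearMap.snd ℝ _ _))

theorem isImage_canonicalMap (x : Γ.configSpace L) :
    Γ.IsImage L x.1 (canonicalMap hL 𝒜 (𝒜.incl x)) :=
  ⟨fun A => transDil_nrm (IsConnSet.exists_ne hL.isEmbedding.injective x.2 A.2),
    fun a => L_canonicalMap hL _ a⟩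

theorem isClosureMap [T2Space M] : Γ.IsClosureMap L n 𝒜.incl (canonicalMap hL 𝒜) where
  smooth_left A := (shapeCLM Γ A).contMDiff.comp contMDiff_val
  smooth_right a := contMDiff_canonicalMap_snd hL a
  extends_canonical x := isImage_canonicalMap hL x
  range_eq := by
    have hcan : ∀ x ∈ Γ.configSpace L, ContDiffAt ℝ ∞ Γ.canon x :=
      fun x hx => contDiffAt_canon hL.isEmbedding.injective hx
    have hcc := isCornerCompactification (𝒜 := 𝒜)
      (isCompact_compactification hL.isEmbedding.injective hL.isEmbedding.continuous) hcan
    have := hcc.compactSpace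
    have himg : {p | ∃ x ∈ Γ.configSpace L, Γ.IsImage L x p} =
        canonicalMap hL 𝒜 '' Set.range 𝒜.incl := by
      ext q
      constructor
      · rintro ⟨x, hx, h1, h2⟩
        refine ⟨_, ⟨⟨x, hx⟩, rfl⟩, ?_⟩
        obtain ⟨h3, h4⟩ := isImage_canonicalMap (𝒜 := 𝒜) hL ⟨x, hx⟩
        refine Prod.ext (funext fun A => Subtype.ext ?_) (funext fun a => ?_)
        · rw [eq_nrm_of_transDil (h1 A), eq_nrm_of_transDil (h3 A)]
        · exact hL.isEmbedding.injective ((h4 a).trans (h2 a).symm)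
      · rintro ⟨_, ⟨x, rfl⟩, rfl⟩
        exact ⟨x, x.2, isImage_canonicalMap hL x⟩
    have hcl : closure (canonicalMap hL 𝒜 '' Set.range 𝒜.incl) =
        Set.range (canonicalMap hL 𝒜) := by
      refine subset_antisymm (closure_minimal (Set.image_subset_range _ _)
        (isCompact_range (continuous_canonicalMap hL)).isClosed) ?_
      exact (continuous_canonicalMap hL).range_subset_closure_image_dense hcc.denseRange
    rw [closedConfigSpace, himg, hcl]
    refine (Set.inter_eq_left.2 ?_).symm
    rintro _ ⟨p, rfl⟩ A B h
    have hr := (isLimitShape_val hL p).restrict A B h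
    by_cases h0 : size (fun a : A.1 => (val p).1 B ⟨a, h a.2⟩) = 0
    · exact Or.inl ⟨_, fun a => eq_mean_of_size_eq_zero h0 a⟩
    · exact Or.inr ⟨_, lt_of_le_of_ne (size_nonneg _) (Ne.symm h0), _, fun a =>
        sub_eq_iff_eq_add.1 (hr a)⟩

theorem isImmersedEmbedding [T2Space M] (hU : Fintype.card U ≠ 1) :
    Γ.IsImmersedEmbedding n (canonicalMap hL 𝒜) where
  isEmbedding := by
    have : CompactSpace 𝒜.Space := isCompact_iff_compactSpace.1
      (isCompact_compactification hL.isEmbedding.injective hL.isEmbedding.continuous)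
    refine ((continuous_canonicalMap hL).isClosedEmbedding fun p q h => ?_).isEmbedding
    refine isEmbedding_val.injective (Prod.ext (funext fun A => ?_) (Prod.ext (funext fun a => ?_)
      (ULift.ext _ _ ?_)))
    · exact congrArg (fun k : Γ.SphereProduct × (U → M) => (k.1 A).1) h
    · rw [← L_canonicalMap hL p, ← L_canonicalMap hL q, h]
    · rw [(isLimitShape_val hL p).scale_eq hU, (isLimitShape_val hL q).scale_eq hU]
  immersion := by
    intro p ξ h1 h2
    apply injective_mfderiv_val p
    rw [map_zero]
    refine Prod.ext (funext fun A => ?_) (Prod.ext (funext fun a => ?_) ?_)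
    · exact (mfderiv_clm_val (shapeCLM Γ A) p ξ).symm.trans (h1 A)
    · refine (mfderiv_clm_val (posCLM Γ a) p ξ).symm.trans ?_
      have h3 : (fun q : 𝒜.Space => posCLM Γ a (val q)) =
          L ∘ fun q => (canonicalMap hL 𝒜 q).2 a := funext fun q => (L_canonicalMap hL q a).symm
      rw [h3, mfderiv_comp p (I' := 𝓡∂ 1) (hL.contMDiff.mdifferentiable (by simp) _)
        ((contMDiff_canonicalMap_snd hL a).mdifferentiable (by simp) p)]
      have h4 := congrArg (mfderiv (𝓡∂ 1) 𝓘(ℝ, E3) L ((canonicalMap hL 𝒜 p).2 a)) (h2 a)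
      exact h4.trans (map_zero (mfderiv (𝓡∂ 1) 𝓘(ℝ, E3) L ((canonicalMap hL 𝒜 p).2 a)))
    · refine (mfderiv_clm_val ((ContinuousLinearMap.snd ℝ _ _).comp
        (ContinuousLinearMap.snd ℝ _ _) : Γ.Ambient →L[ℝ] ULift.{u} ℝ) p ξ).symm.trans ?_
      have h3 : (fun q : 𝒜.Space => ((ContinuousLinearMap.snd ℝ _ _).comp
          (ContinuousLinearMap.snd ℝ _ _) : Γ.Ambient →L[ℝ] ULift.{u} ℝ) (val q)) =
          fun _ => 0 := funext fun q => ULift.ext _ _ ((isLimitShape_val hL q).scale_eq hU)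
      rw [h3, mfderiv_const]
      rfl

variable (𝒜) in
/-- The extension of the direction map to the compactification. -/
theorem exists_direction (o : Γ.EdgeOrientation) : ∃ Ψ : 𝒜.Space → Γ.graph.edgeSet → S2,
    (∀ (x : Γ.configSpace L) (e : Γ.graph.edgeSet),
      (Ψ (𝒜.incl x) e : E3) = directionMap o x.1 e) ∧
    ∀ e : Γ.graph.edgeSet, ContMDiff (cornerModel n) (𝓡 2) ∞ (fun p => Ψ p e) := by
  have hne : ∀ e (p : 𝒜.Space), edgeVector o e (val p) ≠ 0 :=
    fun e p => edgeVector_ne o e (isLimitShape_val hL p)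
  have hmem : ∀ e (p : 𝒜.Space), limitDirection o e (val p) ∈ Metric.sphere (0 : E3) 1 := by
    intro e p
    rw [mem_sphere_zero_iff_norm, limitDirection, norm_smul, norm_inv, norm_norm,
      inv_mul_cancel₀ (norm_ne_zero_iff.2 (hne e p))]
  have : Fact (Module.finrank ℝ E3 = 2 + 1) := ⟨by simp⟩
  refine ⟨fun p e => ⟨limitDirection o e (val p), hmem e p⟩, fun x e => ?_, fun e => ?_⟩
  · exact limitDirection_canon o e hL.isEmbedding.injective x.2
  · refine ContMDiff.codRestrict_sphere (f := fun p : 𝒜.Space => limitDirection o e (val p)) ?_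
      (hmem e)
    intro p
    exact (contDiffAt_limitDirection o e (hne e p)).contMDiffAt.comp p (contMDiff_val p)

end Compactification

end Diagram

/-! ### Arc length and product measures -/

section ArcLength

open scoped ENNReal NNReal

theorem measure_pi_mono {ι : Type*} [Fintype ι] {α : ι → Type*} [∀ i, MeasurableSpace (α i)]
    {μ ν : ∀ i, Measure (α i)} (h : ∀ i, μ i ≤ ν i) : Measure.pi μ ≤ Measure.pi ν := by
  refine Measure.le_iff.2 fun A hA => ?_
  rw [Measure.pi, Measure.pi, toMeasure_apply _ _ hA, toMeasure_apply _ _ hA]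
  have h1 : OuterMeasure.pi (fun i => (μ i).toOuterMeasure) ≤
      OuterMeasure.pi (fun i => (ν i).toOuterMeasure) :=
    OuterMeasure.le_pi.2 fun s _ => (OuterMeasure.pi_pi_le _ s).trans
      (Finset.prod_le_prod' fun i _ => h i (s i))
  exact h1 A

theorem measurePreserving_uncurry (T : Type*) [Fintype T] (n : ℕ) :
    MeasurePreserving (Function.uncurry : (T → Fin n → ℝ) → T × Fin n → ℝ) volume volume := by
  refine ⟨measurable_uncurry, (Measure.pi_eq fun s hs => ?_).symm⟩
  rw [Measure.map_apply measurable_uncurry (MeasurableSet.univ_pi hs)]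
  have h : (Function.uncurry : (T → Fin n → ℝ) → T × Fin n → ℝ) ⁻¹' Set.univ.pi s =
      Set.univ.pi fun t => Set.univ.pi fun l => s (t, l) := by
    ext f
    simp [Set.mem_pi, Prod.forall]
  rw [h, volume_pi_pi, Fintype.prod_prod_type]
  exact Finset.prod_congr rfl fun t _ => volume_pi_pi _

/-- The length of a curve is at most its Lipschitz constant times the length of the interval. -/
theorem hausdorffMeasure_restrict_image_le {ℓ : ℝ → E3} {I : Set ℝ} {K : ℝ≥0}
    (hc : Continuous ℓ) (hK : LipschitzOnWith K ℓ I) :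
    (μH[1] : Measure E3).restrict (ℓ '' I) ≤
      (((K : ℝ≥0∞) • (volume : Measure ℝ)).restrict I).map ℓ := by
  refine Measure.le_iff.2 fun A hA => ?_
  rw [Measure.restrict_apply hA, Measure.map_apply hc.measurable hA,
    Measure.restrict_apply (hc.measurable hA), Measure.smul_apply, smul_eq_mul, Set.inter_comm,
    ← Set.image_inter_preimage, Set.inter_comm, ← hausdorffMeasure_real]
  simpa using (hK.mono (Set.inter_subset_right (s := ℓ ⁻¹' A))).hausdorffMeasure_image_le
    zero_le_one

variable {M : Type u} [TopologicalSpace M] [ChartedSpace (EuclideanHalfSpace 1) M]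
  {U : Type v} {T : Type w} [Fintype U] [Fintype T] {L : M → E3}

namespace LocalParam

variable {m : M} (c : LocalParam L m)

/-- A compact interval around the parameter of the base point. -/
def interval : Set ℝ := Metric.closedBall (c.σ (L m)) (c.ε / 2)

theorem isCompact_interval : IsCompact c.interval := isCompact_closedBall _ _

theorem interval_mem_nhds : c.interval ∈ 𝓝 (c.σ (L m)) :=
  Metric.closedBall_mem_nhds _ (half_pos c.ε_pos)

theorem abs_lt_of_mem_interval {s : ℝ} (hs : s ∈ c.interval) : |s - c.σ (L m)| < c.ε := by
  rw [interval, Metric.mem_closedBall, Real.dist_eq] at hs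
  linarith [c.ε_pos]

theorem exists_lipschitzOnWith : ∃ K : ℝ≥0, LipschitzOnWith K c.ℓ c.interval := by
  refine ContDiffOn.exists_lipschitzOnWith (n := ∞) ?_ (by simp) (convex_closedBall _ _)
    c.isCompact_interval
  exact c.contDiff_ℓ.contDiffOn

end LocalParam

theorem isFiniteMeasure_arcLength [CompactSpace M] [IsManifold (𝓡∂ 1) ∞ M]
    (hL : Manifold.IsSmoothEmbedding (𝓡∂ 1) 𝓘(ℝ, E3) ∞ L) :
    IsFiniteMeasure ((μH[1] : Measure E3).restrict (Set.range L)) := by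
  refine ⟨?_⟩
  rw [Measure.restrict_apply_univ]
  refine (isCompact_range hL.isEmbedding.continuous).measure_lt_top_of_nhdsWithin ?_
  rintro _ ⟨m, rfl⟩
  obtain ⟨c⟩ := exists_localParam hL m
  obtain ⟨K, hK⟩ := c.exists_lipschitzOnWith
  refine ⟨c.ℓ '' c.interval, ?_, ?_⟩
  · have h : c.nhd ∩ c.σ ⁻¹' c.interval ∈ 𝓝 (L m) := Filter.inter_mem
      (c.isOpen_nhd.mem_nhds c.mem_nhd)
      (c.contDiff_σ.continuous.continuousAt c.interval_mem_nhds)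
    filter_upwards [mem_nhdsWithin_of_mem_nhds h, self_mem_nhdsWithin]
    rintro _ ⟨h1, h2⟩ ⟨m', rfl⟩
    exact ⟨_, h2, c.ℓ_σ m' h1⟩
  · refine (hK.hausdorffMeasure_image_le zero_le_one).trans_lt ?_
    rw [hausdorffMeasure_real]
    exact ENNReal.mul_lt_top (by simp) c.isCompact_interval.measure_lt_top

namespace Diagram

/-- The configuration with given curve parameters of the univalent vertices and coordinates of the
trivalent vertices. -/
def place (ℓ : U → ℝ → E3) (s : Idx U T → ℝ) : U ⊕ T → E3 :=
  Sum.elim (fun a => ℓ a (s (Sum.inl a))) fun t => WithLp.toLp 2 fun l => s (Sum.inr (t, l))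

theorem measurable_place {ℓ : U → ℝ → E3} (hℓ : ∀ a, Continuous (ℓ a)) :
    Measurable (place (T := T) ℓ) := by
  refine measurable_pi_lambda _ ?_
  rintro (a | t)
  · exact (hℓ a).measurable.comp (measurable_pi_apply _)
  · exact (PiLp.volume_preserving_toLp (Fin 3)).measurable.comp
      (measurable_pi_lambda _ fun l => measurable_pi_apply _)

/-- In local parameters of the curve, the measure of the configuration space is bounded by a
multiple of the Lebesgue measure. -/
theorem configMeasure_restrict_le [CompactSpace M] [IsManifold (𝓡∂ 1) ∞ M]
    (hL : Manifold.IsSmoothEmbedding (𝓡∂ 1) 𝓘(ℝ, E3) ∞ L) {foot : U → M}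
    (c : ∀ a, LocalParam L (foot a)) : ∃ K : ℝ≥0,
    (configMeasure (U := U) (T := T) L).restrict
        {x | ∀ a, x (Sum.inl a) ∈ (c a).ℓ '' (c a).interval} ≤
      ((K : ℝ≥0∞) • (volume : Measure (Idx U T → ℝ)).restrict
        {s | ∀ a, s (Sum.inl a) ∈ (c a).interval}).map (place fun a => (c a).ℓ) := by
  have hfin := isFiniteMeasure_arcLength hL
  choose K hK using fun a => (c a).exists_lipschitzOnWith
  have hc : ∀ a, Continuous (c a).ℓ := fun a => (c a).contDiff_ℓ.continuous
  have hI : ∀ a, MeasurableSet (c a).interval := fun a => (c a).isCompact_interval.measurableSet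
  -- the product over the univalent vertices
  have hU : (Measure.pi fun _ : U => (μH[1] : Measure E3).restrict (Set.range L)).restrict
      (Set.univ.pi fun a => (c a).ℓ '' (c a).interval) ≤
      (((∏ a, K a : ℝ≥0) : ℝ≥0∞) • (volume : Measure (U → ℝ)).restrict
        (Set.univ.pi fun a => (c a).interval)).map fun s a => (c a).ℓ (s a) := by
    have h1 : ∀ a, ((μH[1] : Measure E3).restrict (Set.range L)).restrict
        ((c a).ℓ '' (c a).interval) ≤
        (((K a : ℝ≥0∞) • (volume : Measure ℝ)).restrict (c a).interval).map (c a).ℓ := fun a =>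
      (Measure.restrict_mono_measure Measure.restrict_le_self _).trans
        (hausdorffMeasure_restrict_image_le (hc a) (hK a))
    rw [Measure.restrict_pi_pi]
    refine (measure_pi_mono h1).trans (le_of_eq ?_)
    have : ∀ a, IsFiniteMeasure (((K a : ℝ≥0∞) • (volume : Measure ℝ)).restrict
        (c a).interval) := fun a => ⟨by
      rw [Measure.restrict_apply_univ, Measure.smul_apply, smul_eq_mul]
      exact ENNReal.mul_lt_top (by simp) (c a).isCompact_interval.measure_lt_top⟩
    rw [← Measure.pi_map_pi fun a => (hc a).aemeasurable]
    congr 1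
    refine Measure.pi_eq fun s hs => ?_
    rw [Measure.smul_apply, Measure.restrict_apply (MeasurableSet.univ_pi hs),
      ← Set.pi_inter_distrib, volume_pi_pi, smul_eq_mul, ENNReal.ofNNReal_finsetProd,
      ← Finset.prod_mul_distrib]
    refine Finset.prod_congr rfl fun a _ => ?_
    rw [Measure.restrict_apply (hs a), Measure.smul_apply, smul_eq_mul]
  refine ⟨∏ a, K a, ?_⟩
  generalize (∏ a, K a) = Λ at hU ⊢
  let μ : U ⊕ T → Measure E3 := Sum.elim
    (fun _ : U => (μH[1] : Measure E3).restrict (Set.range L)) fun _ : T => volume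
  have hμ : ∀ v, SigmaFinite (μ v) := by
    rintro (a | t)
    · exact inferInstanceAs (SigmaFinite ((μH[1] : Measure E3).restrict (Set.range L)))
    · exact inferInstanceAs (SigmaFinite (volume : Measure E3))
  have hsum := measurePreserving_sumPiEquivProdPi_symm (X := fun _ : U ⊕ T => E3) μ
  have hℓ : Measurable fun (s : U → ℝ) a => (c a).ℓ (s a) :=
    measurable_pi_lambda _ fun a => (hc a).measurable.comp (measurable_pi_apply a)
  have hT : MeasurePreserving (fun (f : T → Fin 3 → ℝ) t => (WithLp.toLp 2 (f t) : E3))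
      volume volume := volume_preserving_pi fun _ => PiLp.volume_preserving_toLp (Fin 3)
  have hg : MeasurePreserving (fun z : (U → ℝ) × (T → Fin 3 → ℝ) =>
      (MeasurableEquiv.sumPiEquivProdPi fun _ : Idx U T => ℝ).symm
        (Prod.map id Function.uncurry z)) (volume.prod volume) volume :=
    (volume_measurePreserving_sumPiEquivProdPi_symm fun _ : Idx U T => ℝ).comp
      ((MeasurePreserving.id volume).prod (measurePreserving_uncurry T 3))
  have hbox : MeasurableSet {s : Idx U T → ℝ | ∀ a, s (Sum.inl a) ∈ (c a).interval} := by
    have : {s : Idx U T → ℝ | ∀ a, s (Sum.inl a) ∈ (c a).interval} =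
        ⋂ a, (fun s => s (Sum.inl a)) ⁻¹' (c a).interval := by
      ext s; simp
    rw [this]
    exact MeasurableSet.iInter fun a => measurable_pi_apply _ (hI a)
  have hbox' : MeasurableSet {x : U ⊕ T → E3 | ∀ a, x (Sum.inl a) ∈ (c a).ℓ '' (c a).interval} := by
    have : {x : U ⊕ T → E3 | ∀ a, x (Sum.inl a) ∈ (c a).ℓ '' (c a).interval} =
        ⋂ a, (fun x => x (Sum.inl a)) ⁻¹' ((c a).ℓ '' (c a).interval) := by
      ext s; simp
    rw [this]
    exact MeasurableSet.iInter fun a => measurable_pi_apply _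
      ((c a).isCompact_interval.image (hc a)).measurableSet
  have hplace : Measurable (place (T := T) fun a => (c a).ℓ) := measurable_place hc
  have h1 : (MeasurableEquiv.sumPiEquivProdPi fun _ : U ⊕ T => E3).symm ⁻¹'
      {x | ∀ a, x (Sum.inl a) ∈ (c a).ℓ '' (c a).interval} =
      (Set.univ.pi fun a => (c a).ℓ '' (c a).interval) ×ˢ Set.univ := by
    ext z
    simp only [Set.mem_preimage, Set.mem_ofPred_eq, Set.mem_prod, Set.mem_univ_pi, Set.mem_univ,
      and_true]
    rfl
  have h2 : (fun z : (U → ℝ) × (T → Fin 3 → ℝ) =>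
      (MeasurableEquiv.sumPiEquivProdPi fun _ : Idx U T => ℝ).symm
        (Prod.map id Function.uncurry z)) ⁻¹' {s | ∀ a, s (Sum.inl a) ∈ (c a).interval} =
      (Set.univ.pi fun a => (c a).interval) ×ˢ Set.univ := by
    ext z
    simp only [Set.mem_preimage, Set.mem_ofPred_eq, Set.mem_prod, Set.mem_univ_pi, Set.mem_univ,
      and_true]
    rfl
  calc (configMeasure L).restrict {x | ∀ a, x (Sum.inl a) ∈ (c a).ℓ '' (c a).interval}
      = (((Measure.pi fun _ : U => (μH[1] : Measure E3).restrict (Set.range L)).restrict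
          (Set.univ.pi fun a => (c a).ℓ '' (c a).interval)).prod
          (volume : Measure (T → E3))).map
          (MeasurableEquiv.sumPiEquivProdPi fun _ : U ⊕ T => E3).symm := by
        rw [configMeasure, ← hsum.map_eq, Measure.restrict_map hsum.measurable hbox', h1,
          ← Measure.prod_restrict, Measure.restrict_univ]
        rfl
    _ ≤ (((((Λ : ℝ≥0∞) • (volume : Measure (U → ℝ)).restrict
          (Set.univ.pi fun a => (c a).interval)).map fun s a => (c a).ℓ (s a))).prod
          (volume : Measure (T → E3))).map
          (MeasurableEquiv.sumPiEquivProdPi fun _ : U ⊕ T => E3).symm :=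
        Measure.map_mono (Measure.prod_mono hU le_rfl) hsum.measurable
    _ = _ := by
        have : SFinite ((Λ : ℝ≥0∞) • (volume : Measure (U → ℝ)).restrict
          (Set.univ.pi fun a => (c a).interval)) := inferInstance
        rw [← hT.map_eq, Measure.map_prod_map _ _ hℓ hT.measurable, Measure.map_map hsum.measurable
          (hℓ.prodMap hT.measurable), ← hg.map_eq, Measure.restrict_map hg.measurable hbox, h2,
          ← Measure.prod_restrict, Measure.restrict_univ, ← Measure.map_smul,
          Measure.map_map hplace hg.measurable, Measure.prod_smul_left]
        congr 1

end Diagram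

end ArcLength

/-! ### The form to be integrated -/

namespace Diagram

variable {U : Type v} {T : Type w} {M : Type u}
  [TopologicalSpace M] [ChartedSpace (EuclideanHalfSpace 1) M] [Fintype U] [Fintype T]
  {Γ : Diagram U T M} {L : M → E3} (o : Γ.EdgeOrientation)

theorem contDiffAt_directionMap (e : Γ.graph.edgeSet) {x : U ⊕ T → E3}
    (hx : x (o.head e) ≠ x (o.tail e)) : ContDiffAt ℝ ∞ (fun y => directionMap o y e) x := by
  have h1 : ContDiff ℝ ∞ fun y : U ⊕ T → E3 => y (o.head e) - y (o.tail e) :=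
    (contDiff_apply ℝ E3 _).sub (contDiff_apply ℝ E3 _)
  exact ((h1.contDiffAt.norm ℝ (sub_ne_zero.2 hx)).inv (norm_ne_zero_iff.2 (sub_ne_zero.2 hx))).smul
    h1.contDiffAt

theorem pullbackVolume_eq [Fintype Γ.graph.edgeSet] [DecidableEq Γ.graph.edgeSet] (s : U → E3 → E3)
    (σ : (Γ.graph.edgeSet ⊕ (U ⊕ (T × Fin 3))) ≃ (Γ.graph.edgeSet × Fin 3)) (x : U ⊕ T → E3) :
    pullbackVolume o s σ x = ((4 * Real.pi) ^ Nat.card Γ.graph.edgeSet)⁻¹ *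
      (Matrix.of fun r c => pullbackColumn o s x (σ.symm c) r).det := by
  unfold pullbackVolume
  congr!

theorem continuousOn_pullbackVolume {s : U → E3 → E3} (hs : ∀ a, IsUnitTangent L (s a))
    (σ : (Γ.graph.edgeSet ⊕ (U ⊕ (T × Fin 3))) ≃ (Γ.graph.edgeSet × Fin 3)) :
    ContinuousOn (pullbackVolume o s σ) (Γ.configSpace L) := by
  classical
  have : Fintype Γ.graph.edgeSet := Fintype.ofFinite _
  simp only [funext (pullbackVolume_eq o s σ)]
  refine continuousOn_const.mul ((continuous_id.matrix_det).comp_continuousOn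
    (continuousOn_pi.2 fun r => continuousOn_pi.2 fun c => ?_))
  have hne : ∀ e : Γ.graph.edgeSet, ∀ x ∈ Γ.configSpace L, x (o.head e) ≠ x (o.tail e) :=
    fun e x hx => (hx.1 _ _ (adj_ends o e)).symm
  simp only [Matrix.of_apply]
  have hev : ∀ l : Fin 3, Continuous fun y : E3 => y l := fun l => by fun_prop
  rcases σ.symm c with e | q
  · simp only [pullbackColumn]
    split_ifs with h
    · intro x hx
      exact (hev _).continuousAt.comp_continuousWithinAt
        (contDiffAt_directionMap o e (hne e x hx)).continuousAt.continuousWithinAt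
    · exact continuousOn_const
  · simp only [pullbackColumn]
    refine (hev _).comp_continuousOn (ContinuousOn.clm_apply ?_ ?_)
    · intro x hx
      exact ((contDiffAt_directionMap o r.1 (hne r.1 x hx)).fderiv_right (m := 0)
        (by simp)).continuousAt.continuousWithinAt
    · rcases q with a | ⟨t, l⟩
      · simp only [coordVector]
        refine (continuous_single (Sum.inl a : U ⊕ T)).comp_continuousOn
          ((hs a).continuousOn.comp (continuous_apply _).continuousOn ?_)
        rintro x ⟨-, i, -, hi⟩
        exact ⟨_, (hi a).symm⟩
      · simp only [coordVector]
        exact continuousOn_const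

/-- The velocity of a local parameter is a multiple of the unit tangent vector. -/
theorem exists_deriv_eq_smul {m m' : M} (hL : Manifold.IsSmoothEmbedding (𝓡∂ 1) 𝓘(ℝ, E3) ∞ L)
    (c : LocalParam L m) {s : E3 → E3}
    (hs : IsUnitTangent L s) (hm : L m' ∈ c.nhd) : ∃ κ : ℝ,
      |κ| = ‖deriv c.ℓ (c.σ (L m'))‖ ∧ deriv c.ℓ (c.σ (L m')) = κ • s (L m') := by
  obtain ⟨ξ, hξ⟩ := hs.tangent m'
  have h1 : L =ᶠ[𝓝 m'] fun y => (c.ℓ ∘ c.σ) (L y) := by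
    filter_upwards [hL.isEmbedding.continuous.continuousAt (c.isOpen_nhd.mem_nhds hm)] with y hy
    exact (c.ℓ_σ y hy).symm
  have hd : HasFDerivAt (c.ℓ ∘ c.σ) ((ContinuousLinearMap.toSpanSingleton ℝ
      (deriv c.ℓ (c.σ (L m')))).comp (fderiv ℝ c.σ (L m'))) (L m') :=
    (c.contDiff_ℓ.differentiable (by simp) _).hasDerivAt.hasFDerivAt.comp _
      (c.contDiff_σ.differentiable (by simp) _).hasFDerivAt
  have h2 : s (L m') = fderiv ℝ c.σ (L m') (s (L m')) • deriv c.ℓ (c.σ (L m')) := by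
    have h3 := h1.mfderiv_eq (I := 𝓡∂ 1) (I' := 𝓘(ℝ, E3))
    have h4 : HasMFDerivAt (𝓡∂ 1) 𝓘(ℝ, E3) (fun y => (c.ℓ ∘ c.σ) (L y)) m' _ :=
      hd.hasMFDerivAt.comp m' (hL.contMDiff.mdifferentiable (by simp) m').hasMFDerivAt
    have h5 : mfderiv (𝓡∂ 1) 𝓘(ℝ, E3) L m' ξ =
        fderiv ℝ c.σ (L m') (mfderiv (𝓡∂ 1) 𝓘(ℝ, E3) L m' ξ) • deriv c.ℓ (c.σ (L m')) :=
      congrArg (fun A => A ξ) (h3.trans h4.mfderiv)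
    rwa [hξ] at h5
  have h3 := congrArg norm h2
  rw [hs.norm_eq, norm_smul, Real.norm_eq_abs] at h3
  have h4 : fderiv ℝ c.σ (L m') (s (L m')) ≠ 0 := by
    intro h; rw [h] at h3; simp at h3
  refine ⟨(fderiv ℝ c.σ (L m') (s (L m')))⁻¹, ?_, ?_⟩
  · rw [abs_inv, inv_eq_of_mul_eq_one_right h3.symm]
  · nth_rewrite 2 [h2]
    rw [smul_smul, inv_mul_cancel₀ h4, one_smul]

end Diagram

/-! ### Convergence of the configuration space integral -/

namespace Diagram

variable {U : Type v} {T : Type w} {M : Type u}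
  [TopologicalSpace M] [ChartedSpace (EuclideanHalfSpace 1) M] [Fintype U] [Fintype T]
  {Γ : Diagram U T M} {L : M → E3}

open Classical in
/-- The analogue of `pullbackColumn` for a family of directions `Θ` depending on coordinates `t`,
and the standard basis of the space of coordinates. -/
def directionMatrix (Θ : (Idx U T → ℝ) → Γ.graph.edgeSet → E3) (t : Idx U T → ℝ) :
    Matrix (Γ.graph.edgeSet × Fin 3) (Γ.graph.edgeSet ⊕ Idx U T) ℝ := fun r c =>
  match c with
  | Sum.inl e => if e = r.1 then Θ t e r.2 else 0
  | Sum.inr j => (fderiv ℝ (fun t' => Θ t' r.1) t (Pi.single j 1)) r.2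

theorem continuousAt_directionMatrix {Θ : (Idx U T → ℝ) → Γ.graph.edgeSet → E3}
    {t : Idx U T → ℝ} (h : ∀ e, ContDiffAt ℝ ∞ (fun t => Θ t e) t) (r c) :
    ContinuousAt (fun t => directionMatrix Θ t r c) t := by
  classical
  have hev : Continuous fun y : E3 => y r.2 := by fun_prop
  rcases c with e | j
  · simp only [directionMatrix]
    split_ifs
    · exact hev.continuousAt.comp (h e).continuousAt
    · exact continuousAt_const
  · simp only [directionMatrix]
    refine hev.continuousAt.comp (ContinuousAt.clm_apply ?_ continuousAt_const)
    exact ((h r.1).fderiv_right (m := 0) (by simp)).continuousAt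

/-- The transformation of the form `Ψ^*Ω` under a change of coordinates `X`, whose derivative has
the matrix `diag(κ) A` in the standard basis and in the basis `coordVector`. -/
theorem pullbackVolume_mul_det [Fintype Γ.graph.edgeSet] [DecidableEq Γ.graph.edgeSet]
    (o : Γ.EdgeOrientation) (s : U → E3 → E3)
    (σ : (Γ.graph.edgeSet ⊕ (U ⊕ (T × Fin 3))) ≃ (Γ.graph.edgeSet × Fin 3))
    {X : (Idx U T → ℝ) → U ⊕ T → E3} {X' : (Idx U T → ℝ) →L[ℝ] (U ⊕ T → E3)}
    {A : (Idx U T → ℝ) →L[ℝ] (Idx U T → ℝ)} {κ : Idx U T → ℝ} {t : Idx U T → ℝ}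
    (hne : ∀ e, X t (o.head e) ≠ X t (o.tail e)) (hX : HasFDerivAt X X' t)
    (hcol : ∀ w, X' w = ∑ i, (κ i * A w i) • coordVector s (X t) i) :
    pullbackVolume o s σ (X t) * ((∏ i, κ i) * A.det) =
      ((4 * Real.pi) ^ Nat.card Γ.graph.edgeSet)⁻¹ *
        (Matrix.of fun r c => directionMatrix (fun t => directionMap o (X t)) t r
          (σ.symm c)).det := by
  classical
  let N : Matrix (Idx U T) (Idx U T) ℝ := Matrix.diagonal κ * LinearMap.toMatrix' A.toLinearMap
  have hN : N.det = (∏ i, κ i) * A.det := by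
    rw [Matrix.det_mul, Matrix.det_diagonal, LinearMap.det_toMatrix']
  let D : Matrix (Γ.graph.edgeSet ⊕ Idx U T) (Γ.graph.edgeSet ⊕ Idx U T) ℝ :=
    Matrix.fromBlocks 1 0 0 N
  have hD : D.det = N.det := by
    rw [Matrix.det_fromBlocks_zero₂₁, Matrix.det_one, one_mul]
  let P : Matrix (Γ.graph.edgeSet × Fin 3) (Γ.graph.edgeSet ⊕ Idx U T) ℝ :=
    Matrix.of fun r c => pullbackColumn o s (X t) c r
  have hP : directionMatrix (fun t => directionMap o (X t)) t = P * D := by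
    ext r c
    rw [Matrix.mul_apply, Fintype.sum_sum_type]
    rcases c with e | j
    · simp only [D, Matrix.fromBlocks_apply₁₁, Matrix.fromBlocks_apply₂₁, Matrix.zero_apply,
        mul_zero, Finset.sum_const_zero, add_zero, Matrix.one_apply, mul_ite, mul_one,
        Finset.sum_ite_eq', Finset.mem_univ, if_true]
      simp only [P, directionMatrix, pullbackColumn, Matrix.of_apply]
    · have h1 := (((contDiffAt_directionMap o r.1 (hne r.1)).differentiableAt
        (by simp)).hasFDerivAt.comp t hX).fderiv
      simp only [D, Matrix.fromBlocks_apply₁₂, Matrix.fromBlocks_apply₂₂, Matrix.zero_apply,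
        mul_zero, Finset.sum_const_zero, zero_add, N, Matrix.diagonal_mul]
      simp only [P, directionMatrix, pullbackColumn, Matrix.of_apply]
      change (fderiv ℝ ((fun y => directionMap o y r.1) ∘ X) t (Pi.single j 1)) r.2 = _
      rw [h1, ContinuousLinearMap.comp_apply, hcol, map_sum]
      simp only [map_smul, WithLp.ofLp_sum, Finset.sum_apply, WithLp.ofLp_smul, Pi.smul_apply,
        smul_eq_mul, LinearMap.toMatrix'_apply]
      refine Finset.sum_congr rfl fun i _ => ?_
      rw [mul_comm]
      rfl
  have h2 : (Matrix.of fun r c => directionMatrix (fun t => directionMap o (X t)) t r (σ.symm c)) =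
      P.submatrix id σ.symm * D.submatrix σ.symm σ.symm := by
    rw [Matrix.submatrix_mul_equiv, ← hP]
    rfl
  rw [h2, Matrix.det_mul, Matrix.det_submatrix_equiv_self, hD, hN, pullbackVolume_eq, mul_assoc]
  rfl

theorem nonempty_footing [IsManifold (𝓡∂ 1) ∞ M]
    (hL : Manifold.IsSmoothEmbedding (𝓡∂ 1) 𝓘(ℝ, E3) ∞ L) {p : Γ.Ambient}
    (hp : IsLimitShape Γ L p) : Nonempty (Footing Γ L p) := by
  choose foot hfoot using hp.pos_mem
  exact ⟨⟨fun m => (exists_localParam hL m).some, foot, hfoot⟩⟩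

/-- The coordinates of a configuration: the parameters `σ a` of the univalent vertices, and the
coordinates of the trivalent vertices. -/
def coords (σ : U → E3 → ℝ) (x : U ⊕ T → E3) : Idx U T → ℝ :=
  Sum.elim (fun a => σ a (x (Sum.inl a))) fun z => x (Sum.inr z.1) z.2

theorem contDiff_coords {σ : U → E3 → ℝ} (hσ : ∀ a, ContDiff ℝ ∞ (σ a)) :
    ContDiff ℝ ∞ (coords (T := T) σ) := by
  refine contDiff_pi.2 ?_
  rintro (a | ⟨τ, l⟩)
  · exact (hσ a).comp (contDiff_apply ℝ E3 _)
  · exact contDiff_euclidean.1 (contDiff_apply ℝ E3 (Sum.inr τ : U ⊕ T)) l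

theorem place_coords {ℓ : U → ℝ → E3} {σ : U → E3 → ℝ} {x : U ⊕ T → E3}
    (h : ∀ a, ℓ a (σ a (x (Sum.inl a))) = x (Sum.inl a)) : place ℓ (coords σ x) = x := by
  funext v
  rcases v with a | τ
  · exact h a
  · rfl

open Classical in
/-- The derivative of a family of configurations in terms of its coordinates. -/
theorem fderiv_eq_sum_coordVector {ℓ : U → ℝ → E3} {σ : U → E3 → ℝ} {s : U → E3 → E3}
    (hℓ : ∀ a, ContDiff ℝ ∞ (ℓ a)) {X : (Idx U T → ℝ) → U ⊕ T → E3} {t : Idx U T → ℝ}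
    {X' : (Idx U T → ℝ) →L[ℝ] (U ⊕ T → E3)} {A : (Idx U T → ℝ) →L[ℝ] (Idx U T → ℝ)}
    (hX : HasFDerivAt X X' t) (hA : HasFDerivAt (fun t => coords σ (X t)) A t)
    (heq : ∀ᶠ t in 𝓝 t, ∀ a, ℓ a (σ a (X t (Sum.inl a))) = X t (Sum.inl a)) {κ : U → ℝ}
    (hκ : ∀ a, deriv (ℓ a) (σ a (X t (Sum.inl a))) = κ a • s a (X t (Sum.inl a)))
    (w : Idx U T → ℝ) :
    X' w = ∑ i, (Sum.elim κ (fun _ => 1) i * A w i) • coordVector s (X t) i := by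
  rw [Fintype.sum_sum_type, Fintype.sum_prod_type]
  funext v
  have hXv : HasFDerivAt (fun t => X t v) ((ContinuousLinearMap.proj v).comp X') t :=
    (ContinuousLinearMap.proj v : (U ⊕ T → E3) →L[ℝ] E3).hasFDerivAt.comp t hX
  have hAj : ∀ j, HasFDerivAt (fun t => coords σ (X t) j)
      ((ContinuousLinearMap.proj j).comp A) t := fun j =>
    (ContinuousLinearMap.proj j : (Idx U T → ℝ) →L[ℝ] ℝ).hasFDerivAt.comp t hA
  simp only [Pi.add_apply, Finset.sum_apply, Pi.smul_apply, coordVector, Sum.elim_inl,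
    Sum.elim_inr, one_mul]
  rcases v with a | τ
  · have h1 : HasFDerivAt (fun t => X t (Sum.inl a)) _ t :=
      (((hℓ a).differentiable (by simp) _).hasDerivAt.hasFDerivAt.comp t
        (hAj (Sum.inl a))).congr_of_eventuallyEq (by
          filter_upwards [heq] with t ht using (ht a).symm)
    have h2 := congrArg (fun B => B w) (hXv.unique h1)
    rw [Finset.sum_eq_single a (by intro b _ hb; simp [hb.symm]) (by simp)]
    simp only [Pi.single_eq_same, Pi.single_apply, reduceCtorEq, if_false, smul_zero,
      Finset.sum_const_zero, add_zero]
    refine h2.trans ?_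
    change A w (Sum.inl a) • deriv (ℓ a) (σ a (X t (Sum.inl a))) = _
    rw [hκ a, smul_smul, mul_comm]
  · simp only [Pi.single_apply, reduceCtorEq, if_false, smul_zero, Finset.sum_const_zero, zero_add]
    rw [Finset.sum_eq_single τ (by intro b _ hb; simp [hb.symm]) (by simp)]
    ext l
    have h1 := congrArg (fun B => B w) ((hAj (Sum.inr (τ, l))).unique
      ((EuclideanSpace.proj (𝕜 := ℝ) l).hasFDerivAt.comp t hXv))
    change A w (Sum.inr (τ, l)) = X' w (Sum.inr τ) l at h1
    simp [← h1, Finset.sum_apply, Pi.single_apply]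

end Diagram

namespace Diagram

variable {U : Type v} {T : Type w} {M : Type u}
  [TopologicalSpace M] [ChartedSpace (EuclideanHalfSpace 1) M] [Fintype U] [Fintype T]
  {Γ : Diagram U T M} {L : M → E3}

open scoped ENNReal NNReal

/-- A function on a set of configurations is integrable if it is bounded, after multiplication with
the Jacobian determinant, in bounded coordinates `t`. -/
theorem integrableOn_image [CompactSpace M] [IsManifold (𝓡∂ 1) ∞ M]
    (hL : Manifold.IsSmoothEmbedding (𝓡∂ 1) 𝓘(ℝ, E3) ∞ L) {foot : U → M}
    (c : ∀ a, LocalParam L (foot a)) {f : (U ⊕ T → E3) → ℝ} {X : (Idx U T → ℝ) → U ⊕ T → E3}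
    {A : (Idx U T → ℝ) → (Idx U T → ℝ) →L[ℝ] (Idx U T → ℝ)} {Q : Set (Idx U T → ℝ)}
    (hQ : MeasurableSet Q) (hQb : Bornology.IsBounded Q) (hX : ContinuousOn X Q)
    (hinj : Set.InjOn X Q) (hf : ContinuousOn f (X '' Q))
    (hA : ∀ t ∈ Q, HasFDerivAt (fun t => coords (fun a => (c a).σ) (X t)) (A t) t)
    (hc : ∀ t ∈ Q, ∀ a, (c a).ℓ ((c a).σ (X t (Sum.inl a))) = X t (Sum.inl a))
    (hi : ∀ t ∈ Q, ∀ a, (c a).σ (X t (Sum.inl a)) ∈ (c a).interval) {B : ℝ}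
    (hB : ∀ t ∈ Q, |f (X t)| * |(A t).det| ≤ B) :
    MeasurableSet (X '' Q) ∧ IntegrableOn f (X '' Q) (configMeasure L) := by
  have hS : MeasurableSet (X '' Q) := hQ.image_of_continuousOn_injOn hX hinj
  refine ⟨hS, hf.aestronglyMeasurable hS, ?_⟩
  obtain ⟨K, hK⟩ := configMeasure_restrict_le (T := T) hL c
  set q := fun t => coords (fun a => (c a).σ) (X t) with hq
  set ℓ := fun a => (c a).ℓ with hℓ
  have hpl : Measurable (place (T := T) ℓ) :=
    measurable_place fun a => (c a).contDiff_ℓ.continuous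
  have hpq : ∀ t ∈ Q, place ℓ (q t) = X t := fun t ht => place_coords (hc t ht)
  have hqinj : Set.InjOn q Q := fun t ht t' ht' h => hinj ht ht' (by
    rw [← hpq t ht, ← hpq t' ht', h])
  have h1 : (configMeasure L).restrict (X '' Q) ≤ (K : ℝ≥0∞) •
      ((volume.restrict (q '' Q)).map (place ℓ)) := by
    have hsub : X '' Q ⊆ {x | ∀ a, x (Sum.inl a) ∈ (c a).ℓ '' (c a).interval} := by
      rintro _ ⟨t, ht, rfl⟩ a
      exact ⟨_, hi t ht a, hc t ht a⟩
    have hsub' : place ℓ ⁻¹' (X '' Q) ∩ {s | ∀ a, s (Sum.inl a) ∈ (c a).interval} ⊆ q '' Q := by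
      rintro s ⟨⟨t, ht, hts⟩, hs⟩
      refine ⟨t, ht, ?_⟩
      funext j
      rcases j with a | ⟨τ, l⟩
      · change (c a).σ (X t (Sum.inl a)) = s (Sum.inl a)
        rw [hts]
        exact (c a).σ_ℓ _ ((c a).abs_lt_of_mem_interval (hs a))
      · change X t (Sum.inr τ) l = s (Sum.inr (τ, l))
        rw [hts]
        rfl
    calc (configMeasure L).restrict (X '' Q)
        = ((configMeasure L).restrict
            {x | ∀ a, x (Sum.inl a) ∈ (c a).ℓ '' (c a).interval}).restrict (X '' Q) := by
          rw [Measure.restrict_restrict hS, Set.inter_eq_left.2 hsub]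
      _ ≤ (((K : ℝ≥0∞) • (volume : Measure (Idx U T → ℝ)).restrict
            {s | ∀ a, s (Sum.inl a) ∈ (c a).interval}).map (place ℓ)).restrict (X '' Q) :=
          Measure.restrict_mono_measure hK _
      _ = (K : ℝ≥0∞) • ((volume.restrict (place ℓ ⁻¹' (X '' Q) ∩
            {s | ∀ a, s (Sum.inl a) ∈ (c a).interval})).map (place ℓ)) := by
          rw [Measure.restrict_map hpl hS, Measure.restrict_smul, Measure.map_smul,
            Measure.restrict_restrict (hpl hS)]
      _ ≤ _ := by
          gcongr
  have h2 : ∀ t ∈ Q, ENNReal.ofReal |(A t).det| * ‖f (place ℓ (q t))‖ₑ ≤ ENNReal.ofReal B := by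
    intro t ht
    rw [hpq t ht, ← ofReal_norm, ← ENNReal.ofReal_mul (abs_nonneg _), mul_comm,
      Real.norm_eq_abs]
    exact ENNReal.ofReal_le_ofReal (hB t ht)
  calc ∫⁻ x in X '' Q, ‖f x‖ₑ ∂configMeasure L
      ≤ ∫⁻ x, ‖f x‖ₑ ∂((K : ℝ≥0∞) • ((volume.restrict (q '' Q)).map (place ℓ))) :=
        lintegral_mono' h1 le_rfl
    _ = (K : ℝ≥0∞) * ∫⁻ x, ‖f x‖ₑ ∂((volume.restrict (q '' Q)).map (place ℓ)) := by
        rw [lintegral_smul_measure, smul_eq_mul]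
    _ ≤ (K : ℝ≥0∞) * ∫⁻ s in q '' Q, ‖f (place ℓ s)‖ₑ := by
        gcongr
        exact lintegral_map_le _ _
    _ = (K : ℝ≥0∞) * ∫⁻ t in Q, ENNReal.ofReal |(A t).det| * ‖f (place ℓ (q t))‖ₑ := by
        rw [lintegral_image_eq_lintegral_abs_det_fderiv_mul volume hQ
          (fun t ht => (hA t ht).hasFDerivWithinAt) hqinj fun s => ‖f (place ℓ s)‖ₑ]
    _ ≤ (K : ℝ≥0∞) * ∫⁻ _ in Q, ENNReal.ofReal B := by
        gcongr 1
        exact setLIntegral_mono' hQ h2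
    _ < ⊤ := by
        rw [setLIntegral_const]
        exact ENNReal.mul_lt_top (by simp) (ENNReal.mul_lt_top (by simp) hQb.measure_lt_top)

variable [CompactSpace M] [IsManifold (𝓡∂ 1) ∞ M]
  (hL : Manifold.IsSmoothEmbedding (𝓡∂ 1) 𝓘(ℝ, E3) ∞ L)
include hL

/-- Every point of the compactification has a neighbourhood on which the form is integrable: in the
coordinates of a local model its coefficient is bounded, as the directions extend smoothly. -/
theorem exists_integrableOn {p : Γ.Ambient} (hp : p ∈ Γ.compactification L)
    (o : Γ.EdgeOrientation) {s : U → E3 → E3} (hs : ∀ a, IsUnitTangent L (s a))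
    (σ : (Γ.graph.edgeSet ⊕ (U ⊕ (T × Fin 3))) ≃ (Γ.graph.edgeSet × Fin 3)) :
    ∃ S : Set (U ⊕ T → E3), IntegrableOn (pullbackVolume o s σ) S (configMeasure L) ∧
      ∀ᶠ e in 𝓝 p, ∀ x ∈ Γ.configSpace L, Γ.canon x = e → x ∈ S := by
  classical
  have : Fintype Γ.graph.edgeSet := Fintype.ofFinite _
  have hlim := isLimitShape_of_mem hL.isEmbedding.injective hL.isEmbedding.continuous hp
  obtain ⟨m⟩ := nonempty_localModel hL hp
  obtain ⟨d⟩ := nonempty_footing hL hlim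
  have hΦp : m.Φ (m.G p) = p := m.Φ_G_self hp
  have hΦ := m.contDiffAt_Φ.self_of_nhds
  have hpos : ∀ a, ContinuousAt (fun t => (m.Φ t).2.1 a) (m.G p) := fun a =>
    (contDiff_pos (Γ := Γ) a).continuous.continuousAt.comp hΦ.continuousAt
  set Θ : (Idx U T → ℝ) → Γ.graph.edgeSet → E3 := fun t e => limitDirection o e (m.Φ t) with hΘ
  -- the coefficient of the form in the coordinates `t`
  set F : (Idx U T → ℝ) → ℝ := fun t => ((4 * Real.pi) ^ Nat.card Γ.graph.edgeSet)⁻¹ *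
    (Matrix.of fun r c => directionMatrix Θ t r (σ.symm c)).det with hF
  set V : (Idx U T → ℝ) → ℝ := fun t =>
    ∏ a, ‖deriv (d.par a).ℓ ((d.par a).σ ((m.Φ t).2.1 a))‖ with hV
  have hFc : ContinuousAt F (m.G p) := by
    refine continuousAt_const.mul ((continuous_id.matrix_det).continuousAt.comp
      (continuousAt_pi.2 fun r => continuousAt_pi.2 fun c => ?_))
    refine continuousAt_directionMatrix (fun e => ?_) r (σ.symm c)
    have h1 : ContDiffAt ℝ ∞ (limitDirection o e) (m.Φ (m.G p)) :=
      contDiffAt_limitDirection o e (by rw [hΦp]; exact edgeVector_ne o e hlim)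
    exact h1.comp (m.G p) hΦ
  have hVc : ContinuousAt V (m.G p) := by
    refine tendsto_finsetProd _ fun a _ => ?_
    exact ((((contDiff_infty_iff_deriv.1 (d.par a).contDiff_ℓ).2.continuous.comp
      (d.par a).contDiff_σ.continuous).norm).continuousAt.comp (hpos a))
  have hVp : V (m.G p) ≠ 0 := by
    refine Finset.prod_ne_zero_iff.2 fun a _ => norm_ne_zero_iff.2 ((d.par a).deriv_ne ?_)
    rw [hΦp, ← d.foot_eq, sub_self, abs_zero]
    exact (d.par a).ε_pos
  have hbd : ∀ᶠ t in 𝓝 (m.G p), |F t| / |V t| < |F (m.G p)| / |V (m.G p)| + 1 :=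
    (hFc.abs.div hVc.abs (abs_ne_zero.2 hVp)).eventually (gt_mem_nhds (by simp))
  have hnhd : ∀ᶠ t in 𝓝 (m.G p), ∀ a, (m.Φ t).2.1 a ∈ (d.par a).nhd ∧
      (d.par a).σ ((m.Φ t).2.1 a) ∈ (d.par a).interval := by
    refine Filter.eventually_all.2 fun a => ((hpos a).eventually ?_).and
      ((((d.par a).contDiff_σ.continuous.continuousAt).comp (hpos a)).eventually ?_)
    · change ∀ᶠ y in 𝓝 ((m.Φ (m.G p)).2.1 a), y ∈ (d.par a).nhd
      rw [hΦp, ← d.foot_eq]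
      exact (d.par a).isOpen_nhd.mem_nhds (d.par a).mem_nhd
    · change ∀ᶠ s in 𝓝 ((d.par a).σ ((m.Φ (m.G p)).2.1 a)), s ∈ (d.par a).interval
      rw [hΦp, ← d.foot_eq]
      exact (d.par a).interval_mem_nhds
  obtain ⟨ε, hε, hball⟩ := Metric.eventually_nhds_iff_ball.1
    (m.G_X.and (m.contDiffAt_X.and (hnhd.and hbd)))
  have hQo : IsOpen (Metric.ball (m.G p) ε ∩ {t | ∀ j ∈ m.Cn, 0 < t j}) := by
    refine Metric.isOpen_ball.inter ?_
    have : {t : Idx U T → ℝ | ∀ j ∈ m.Cn, 0 < t j} = ⋂ j ∈ m.Cn, (fun t => t j) ⁻¹' Set.Ioi 0 := by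
      ext t; simp
    rw [this]
    exact m.Cn.toFinite.isOpen_biInter fun j _ => isOpen_Ioi.preimage (continuous_apply j)
  set Q := Metric.ball (m.G p) ε ∩ {t | ∀ j ∈ m.Cn, 0 < t j} with hQ
  have hXC : ∀ t ∈ Q, m.X t ∈ Γ.configSpace L := fun t ht => ((hball t ht.1).1 ht.2).1
  have hcan : ∀ t ∈ Q, Γ.canon (m.X t) = m.Φ t := fun t ht => ((hball t ht.1).1 ht.2).2.2
  have hXpos : ∀ t ∈ Q, ∀ a, m.X t (Sum.inl a) = (m.Φ t).2.1 a := fun t ht a => by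
    rw [← hcan t ht]; rfl
  have hXd : ∀ t ∈ Q, ContDiffAt ℝ ∞ m.X t := fun t ht => (hball t ht.1).2.1 ht.2
  have hn : ∀ t ∈ Q, ∀ a, m.X t (Sum.inl a) ∈ (d.par a).nhd ∧
      (d.par a).σ (m.X t (Sum.inl a)) ∈ (d.par a).interval := fun t ht a => by
    rw [hXpos t ht a]; exact (hball t ht.1).2.2.1 a
  have hℓ : ∀ t ∈ Q, ∀ a, (d.par a).ℓ ((d.par a).σ (m.X t (Sum.inl a))) = m.X t (Sum.inl a) := by
    intro t ht a
    obtain ⟨-, i, -, hi⟩ := hXC t ht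
    rw [hi a]
    exact (d.par a).ℓ_σ _ (hi a ▸ (hn t ht a).1)
  have hcd : ContDiff ℝ ∞ (coords (T := T) fun a => (d.par a).σ) :=
    contDiff_coords fun a => (d.par a).contDiff_σ
  have hA : ∀ t ∈ Q, HasFDerivAt (fun t => coords (fun a => (d.par a).σ) (m.X t))
      (fderiv ℝ (fun t => coords (fun a => (d.par a).σ) (m.X t)) t) t := fun t ht =>
    ((hcd.contDiffAt.comp t (hXd t ht)).differentiableAt (by simp)).hasFDerivAt
  refine ⟨m.X '' Q, (integrableOn_image hL (fun a => d.par a) hQo.measurableSet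
    (Metric.isBounded_ball.subset Set.inter_subset_left)
    (fun t ht => (hXd t ht).continuousAt.continuousWithinAt) ?_
    ((continuousOn_pullbackVolume o hs σ).mono (by rintro _ ⟨t, ht, rfl⟩; exact hXC t ht)) hA hℓ
    (fun t ht a => (hn t ht a).2) (B := |F (m.G p)| / |V (m.G p)| + 1) ?_).2, ?_⟩
  · intro t ht t' ht' h
    rw [← ((hball t ht.1).1 ht.2).2.1, h, ((hball t' ht'.1).1 ht'.2).2.1]
  · intro t ht
    have htQ : ∀ᶠ t in 𝓝 t, t ∈ Q := hQo.mem_nhds ht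
    have hκ : ∀ a, ∃ κ : ℝ, |κ| = ‖deriv (d.par a).ℓ ((d.par a).σ (m.X t (Sum.inl a)))‖ ∧
        deriv (d.par a).ℓ ((d.par a).σ (m.X t (Sum.inl a))) = κ • s a (m.X t (Sum.inl a)) := by
      intro a
      obtain ⟨-, i, -, hi⟩ := hXC t ht
      have h1 := (hn t ht a).1
      rw [hi a] at h1 ⊢
      exact exists_deriv_eq_smul hL (d.par a) (hs a) h1
    choose κ hκ1 hκ2 using hκ
    have hX' := ((hXd t ht).differentiableAt (by simp)).hasFDerivAt
    have h1 := pullbackVolume_mul_det o s σ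
      (fun e => ((hXC t ht).1 _ _ (adj_ends o e)).symm) hX'
      (fderiv_eq_sum_coordVector (ℓ := fun a => (d.par a).ℓ)
        (fun a => (d.par a).contDiff_ℓ) hX' (hA t ht) (htQ.mono hℓ) hκ2)
    have h2 : directionMatrix (fun t => directionMap o (m.X t)) t = directionMatrix Θ t := by
      have h3 : ∀ e, (fun t => directionMap o (m.X t) e) =ᶠ[𝓝 t] fun t => Θ t e := by
        intro e
        filter_upwards [htQ] with t' ht'
        change directionMap o (m.X t') e = limitDirection o e (m.Φ t')
        rw [← hcan t' ht']
        exact (limitDirection_canon o e hL.isEmbedding.injective (hXC t' ht')).symm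
      ext r c
      rcases c with e | j
      · simp only [directionMatrix, (h3 e).self_of_nhds]
      · simp only [directionMatrix, (h3 r.1).fderiv_eq]
    have h4 : |∏ i, Sum.elim κ (fun _ : T × Fin 3 => 1) i| = |V t| := by
      rw [Fintype.prod_sum_type]
      simp only [Sum.elim_inl, Sum.elim_inr, Finset.prod_const_one, mul_one, Finset.abs_prod, hV,
        hκ1, abs_norm, hXpos t ht]
    have hVt : 0 < |V t| := by
      refine abs_pos.2 (Finset.prod_ne_zero_iff.2 fun a _ => norm_ne_zero_iff.2 ?_)
      rw [← hXpos t ht a]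
      exact (d.par a).deriv_ne ((d.par a).abs_lt_of_mem_interval (hn t ht a).2)
    rw [h2] at h1
    have h5 := congrArg abs h1
    rw [abs_mul, abs_mul, h4] at h5
    refine le_trans (le_of_eq ?_) (hball t ht.1).2.2.2.le
    rw [eq_div_iff hVt.ne', hF, ← h5]
    ring
  · have hGc := m.contDiffAt_G.self_of_nhds.continuousAt
    filter_upwards [m.X_G, hGc (Metric.ball_mem_nhds _ hε)] with e h1 h2 x hx hxe
    obtain ⟨h3, h4⟩ := h1 x hx hxe
    exact ⟨m.G e, ⟨h2, h3⟩, h4⟩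

theorem integralConverges (o : Γ.EdgeOrientation) {s : U → E3 → E3}
    (hs : ∀ a, IsUnitTangent L (s a))
    (σ : (Γ.graph.edgeSet ⊕ (U ⊕ (T × Fin 3))) ≃ (Γ.graph.edgeSet × Fin 3)) :
    IntegralConverges L o s σ := by
  have h : ∃ S : Set (U ⊕ T → E3), IntegrableOn (pullbackVolume o s σ) S (configMeasure L) ∧
      ∀ x ∈ Γ.configSpace L, Γ.canon x ∈ Γ.compactification L → x ∈ S := by
    refine (isCompact_compactification (Γ := Γ) hL.isEmbedding.injective
      hL.isEmbedding.continuous).induction_on (p := fun K : Set Γ.Ambient =>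
      ∃ S : Set (U ⊕ T → E3), IntegrableOn (pullbackVolume o s σ) S (configMeasure L) ∧
      ∀ x ∈ Γ.configSpace L, Γ.canon x ∈ K → x ∈ S) ?_ ?_ ?_ ?_
    · exact ⟨∅, integrableOn_empty, fun _ _ h => h⟩
    · rintro K K' hK ⟨S, h1, h2⟩
      exact ⟨S, h1, fun x hx hxK => h2 x hx (hK hxK)⟩
    · rintro K K' ⟨S, h1, h2⟩ ⟨S', h1', h2'⟩
      exact ⟨S ∪ S', h1.union h1', fun x hx hxK => hxK.imp (h2 x hx) (h2' x hx)⟩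
    · intro p hp
      obtain ⟨S, h1, h2⟩ := exists_integrableOn hL hp o hs σ
      exact ⟨_, mem_nhdsWithin_of_mem_nhds h2, S, h1, fun x hx hxe => hxe x hx rfl⟩
  obtain ⟨S, h1, h2⟩ := h
  exact h1.mono_set fun x hx => h2 x hx (subset_closure ⟨x, hx, rfl⟩)

end Diagram

end

theorem proposition1 {M : Type u} [TopologicalSpace M] [T2Space M] [CompactSpace M]
    [ChartedSpace (EuclideanHalfSpace 1) M] [IsManifold (𝓡∂ 1) ∞ M]
    {U : Type v} {T : Type w} [Fintype U] [Fintype T]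
    (L : M → E3) (hL : Manifold.IsSmoothEmbedding (𝓡∂ 1) 𝓘(ℝ, E3) ∞ L)
    (Γ : Diagram U T M) :
    (∃ (N : Type (max u v w)) (_ : TopologicalSpace N)
      (_ : ChartedSpace (EuclideanQuadrant (Fintype.card U + 3 * Fintype.card T)) N)
      (j : Γ.configSpace L → N),
      IsCornerCompactification (Fintype.card U + 3 * Fintype.card T) (Γ.configSpace L) N j ∧
      (∃ k : N → Γ.SphereProduct × (U → M),
        Γ.IsClosureMap L (Fintype.card U + 3 * Fintype.card T) j k ∧
        (Fintype.card U ≠ 1 →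
          Γ.IsImmersedEmbedding (Fintype.card U + 3 * Fintype.card T) k)) ∧
      ∀ o : Γ.EdgeOrientation, ∃ Ψ : N → Γ.graph.edgeSet → S2,
        (∀ (x : Γ.configSpace L) (e : Γ.graph.edgeSet),
          (Ψ (j x) e : E3) = Diagram.directionMap o x.1 e) ∧
        ∀ e : Γ.graph.edgeSet,
          ContMDiff (cornerModel (Fintype.card U + 3 * Fintype.card T)) (𝓡 2) ∞
            (fun p => Ψ p e)) ∧
    ∀ (o : Γ.EdgeOrientation) (s : U → E3 → E3)
      (σ : (Γ.graph.edgeSet ⊕ (U ⊕ (T × Fin 3))) ≃ (Γ.graph.edgeSet × Fin 3)),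
      (∀ a, Diagram.IsUnitTangent L (s a)) → Diagram.IntegralConverges L o s σ := by
  refine ⟨?_, fun o s σ hs => ?_⟩
  · obtain ⟨𝒜⟩ := Diagram.nonempty_cornerAtlas (Γ := Γ) hL
    refine ⟨𝒜.Space, inferInstance, inferInstance, 𝒜.incl, ?_, ⟨Diagram.canonicalMap hL 𝒜,
      Diagram.isClosureMap hL, Diagram.isImmersedEmbedding hL⟩, Diagram.exists_direction hL 𝒜⟩
    exact CornerAtlas.isCornerCompactification
      (Diagram.isCompact_compactification hL.isEmbedding.injective hL.isEmbedding.continuous)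
      fun x hx => Diagram.contDiffAt_canon hL.isEmbedding.injective hx
  · exact Diagram.integralConverges hL o hs σ
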